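/- Let $r>0$. A (planar) Tangle with curvature $1/r$ is a simple closed curve in the plane with continuously varying tangent direction that is a concatenation of finitely many quadrants (quarter-arcs) of circles of radius $r$; these quadrants are its links, and their endpoints are its joints. The region enclosed by the Tangle is the set of points off the curve whose connected component in the complement of the curve is bounded. The circles carrying the links of a Tangle belong to a square packing of the plane by circles of radius $r$, in which the joints are kissing points (for definiteness: the packing generated by the circle and the initial joint of one chosen link). Colour the circles of the packing like a chessboard, so that kissing circles have different colours, and call black the colour of those circles that carry a link and lie inside the Tangle; here a circle lies inside the Tangle if the open disk it bounds is contained in the enclosed region. The dual graph of the Tangle has as vertices the centers of the black circles lying inside the Tangle, and two vertices are joined by an edge if the segment between them does not meet the Tangle and meets no circle of the packing other than the two centered at its endpoints. The size of the Tangle is the number of edges of its dual graph. Theorem. The dual graph of every Tangle with curvature $1/r$ has finitely many edges, and if its size is $m$, then the Tangle encloses a region of area $(4m+\pi)r^2$. -/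

import Mathlib

/-- The quadrant of the circle with center `c` and radius `r` that starts at the point `c + r u`
(`u` a unit complex number) and is traversed counterclockwise if `σ = 1` and clockwise if
`σ = -1`, with constant speed for `t ∈ [0, 1]`. -/
noncomputable def quadrant (r : ℝ) (c u : ℂ) (σ : ℝ) (t : ℝ) : ℂ :=
  c + r * u * Complex.exp ((σ * (Real.pi / 2) * t : ℝ) * Complex.I)

/-- A (planar) Tangle with curvature `1 / r`: a simple closed curve in the plane `ℂ`, made of
`length` consecutive quadrants of circles of radius `r` (its links), and smooth in the sense that
its tangent is continuous. The closed curve is a `length`-periodic map on `ℝ`; its `k`-th link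
is the restriction to `[k, k + 1]`, run through with constant speed `π r / 2`, so that being `C¹`
is continuity of the tangent direction at the joints `curve k`. -/
structure Tangle (r : ℝ) where
  length : ℕ
  length_pos : 0 < length
  curve : ℝ → ℂ
  periodic : Function.Periodic curve (length : ℝ)
  injOn : Set.InjOn curve (Set.Ico 0 (length : ℝ))
  contDiff : ContDiff ℝ 1 curve
  /-- center of the circle that carries the `k`-th link -/
  center : ℤ → ℂ
  /-- unit vector from the center of the `k`-th link to its starting joint -/
  start : ℤ → ℂ
  norm_start : ∀ k, ‖start k‖ = 1
  /-- sense of rotation along the `k`-th link -/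
  sign : ℤ → ℝ
  sign_eq : ∀ k, sign k = 1 ∨ sign k = -1
  link : ∀ k : ℤ, ∀ t ∈ Set.Icc (0 : ℝ) 1,
    curve (k + t) = quadrant r (center k) (start k) (sign k) t

namespace Tangle

variable {r : ℝ} (T : Tangle r)

/-- The Tangle as a subset of the plane. -/
def carrier : Set ℂ := Set.range T.curve

/-- The region enclosed by the Tangle: the points off the curve whose connected component in the
complement of the curve is bounded. -/
def enclosed : Set ℂ :=
  {z | z ∈ T.carrierᶜ ∧ Bornology.IsBounded (connectedComponentIn T.carrierᶜ z)}

/-- Centers of the circles of radius `r` in the square packing of the plane in which the circle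
of the link `0` is one of the circles and the joints of that link are kissing points. -/
noncomputable def packingCenter (p : ℤ × ℤ) : ℂ :=
  T.center 0 + 2 * r * T.start 0 * ((p.1 : ℂ) + (p.2 : ℂ) * Complex.I)

/-- A circle of the packing lies inside the Tangle: the open disk it bounds is contained in the
enclosed region (the circle itself may share links with the Tangle). -/
def CircleInside (p : ℤ × ℤ) : Prop :=
  Metric.ball (T.packingCenter p) r ⊆ T.enclosed

/-- The packing is coloured like a chessboard. A circle is black if it has the colour of the
circles that carry a link and lie inside the Tangle. -/
def IsBlack (p : ℤ × ℤ) : Prop :=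
  ∃ (k : ℤ) (q : ℤ × ℤ), T.packingCenter q = T.center k ∧ T.CircleInside q ∧
    Even ((p.1 + p.2) - (q.1 + q.2))

/-- The vertices of the dual graph: the black circles inside the Tangle (each standing for its
center). -/
def dualVertices : Set (ℤ × ℤ) := {p | T.IsBlack p ∧ T.CircleInside p}

/-- The dual graph: two vertices are joined if the segment between the two centers does not meet
the Tangle and meets no other circle of the packing. -/
def dualGraph : SimpleGraph T.dualVertices where
  Adj p q := p ≠ q ∧
    Disjoint (segment ℝ (T.packingCenter p) (T.packingCenter q)) T.carrier ∧
    ∀ s : ℤ × ℤ, s ≠ p → s ≠ q →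
      Disjoint (segment ℝ (T.packingCenter p) (T.packingCenter q))
        (Metric.sphere (T.packingCenter s) r)
  symm := ⟨fun p q h => ⟨h.1.symm, by rw [segment_symm]; exact h.2.1,
    fun s hp hq => by rw [segment_symm]; exact h.2.2 s hq hp⟩⟩
  loopless := ⟨fun _ h => h.1 rfl⟩

/-- The size of a Tangle: the number of edges of its dual graph. -/
noncomputable def size : ℕ := T.dualGraph.edgeSet.ncard

end Tangle

/-! After a similarity the circles have radius 1 and centers `2 (a, b)`. The plane is then covered
by faces whose midpoints have integer coordinates of equal parity: disks (even) and gaps between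
four circles (odd). The unit squares spanned by a disk center and the midpoint of an adjacent gap
tile the plane up to a null set. In each of them one quadrant, which may or may not be a link,
separates a quarter disk of area `π/4` from a quarter gap of area `1 - π/4`. The interior of a face
is entirely enclosed or entirely not, so a square contributes `π/4 [disk inside] + (1 - π/4) [gap
inside] = [gap inside] + π/4 ([disk inside] - [gap inside])`.

The first terms add up to four times the number of gaps inside. A second term vanishes unless the
quadrant is a link, and there it is `π/4` or `-π/4` according to the side on which the interior
lies, that is, to the sense of rotation of the link compared with that of a link starting at a
lowest joint. The tangent of a simple closed curve turns exactly once (Hopf's Umlaufsatz,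
`exists_log_deriv_of_simple_closed`) and each link turns it by a right angle, so these signs add up
to 4 (`Tangle.sum_sign`, `sum_defect`). This is the summand `π` of the area.

It remains to match the gaps inside with the edges of the dual graph. Along the curve the sense of
rotation changes exactly when the carrying circle changes colour (`color_iff`), so a link on a black
circle has its disk inside and its gap outside. Hence no link separates a gap inside from the two
black ones among its four circles; these are diagonal neighbours, and the segment between their
centers runs through the gap. Conversely, an edge can only join diagonal neighbours, since any other
segment between black centers meets a third circle (`bijOn_edgeSet`).

"Inside" is made combinatorial by a Jordan curve theorem (`isBounded_comp_iff`). The parity of the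
number of links crossed by a diagonal ray changes between adjacent faces exactly across links and is
even far away, so odd faces lie in bounded components. Following the disk side and the gap side from
link to link shows that there are at most two components, and the one below a lowest joint is
unbounded. -/

/-! ### Turning of the tangent of a simple closed curve -/

theorem mem_Icc_zero_pi_of_sin_nonneg {g : ℝ → ℝ} {L : ℝ} (hL : 0 ≤ L)
    (hg : ContinuousOn g (Set.Icc 0 L)) (hsin : ∀ h ∈ Set.Icc 0 L, 0 ≤ Real.sin (g h))
    (h0 : g 0 ∈ Set.Icc 0 Real.pi) : g L ∈ Set.Icc 0 Real.pi := by
  have hpi := Real.pi_pos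
  have key : ∀ v, Real.sin v < 0 → ¬ v ∈ Set.uIcc (g 0) (g L) := by
    intro v hv hmem
    have := intermediate_value_uIcc (a := 0) (b := L) (f := g) (by rwa [Set.uIcc_of_le hL]) hmem
    obtain ⟨h, hh, rfl⟩ := this
    rw [Set.uIcc_of_le hL] at hh
    exact absurd (hsin h hh) (not_le.2 hv)
  constructor
  · by_contra! hlt
    -- Truncation at `-π/2` produces a value in `(-π, 0)`, where the sine is negative, that still
    -- lies between `g L` and `g 0`; `3π/2` plays the same role above `π`.
    refine key (max (g L) (-(Real.pi / 2))) ?_ ?_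
    · apply Real.sin_neg_of_neg_of_neg_pi_lt
      · exact max_lt hlt (by linarith)
      · exact lt_of_lt_of_le (by linarith) (le_max_right _ _)
    · rw [Set.mem_uIcc]
      exact Or.inr ⟨le_max_left _ _, max_le (by linarith [h0.1]) (by linarith [h0.1])⟩
  · by_contra! hlt
    refine key (min (g L) (3 * Real.pi / 2)) ?_ ?_
    · have h1 : Real.pi < min (g L) (3 * Real.pi / 2) := lt_min hlt (by linarith)
      have h2 : min (g L) (3 * Real.pi / 2) ≤ 3 * Real.pi / 2 := min_le_right _ _
      have := Real.sin_pos_of_pos_of_lt_pi (x := min (g L) (3 * Real.pi / 2) - Real.pi)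
        (by linarith) (by linarith)
      rw [Real.sin_sub_pi] at this
      linarith
    · rw [Set.mem_uIcc]
      exact Or.inl ⟨le_min (by linarith [h0.2]) (by linarith [h0.2]), min_le_left _ _⟩

/-- Along a path with values in the closed upper half plane that leads from a real number to its
opposite, the argument changes by `π` or `-π`. -/
theorem sub_eq_of_exp_im_nonneg {f : ℝ → ℂ} {L : ℝ} (hL : 0 ≤ L) (hf : Continuous f)
    (him : ∀ h ∈ Set.Icc 0 L, 0 ≤ (Complex.exp (f h)).im) (h0 : (Complex.exp (f 0)).im = 0)
    (hneg : Complex.exp (f L) = -Complex.exp (f 0)) :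
    (0 < (Complex.exp (f 0)).re → f L - f 0 = Real.pi * Complex.I) ∧
      ((Complex.exp (f 0)).re < 0 → f L - f 0 = -(Real.pi * Complex.I)) := by
  have hpi := Real.pi_pos
  have hsin : ∀ h ∈ Set.Icc 0 L, 0 ≤ Real.sin (f h).im := by
    intro h hh
    have := him h hh
    rw [Complex.exp_im] at this
    exact nonneg_of_mul_nonneg_right this (Real.exp_pos _)
  have hs0 : Real.sin (f 0).im = 0 := by
    rw [Complex.exp_im] at h0
    exact (mul_eq_zero.1 h0).resolve_left (Real.exp_pos _).ne'
  obtain ⟨j, hj⟩ : ∃ j : ℤ, f L - f 0 = Real.pi * Complex.I + j * (2 * Real.pi * Complex.I) := by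
    have : Complex.exp (f L) = Complex.exp (f 0 + Real.pi * Complex.I) := by
      rw [hneg, Complex.exp_add, Complex.exp_pi_mul_I]; ring
    obtain ⟨j, hj⟩ := Complex.exp_eq_exp_iff_exists_int.1 this
    exact ⟨j, by rw [hj]; ring⟩
  have hjim : (f L).im - (f 0).im = Real.pi + j * (2 * Real.pi) := by
    have := congrArg Complex.im hj
    simpa using this
  obtain ⟨m, hm⟩ := Real.sin_eq_zero_iff.1 hs0
  have hcts : ∀ k : ℤ, ContinuousOn (fun h => (f h).im - k * (2 * Real.pi)) (Set.Icc 0 L) :=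
    fun k => ((Complex.continuous_im.comp hf).sub continuous_const).continuousOn
  have hran : ∀ k : ℤ, (f 0).im - k * (2 * Real.pi) ∈ Set.Icc 0 Real.pi →
      (f L).im - k * (2 * Real.pi) ∈ Set.Icc 0 Real.pi := fun k hk =>
    mem_Icc_zero_pi_of_sin_nonneg (g := fun h => (f h).im - k * (2 * Real.pi)) hL (hcts k)
      (fun h hh => by rw [Real.sin_sub_int_mul_two_pi]; exact hsin h hh) hk
  have hcos : ∀ k : ℤ, Real.cos (f 0).im = Real.cos ((f 0).im - k * (2 * Real.pi)) := fun k =>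
    (Real.cos_sub_int_mul_two_pi _ _).symm
  have hre : (Complex.exp (f 0)).re = Real.exp (f 0).re * Real.cos (f 0).im := Complex.exp_re _
  have hexp := Real.exp_pos (f 0).re
  -- The initial argument is `m π`. Shifting by `2 π k` moves it to `0` or `π` according to the
  -- parity of `m`, that is, to the sign of the real number `exp (f 0)`. Confinement of the shifted
  -- argument to `[0, π]` then determines `j`.
  rcases Int.even_or_odd' m with ⟨k, rfl | rfl⟩
  · have e : (f 0).im - k * (2 * Real.pi) = 0 := by rw [← hm]; push_cast; ring
    have hc : Real.cos (f 0).im = 1 := by rw [hcos k, e, Real.cos_zero]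
    refine ⟨fun _ => ?_, fun h => ?_⟩
    · have := hran k (by rw [e]; exact ⟨le_rfl, hpi.le⟩)
      have e2 : (f L).im - k * (2 * Real.pi) = Real.pi + j * (2 * Real.pi) := by linarith
      rw [e2] at this
      have h1 : (j : ℝ) * 2 ≤ 0 := by nlinarith [this.2]
      have h2 : -1 ≤ (j : ℝ) * 2 := by nlinarith [this.1]
      have h3 : j = 0 := by
        have h1' : j * 2 ≤ 0 := by exact_mod_cast h1
        have h2' : -1 ≤ j * 2 := by exact_mod_cast h2
        omega
      rw [hj, h3]; simp
    · rw [hre, hc] at h; linarith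
  · have e : (f 0).im - k * (2 * Real.pi) = Real.pi := by rw [← hm]; push_cast; ring
    have hc : Real.cos (f 0).im = -1 := by rw [hcos k, e, Real.cos_pi]
    refine ⟨fun h => ?_, fun _ => ?_⟩
    · rw [hre, hc] at h; linarith
    · have := hran k (by rw [e]; exact ⟨hpi.le, le_rfl⟩)
      have e2 : (f L).im - k * (2 * Real.pi) = 2 * Real.pi + j * (2 * Real.pi) := by linarith
      rw [e2] at this
      have h1 : (j : ℝ) * 2 ≤ -1 := by nlinarith [this.2]
      have h2 : -2 ≤ (j : ℝ) * 2 := by nlinarith [this.1]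
      have h3 : j = -1 := by
        have h1' : j * 2 ≤ -1 := by exact_mod_cast h1
        have h2' : -2 ≤ j * 2 := by exact_mod_cast h2
        omega
      rw [hj, h3]; push_cast; ring

/-- A continuous logarithm of a constant function is constant. -/
theorem eq_of_exp_eq {X : Type*} [TopologicalSpace X] [PreconnectedSpace X] {G : X → ℂ}
    (hG : Continuous G) {c : ℂ} (h : ∀ x, Complex.exp (G x) = c) (x y : X) : G x = G y := by
  have hint : ∀ z, ∃ n : ℤ, G z = G y + n * (2 * Real.pi * Complex.I) := fun z =>
    Complex.exp_eq_exp_iff_exists_int.1 ((h z).trans (h y).symm)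
  set g : X → ℝ := fun z => (G z - G y).im / (2 * Real.pi) with hg
  have hgc : Continuous g := by fun_prop
  have hpi := Real.pi_pos
  have hgint : ∀ z, ∀ n : ℤ, G z = G y + n * (2 * Real.pi * Complex.I) → g z = n := by
    intro z n hn
    simp [hg, hn]
  have hgy : g y = 0 := by simp [hg]
  obtain ⟨n, hn⟩ := hint x
  have hgx := hgint x n hn
  -- `g` takes integer values only, so by the intermediate value theorem it cannot get past a
  -- half-integer.
  have hhalf : ∀ m : ℤ, (m : ℝ) + 1 / 2 ∉ Set.range g := by
    rintro m ⟨z, hz⟩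
    obtain ⟨k, hk⟩ := hint z
    rw [hgint z k hk] at hz
    have : (2 * k : ℝ) = 2 * m + 1 := by linarith
    have : 2 * k = 2 * m + 1 := by exact_mod_cast this
    omega
  rcases lt_trichotomy n 0 with hlt | rfl | hlt
  · have : (n : ℝ) ≤ -1 := by exact_mod_cast (by omega : n ≤ -1)
    exact absurd (mem_range_of_exists_le_of_exists_ge hgc ⟨x, by push_cast; linarith⟩
      ⟨y, by push_cast; linarith⟩) (hhalf (-1))
  · simpa using hn
  · have : (1 : ℝ) ≤ n := by exact_mod_cast (by omega : 1 ≤ n)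
    exact absurd (mem_range_of_exists_le_of_exists_ge hgc ⟨y, by push_cast; linarith⟩
      ⟨x, by push_cast; linarith⟩) (hhalf 0)

theorem isSimplyConnected_univ_of_contractible {X : Type*} [TopologicalSpace X]
    [ContractibleSpace X] : IsSimplyConnected (Set.univ : Set X) := by
  have : ContractibleSpace (Set.univ : Set X) :=
    (Homeomorph.Set.univ X).contractibleSpace_iff.2 inferInstance
  exact SimplyConnectedSpace.ofContractible _

/-- The difference quotient `(γ (s + h) - γ s) / h`, extended by `γ' s` to `h = 0`. -/
noncomputable def secant (γ : ℝ → ℂ) (p : ℝ × ℝ) : ℂ := ∫ u in (0 : ℝ)..1, deriv γ (p.1 + u * p.2)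

/-- The integral form makes joint continuity, also at `h = 0`, an instance of continuity of a
parametric integral. -/
theorem continuous_secant {γ : ℝ → ℂ} (hC : ContDiff ℝ 1 γ) : Continuous (secant γ) := by
  have h : Continuous (deriv γ) := hC.continuous_deriv le_rfl
  unfold secant
  apply intervalIntegral.continuous_parametric_intervalIntegral_of_continuous'
  unfold Function.uncurry
  fun_prop

theorem secant_zero (γ : ℝ → ℂ) (s : ℝ) : secant γ (s, 0) = deriv γ s := by
  simp [secant]

theorem mul_secant {γ : ℝ → ℂ} (hC : ContDiff ℝ 1 γ) (s h : ℝ) :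
    h * secant γ (s, h) = γ (s + h) - γ s := by
  have hc : Continuous (deriv γ) := hC.continuous_deriv le_rfl
  have := intervalIntegral.smul_integral_comp_add_mul (a := 0) (b := 1) (deriv γ) h s
  simp only [secant]
  have e : (∫ u in (0 : ℝ)..1, deriv γ (s + u * h)) = ∫ u in (0 : ℝ)..1, deriv γ (s + h * u) := by
    simp_rw [mul_comm]
  rw [e, ← Complex.real_smul, this]
  rw [intervalIntegral.integral_deriv_eq_sub (fun x _ => (hC.differentiable one_ne_zero) x)
    (hc.intervalIntegrable _ _)]
  simp

/-- Turning of the tangent of a simple closed plane curve, measured by a continuous logarithm of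
the velocity. -/
theorem exists_log_deriv_of_simple_closed {γ : ℝ → ℂ} {L : ℝ} (hL : 0 < L)
    (hper : Function.Periodic γ L) (hinj : Set.InjOn γ (Set.Ico 0 L)) (hC : ContDiff ℝ 1 γ)
    (hne : ∀ s, deriv γ s ≠ 0) (s₀ : ℝ) (hmin : ∀ s, (γ s₀).im ≤ (γ s).im) :
    ∃ θ : ℝ → ℂ, Continuous θ ∧ (∀ s, L * Complex.exp (θ s) = deriv γ s) ∧
      (0 < (deriv γ s₀).re → θ L - θ 0 = 2 * Real.pi * Complex.I) ∧
      ((deriv γ s₀).re < 0 → θ L - θ 0 = -(2 * Real.pi * Complex.I)) := by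
  have hLC : (L : ℂ) ≠ 0 := by exact_mod_cast hL.ne'
  have hderper : Function.Periodic (deriv γ) L := by
    intro s
    rw [← deriv_comp_add_const γ L s]
    congr 1
    exact funext hper
  have hsec := continuous_secant hC
  have hinj' : ∀ s h, 0 < h → h < L → γ (s + h) ≠ γ s := by
    intro s h h0 h1 heq
    obtain ⟨m, hm⟩ : ∃ m : ℤ, s - m • L ∈ Set.Ico 0 L :=
      ⟨toIcoDiv hL 0 s, by simpa using sub_toIcoDiv_zsmul_mem_Ico hL 0 s⟩
    set y := s - m • L with hy
    have hys : γ y = γ s := hper.sub_zsmul_eq m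
    have hyh : γ (y + h) = γ s := by
      rw [← heq, ← hper.sub_zsmul_eq (x := s + h) m]
      congr 1
      rw [hy]; ring
    by_cases hlt : y + h < L
    · have := hinj ⟨by linarith [hm.1], hlt⟩ hm (hyh.trans hys.symm)
      linarith
    · have := hinj ⟨by linarith, by linarith [hm.2]⟩ hm
        ((hper.sub_eq (y + h)).trans (hyh.trans hys.symm))
      linarith
  have hsne : ∀ s h, 0 ≤ h → h < L → secant γ (s, h) ≠ 0 := by
    intro s h h0 h1 hz
    rcases h0.eq_or_lt with rfl | h0
    · rw [secant_zero] at hz; exact hne s hz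
    · have := mul_secant hC s h
      rw [hz, mul_zero] at this
      exact hinj' s h h0 h1 (sub_eq_zero.1 this.symm)
  -- Clamping `h` to `[0, L]` lets everything be defined on the whole of `ℝ × ℝ`, where simple
  -- connectedness yields a logarithm.
  set cl : ℝ → ℝ := fun h => max 0 (min h L) with hcl
  have hclc : Continuous cl := by fun_prop
  have hcl0 : ∀ h, 0 ≤ cl h := fun h => le_max_left _ _
  have hclL : ∀ h, cl h ≤ L := fun h => max_le hL.le (min_le_right _ _)
  have hclid : ∀ h ∈ Set.Icc 0 L, cl h = h := by
    intro h hh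
    simp [hcl, hh.1, hh.2]
  -- For `0 < h < L` this is `(γ (s + h) - γ s) / (h (L - h))`, with limits `γ' s / L` at `h = 0`
  -- and `-γ' s / L` at `h = L`. The second formula uses the complementary chord from `s + h` to `s
  -- + L`; each formula has a nonzero denominator on its own half.
  set H : ℝ × ℝ → ℂ := fun p => if cl p.2 ≤ L / 2 then secant γ (p.1, cl p.2) / (L - cl p.2 : ℝ)
    else -secant γ (p.1 + cl p.2, L - cl p.2) / (cl p.2 : ℝ) with hH
  have hHc : Continuous H := by
    -- `min` and `max` with `L / 2` change nothing on the half where the formula is used, but keep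
    -- both denominators away from zero everywhere.
    have key : Continuous fun p : ℝ × ℝ => if cl p.2 ≤ L / 2 then
        secant γ (p.1, min (cl p.2) (L / 2)) / (L - min (cl p.2) (L / 2) : ℝ)
        else -secant γ (p.1 + cl p.2, L - cl p.2) / (max (cl p.2) (L / 2) : ℝ) := by
      refine Continuous.if_le ?_ ?_ (by fun_prop) continuous_const ?_
      · refine (hsec.comp (by fun_prop)).div (by fun_prop) fun p => ?_
        have := min_le_right (cl p.2) (L / 2)
        exact_mod_cast (by linarith : 0 < L - min (cl p.2) (L / 2)).ne'
      · refine (hsec.comp (by fun_prop)).neg.div (by fun_prop) fun p => ?_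
        have := le_max_right (cl p.2) (L / 2)
        exact_mod_cast (by linarith : 0 < max (cl p.2) (L / 2)).ne'
      · intro p hp
        rw [hp, min_self, max_self]
        have e1 := mul_secant hC p.1 (L / 2)
        have e2 := mul_secant hC (p.1 + L / 2) (L / 2)
        have e3 : L - L / 2 = L / 2 := by ring
        have e4 : p.1 + L / 2 + L / 2 = p.1 + L := by ring
        rw [e4, hper] at e2
        rw [e3]
        congr 1
        have h2 : ((L / 2 : ℝ) : ℂ) ≠ 0 := by exact_mod_cast (by linarith : 0 < L / 2).ne'
        apply mul_left_cancel₀ h2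
        rw [mul_neg, e1, e2]
        ring
    convert key using 2 with p
    rw [hH]
    dsimp only
    split_ifs with h
    · rw [min_eq_left h]
    · rw [max_eq_left (not_le.1 h).le]
  have hHne : ∀ p, H p ≠ 0 := by
    intro p
    rw [hH]
    dsimp only
    split_ifs with h
    · refine div_ne_zero (hsne _ _ (hcl0 _) (by linarith)) ?_
      exact_mod_cast (by linarith : 0 < L - cl p.2).ne'
    · rw [not_le] at h
      refine div_ne_zero (neg_ne_zero.2 (hsne _ _ (by linarith [hclL p.2]) (by linarith))) ?_
      exact_mod_cast (by linarith : 0 < cl p.2).ne'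
  have hH0 : ∀ s, H (s, 0) = deriv γ s / L := by
    intro s
    have : cl 0 = 0 := hclid 0 ⟨le_rfl, hL.le⟩
    simp only [hH, this, secant_zero, sub_zero]
    rw [if_pos (by linarith)]
  have hHL : ∀ s, H (s, L) = -deriv γ s / L := by
    intro s
    have : cl L = L := hclid L ⟨hL.le, le_rfl⟩
    simp only [hH, this, secant_zero, sub_self]
    rw [if_neg (by linarith), hderper]
  have hHmul : ∀ s, ∀ h ∈ Set.Ioo 0 L, (h * (L - h) : ℂ) * H (s, h) = γ (s + h) - γ s := by
    intro s h hh
    have h1 : (h : ℂ) ≠ 0 := by exact_mod_cast hh.1.ne'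
    have h2 : (L - h : ℂ) ≠ 0 := by exact_mod_cast (sub_pos.2 hh.2).ne'
    have e : cl h = h := hclid h ⟨hh.1.le, hh.2.le⟩
    simp only [hH, e]
    split_ifs
    · rw [← mul_secant hC]; push_cast; field_simp
    · have := mul_secant hC (s + h) (L - h)
      rw [show s + h + (L - h) = s + L by ring, hper] at this
      rw [← neg_sub (γ s), ← this]; push_cast; field_simp
  have hHsymm : ∀ s, ∀ h ∈ Set.Icc 0 L, H (s + h, L - h) = -H (s, h) := by
    intro s h hh
    rcases hh.1.eq_or_lt with rfl | h0
    · rw [sub_zero, add_zero, hHL, hH0, neg_div]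
    rcases hh.2.eq_or_lt with rfl | h1
    · rw [sub_self, hHL, hH0, neg_div, neg_neg, hderper]
    have a1 := hHmul s h ⟨h0, h1⟩
    have a2 := hHmul (s + h) (L - h) ⟨by linarith, by linarith⟩
    rw [show s + h + (L - h) = s + L by ring, hper] at a2
    have h3 : (h : ℂ) ≠ 0 := by exact_mod_cast h0.ne'
    have h4 : (L - h : ℂ) ≠ 0 := by exact_mod_cast (sub_pos.2 h1).ne'
    apply mul_left_cancel₀ (mul_ne_zero h3 h4)
    rw [mul_neg, a1, neg_sub, ← a2]
    push_cast; ring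
  obtain ⟨F, hFc, hF⟩ := Complex.exists_continuousOn_eqOn_exp_comp (X := ℝ × ℝ) (U := Set.univ)
    (g := H) isSimplyConnected_univ_of_contractible isOpen_univ hHc.continuousOn (by rintro ⟨p, -, hp⟩; exact hHne p hp)
  rw [continuousOn_univ] at hFc
  have hF' : ∀ p, Complex.exp (F p) = H p := fun p => hF (Set.mem_univ p)
  -- The same chord read backwards has the opposite value of `H`. The difference of the two
  -- logarithms thus has exponential `-1` throughout and is constant.
  have hconst : ∀ s, ∀ h ∈ Set.Icc 0 L, F (s + h, L - h) - F (s, h) = F (s₀, L) - F (s₀, 0) := by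
    have key := eq_of_exp_eq (X := ℝ × ℝ)
      (G := fun p => F (p.1 + cl p.2, L - cl p.2) - F (p.1, cl p.2)) (by fun_prop)
      (c := -1) (fun p => by
        rw [Complex.exp_sub, hF', hF', hHsymm _ _ ⟨hcl0 _, hclL _⟩, neg_div,
          div_self (hHne _)])
    intro s h hh
    have := key (s, h) (s₀, 0)
    simpa [hclid h hh, hclid 0 ⟨le_rfl, hL.le⟩] using this
  -- The constant difference is used at `(0, 0)` and at `(0, L)`: from `(0, 0)` through `(0, L)` to
  -- `(L, 0)` the logarithm gains it twice.
  have htot : F (L, 0) - F (0, 0) = 2 * (F (s₀, L) - F (s₀, 0)) := by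
    have h1 := hconst 0 0 ⟨le_rfl, hL.le⟩
    have h2 := hconst 0 L ⟨hL.le, le_rfl⟩
    simp only [add_zero, sub_zero, zero_add, sub_self] at h1 h2
    rw [two_mul]
    nth_rw 1 [← h1]
    rw [← h2]
    ring
  have hder0 : (deriv γ s₀).im = 0 := by
    have h1 : HasDerivAt (fun s => (γ s).im) (deriv γ s₀).im s₀ :=
      Complex.imCLM.hasFDerivAt.comp_hasDerivAt s₀
        ((hC.differentiable one_ne_zero) s₀).hasDerivAt
    exact IsLocalMin.hasDerivAt_eq_zero (Filter.Eventually.of_forall hmin) h1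
  -- Seen from a lowest point of the curve, all other points lie in the closed upper half plane, and
  -- so do the chord directions.
  have hHim : ∀ h ∈ Set.Icc 0 L, 0 ≤ (H (s₀, h)).im := by
    intro h hh
    rcases hh.1.eq_or_lt with rfl | h0
    · rw [hH0, Complex.div_ofReal_im, hder0, zero_div]
    rcases hh.2.eq_or_lt with rfl | h1
    · rw [hHL, Complex.div_ofReal_im, Complex.neg_im, hder0, neg_zero, zero_div]
    have a1 := congrArg Complex.im (hHmul s₀ h ⟨h0, h1⟩)
    rw [← Complex.ofReal_sub, ← Complex.ofReal_mul, Complex.im_ofReal_mul, Complex.sub_im] at a1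
    have a2 : 0 < h * (L - h) := mul_pos h0 (sub_pos.2 h1)
    refine nonneg_of_mul_nonneg_right ?_ a2
    rw [a1]
    exact sub_nonneg.2 (hmin _)
  have hleg := sub_eq_of_exp_im_nonneg (f := fun h => F (s₀, h)) hL.le (by fun_prop)
    (fun h hh => by rw [hF']; exact hHim h hh)
    (by rw [hF', hH0, Complex.div_ofReal_im, hder0, zero_div])
    (by rw [hF', hF', hH0, hHL, neg_div])
  simp only [hF', hH0] at hleg
  refine ⟨fun s => F (s, 0), by fun_prop, fun s => ?_, fun h => ?_, fun h => ?_⟩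
  · rw [hF', hH0]; field_simp
  · rw [htot, hleg.1 ?_]
    · ring
    · rw [Complex.div_ofReal_re]; positivity
  · rw [htot, hleg.2 ?_]
    · ring
    · rw [Complex.div_ofReal_re]; exact div_neg_of_neg_of_pos h hL

/-! ### Velocity of the links and lattice coordinates of their circles -/

theorem hasDerivAt_quadrant (r : ℝ) (c u : ℂ) (σ t : ℝ) :
    HasDerivAt (quadrant r c u σ) (r * u * (σ * (Real.pi / 2) * Complex.I) *
      Complex.exp ((σ * (Real.pi / 2) * t : ℝ) * Complex.I)) t := by
  have h1 : HasDerivAt (fun t : ℝ => ((σ * (Real.pi / 2) * t : ℝ) : ℂ) * Complex.I)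
      (((σ * (Real.pi / 2) * 1 : ℝ) : ℂ) * Complex.I) t :=
    (HasDerivAt.ofReal_comp ((hasDerivAt_id t).const_mul _)).mul_const _
  have h2 := ((h1.cexp).const_mul (r * u)).const_add c
  refine h2.congr_deriv ?_
  push_cast
  ring

theorem exp_sign_mul_pi_div_two {σ : ℝ} (h : σ = 1 ∨ σ = -1) :
    Complex.exp ((σ * (Real.pi / 2) * 1 : ℝ) * Complex.I) = σ * Complex.I := by
  rcases h with rfl | rfl
  · simp [Complex.exp_pi_div_two_mul_I]
  · simp only [mul_one, neg_mul, one_mul, Complex.ofReal_neg, Complex.exp_neg]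
    push_cast
    rw [Complex.exp_pi_div_two_mul_I, Complex.inv_I]
    simp

namespace Tangle

variable {r : ℝ} (T : Tangle r)

/-- Differentiation of the quadrant gives the formula inside the link; continuity of the derivative
carries it to the two joints. -/
theorem deriv_curve (k : ℤ) {t : ℝ} (ht : t ∈ Set.Icc (0 : ℝ) 1) :
    deriv T.curve (k + t) = r * T.start k * (T.sign k * (Real.pi / 2) * Complex.I) *
      Complex.exp ((T.sign k * (Real.pi / 2) * t : ℝ) * Complex.I) := by
  have hc : Continuous (deriv T.curve) := T.contDiff.continuous_deriv le_rfl
  have hIoo : Set.EqOn (fun t : ℝ => deriv T.curve (k + t))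
      (fun t : ℝ => r * T.start k * (T.sign k * (Real.pi / 2) * Complex.I) *
      Complex.exp ((T.sign k * (Real.pi / 2) * t : ℝ) * Complex.I)) (Set.Ioo 0 1) := by
    intro t ht
    have hq := hasDerivAt_quadrant r (T.center k) (T.start k) (T.sign k) t
    have : (fun t : ℝ => T.curve (k + t)) =ᶠ[nhds t]
        quadrant r (T.center k) (T.start k) (T.sign k) := by
      filter_upwards [Ioo_mem_nhds ht.1 ht.2] with x hx
      exact T.link k x ⟨hx.1.le, hx.2.le⟩
    have h2 := (hq.congr_of_eventuallyEq this).deriv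
    rw [deriv_comp_const_add] at h2
    exact h2
  have hcl := hIoo.closure (by fun_prop) (by fun_prop)
  rw [closure_Ioo zero_ne_one] at hcl
  exact hcl ht

theorem curve_int (k : ℤ) : T.curve k = T.center k + r * T.start k := by
  have := T.link k 0 ⟨le_rfl, zero_le_one⟩
  simpa [quadrant] using this

theorem curve_int_succ (k : ℤ) :
    T.curve (k + 1) = T.center k + r * T.start k * (T.sign k * Complex.I) := by
  have := T.link k 1 ⟨zero_le_one, le_rfl⟩
  rwa [quadrant, exp_sign_mul_pi_div_two (T.sign_eq k)] at this

theorem sign_sq (k : ℤ) : (T.sign k : ℂ) * T.sign k = 1 := by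
  rcases T.sign_eq k with h | h <;> simp [h]

/-- Equality of velocities at the joint: the outgoing velocity `(r π / 2) σ' i u'` must equal the
incoming one, which is `-(r π / 2) u`. -/
theorem start_succ (hr : 0 < r) (k : ℤ) :
    T.start (k + 1) = T.sign (k + 1) * Complex.I * T.start k := by
  have hrC : (r : ℂ) ≠ 0 := by exact_mod_cast hr.ne'
  have hpi : (Real.pi : ℂ) ≠ 0 := by exact_mod_cast Real.pi_ne_zero
  have h1 := T.deriv_curve k (t := 1) ⟨zero_le_one, le_rfl⟩
  have h2 := T.deriv_curve (k + 1) (t := 0) ⟨le_rfl, zero_le_one⟩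
  rw [exp_sign_mul_pi_div_two (T.sign_eq k)] at h1
  simp only [mul_zero, Complex.ofReal_zero, zero_mul, Complex.exp_zero, mul_one, add_zero] at h2
  push_cast at h2
  rw [h2] at h1
  have h3 : (r * Real.pi : ℂ) * (T.sign (k + 1) * T.start (k + 1)) =
      (r * Real.pi : ℂ) * (Complex.I * T.start k) := by
    have e := T.sign_sq k
    have hI := Complex.I_mul_I
    linear_combination (-2 * Complex.I) * h1 +
      (r * Real.pi * T.sign (k + 1) * T.start (k + 1) -
        r * Real.pi * Complex.I * T.start k * T.sign k * T.sign k) * hI +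
      r * Real.pi * Complex.I * T.start k * e
  have h4 := mul_left_cancel₀ (mul_ne_zero hrC hpi) h3
  linear_combination T.sign (k + 1) * h4 - T.start (k + 1) * T.sign_sq (k + 1)

/-- With equal signs the curve stays on its circle; with opposite signs it passes to the circle that
kisses the old one at the joint. -/
theorem center_succ (hr : 0 < r) (k : ℤ) :
    T.center (k + 1) = T.center k +
      r * ((T.sign k - T.sign (k + 1)) * Complex.I * T.start k) := by
  have h1 := T.curve_int_succ k
  have h2 := T.curve_int (k + 1)
  push_cast at h2
  rw [T.start_succ hr, h1] at h2
  linear_combination -h2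

/-- Normalization of a Tangle: the similarity that takes the unit circle with its point `1` to
the circle of the link `0` with its initial joint. -/
noncomputable def frame (z : ℂ) : ℂ := T.center 0 + r * T.start 0 * z

theorem start_ne_zero (k : ℤ) : T.start k ≠ 0 := fun h => by
  have := T.norm_start k
  simp [h] at this

theorem frame_injective (hr : 0 < r) : Function.Injective T.frame := by
  intro z w h
  have hrC : (r : ℂ) ≠ 0 := by exact_mod_cast hr.ne'
  exact mul_left_cancel₀ (mul_ne_zero hrC (T.start_ne_zero 0)) (add_left_cancel h)

theorem exists_int_sign (k : ℤ) : ∃ s : ℤ, (s = 1 ∨ s = -1) ∧ T.sign k = s := by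
  rcases T.sign_eq k with h | h
  · exact ⟨1, Or.inl rfl, by simp [h]⟩
  · exact ⟨-1, Or.inr rfl, by simp [h]⟩

/-- Two signs differ by an even number `2 d`, so the recursions for center and start preserve the
lattice of the packing. Running them in both directions from link `0` reaches every link. -/
theorem exists_int_coordinates (hr : 0 < r) (k : ℤ) :
    ∃ px py ux uy : ℤ, T.center k = T.frame (2 * (px + py * Complex.I)) ∧
      T.start k = T.start 0 * (ux + uy * Complex.I) ∧
      ((ux = 1 ∧ uy = 0) ∨ (ux = 0 ∧ uy = 1) ∨ (ux = -1 ∧ uy = 0) ∨ (ux = 0 ∧ uy = -1)) := by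
  have hI := Complex.I_mul_I
  induction k using Int.induction_on with
  | zero => exact ⟨0, 0, 1, 0, by simp [frame], by simp, by simp⟩
  | succ k ih =>
    obtain ⟨px, py, ux, uy, hc, hu, h4⟩ := ih
    obtain ⟨s, hs, hs'⟩ := T.exists_int_sign k
    obtain ⟨s', hs1, hs1'⟩ := T.exists_int_sign (k + 1)
    obtain ⟨d, hd⟩ : ∃ d, s - s' = 2 * d := by
      rcases hs with rfl | rfl <;> rcases hs1 with rfl | rfl
      exacts [⟨0, rfl⟩, ⟨1, rfl⟩, ⟨-1, rfl⟩, ⟨0, rfl⟩]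
    have hd' : (s - s' : ℂ) = 2 * d := by exact_mod_cast hd
    refine ⟨px - d * uy, py + d * ux, -s' * uy, s' * ux, ?_, ?_, ?_⟩
    · rw [T.center_succ hr, hc, hu, hs', hs1']
      simp only [frame]
      push_cast
      rw [hd']
      linear_combination (r * 2 * d * T.start 0 * uy) * hI
    · rw [T.start_succ hr, hu, hs1']
      push_cast
      linear_combination (s' * T.start 0 * uy) * hI
    · rcases hs1 with rfl | rfl <;> omega
  | pred k ih =>
    obtain ⟨px, py, ux, uy, hc, hu, h4⟩ := ih
    obtain ⟨k', hk'⟩ : ∃ k' : ℤ, k' = -k - 1 := ⟨_, rfl⟩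
    rw [← hk']
    have hk : (-k : ℤ) = k' + 1 := by omega
    rw [hk] at hc hu
    obtain ⟨s, hs, hs'⟩ := T.exists_int_sign k'
    obtain ⟨s', hs1, hs1'⟩ := T.exists_int_sign (k' + 1)
    obtain ⟨d, hd⟩ : ∃ d, s - s' = 2 * d := by
      rcases hs with rfl | rfl <;> rcases hs1 with rfl | rfl
      exacts [⟨0, rfl⟩, ⟨1, rfl⟩, ⟨-1, rfl⟩, ⟨0, rfl⟩]
    have hd' : (s - s' : ℂ) = 2 * d := by exact_mod_cast hd
    have hsq : (s' * s' : ℂ) = 1 := by rcases hs1 with rfl | rfl <;> simp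
    have hu' : T.start k' = T.start 0 * ((s' * uy : ℤ) + (-s' * ux : ℤ) * Complex.I) := by
      have := T.start_succ hr k'
      rw [hu, hs1'] at this
      push_cast at this ⊢
      linear_combination (s' * Complex.I) * this +
        (- s' * T.start 0 * uy + s' * s' * T.start k') * hI - T.start k' * hsq
    refine ⟨px - d * (s' * ux), py - d * (s' * uy), s' * uy, -s' * ux, ?_, hu', ?_⟩
    · have := T.center_succ hr k'
      rw [hc, hu', hs', hs1'] at this
      simp only [frame] at this ⊢
      push_cast at this ⊢
      rw [hd'] at this
      linear_combination -this + (r * 2 * d * s' * ux * T.start 0) * hI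
    · rcases hs1 with rfl | rfl <;> omega

end Tangle

/-- The combinatorial data of a smooth simple closed curve made of quadrants of circles of radius
`1`, carried by the packing by the circles with centers `2 (a, b)`. The `k`-th link starts at the
point `2 (px k, py k) + (ux k, uy k)` and has sense of rotation `s k`. -/
structure GridLoop where
  n : ℕ
  n_pos : 0 < n
  px : ℤ → ℤ
  py : ℤ → ℤ
  ux : ℤ → ℤ
  uy : ℤ → ℤ
  s : ℤ → ℤ
  s_eq : ∀ k, s k = 1 ∨ s k = -1
  unit : ∀ k, (ux k = 1 ∧ uy k = 0) ∨ (ux k = 0 ∧ uy k = 1) ∨ (ux k = -1 ∧ uy k = 0) ∨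
    (ux k = 0 ∧ uy k = -1)
  ux_succ : ∀ k, ux (k + 1) = -(s (k + 1) * uy k)
  uy_succ : ∀ k, uy (k + 1) = s (k + 1) * ux k
  px_succ : ∀ k, 2 * px (k + 1) = 2 * px k - (s k - s (k + 1)) * uy k
  py_succ : ∀ k, 2 * py (k + 1) = 2 * py k + (s k - s (k + 1)) * ux k
  periodic_x : ∀ k, 2 * px (k + n) + ux (k + n) = 2 * px k + ux k
  periodic_y : ∀ k, 2 * py (k + n) + uy (k + n) = 2 * py k + uy k
  inj : ∀ k l, 2 * px k + ux k = 2 * px l + ux l → 2 * py k + uy k = 2 * py l + uy l →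
    (n : ℤ) ∣ k - l
  base : ℤ
  base_le : ∀ k, 2 * py base + uy base ≤ 2 * py k + uy k

/-! ### The lowest joint of a grid loop -/

namespace GridLoop

variable (G : GridLoop)

/-- The points of the curve. -/
def carrier : Set ℂ :=
  {z | ∃ k, (z.re - 2 * G.px k) ^ 2 + (z.im - 2 * G.py k) ^ 2 = 1 ∧
    0 ≤ G.ux k * (z.re - 2 * G.px k) + G.uy k * (z.im - 2 * G.py k) ∧
    0 ≤ G.s k * (G.ux k * (z.im - 2 * G.py k) - G.uy k * (z.re - 2 * G.px k))}

/-- A joint at the side of its circle has a vertical tangent and hence a lower neighbouring joint;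
from the top of its circle the next joint is lower. Only the bottom remains. -/
theorem base_unit : G.ux G.base = 0 ∧ G.uy G.base = -1 := by
  have h1 := G.base_le (G.base + 1)
  have h2 := G.base_le (G.base - 1)
  have a2 := G.uy_succ G.base
  have a4 := G.py_succ G.base
  obtain ⟨k, hk⟩ : ∃ k, k = G.base - 1 := ⟨_, rfl⟩
  have hb : G.base = k + 1 := by omega
  rw [← hk] at h2
  have b1 := G.ux_succ k
  have b2 := G.uy_succ k
  have b4 := G.py_succ k
  rw [← hb] at b1 b2 b4
  rcases G.s_eq (G.base + 1) with hs | hs <;> rcases G.s_eq G.base with hs1 | hs1 <;>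
  rcases G.s_eq k with hs2 | hs2 <;> rw [hs1, hs2] at b4 <;> rw [hs1] at b1 b2 a4 <;>
  rw [hs] at a2 a4 <;> have := G.unit G.base <;> omega

/-- No point of the curve is lower than its base joint. -/
theorem base_le_im {z : ℂ} (hz : z ∈ G.carrier) :
    ((2 * G.py G.base + G.uy G.base : ℤ) : ℝ) ≤ z.im := by
  obtain ⟨k, h1, h2, h3⟩ := hz
  have b1 := G.base_le k
  have b2 := G.base_le (k + 1)
  have b3 := G.uy_succ k
  have b4 := G.py_succ k
  have hle : ((2 * G.py G.base + G.uy G.base : ℤ) : ℝ) ≤ 2 * G.py k + G.uy k := by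
    exact_mod_cast b1
  have hle' : ((2 * G.py G.base + G.uy G.base : ℤ) : ℝ) ≤ 2 * G.py k + G.s k * G.ux k := by
    have : 2 * G.py G.base + G.uy G.base ≤ 2 * G.py k + G.s k * G.ux k := by
      rw [b3, b4] at b2
      linarith
    exact_mod_cast this
  have h4 : -1 ≤ z.im - 2 * G.py k := by nlinarith [sq_nonneg (z.re - 2 * G.px k)]
  -- A quadrant between two axis points of its circle is lowest at one of its ends, whose heights
  -- are bounded by `hle` and `hle'`.
  rcases G.s_eq k with hs | hs <;> rcases G.unit k with h | h | h | h <;>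
  simp only [h.1, h.2, hs, Int.cast_one, Int.cast_neg, Int.cast_zero] at * <;> linarith

end GridLoop

/-! ### From a Tangle to its grid loop -/

theorem exists_exp_eq {w : ℂ} (hw : ‖w‖ = 1) (hre : 0 ≤ w.re) (him : 0 ≤ w.im) :
    ∃ t ∈ Set.Icc (0 : ℝ) 1, Complex.exp ((Real.pi / 2 * t : ℝ) * Complex.I) = w := by
  have hpi := Real.pi_pos
  have h1 := Complex.arg_nonneg_iff.2 him
  have h2 := le_of_abs_le (Complex.abs_arg_le_pi_div_two_iff.2 hre)
  refine ⟨w.arg / (Real.pi / 2), ⟨by positivity, (div_le_one (by positivity)).2 h2⟩, ?_⟩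
  rw [mul_div_cancel₀ _ (by positivity : Real.pi / 2 ≠ 0)]
  have := Complex.norm_mul_exp_arg_mul_I w
  rwa [hw, Complex.ofReal_one, one_mul] at this

theorem exists_exp_sign_eq_iff {σ : ℝ} (hσ : σ = 1 ∨ σ = -1) (w : ℂ) :
    (∃ t ∈ Set.Icc (0 : ℝ) 1, Complex.exp ((σ * (Real.pi / 2) * t : ℝ) * Complex.I) = w) ↔
      w.re ^ 2 + w.im ^ 2 = 1 ∧ 0 ≤ w.re ∧ 0 ≤ σ * w.im := by
  have hpi := Real.pi_pos
  constructor
  · rintro ⟨t, ht, rfl⟩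
    rw [Complex.exp_ofReal_mul_I_re, Complex.exp_ofReal_mul_I_im]
    refine ⟨Real.cos_sq_add_sin_sq _, ?_, ?_⟩
    · have h0 : 0 ≤ Real.pi / 2 * t := mul_nonneg (by positivity) ht.1
      have h1 : Real.pi / 2 * t ≤ Real.pi / 2 := mul_le_of_le_one_right (by positivity) ht.2
      apply Real.cos_nonneg_of_neg_pi_div_two_le_of_le <;> rcases hσ with rfl | rfl <;> linarith
    · have h0 : 0 ≤ Real.sin (Real.pi / 2 * t) := by
        apply Real.sin_nonneg_of_nonneg_of_le_pi (mul_nonneg (by positivity) ht.1)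
        have h1 : Real.pi / 2 * t ≤ Real.pi / 2 := mul_le_of_le_one_right (by positivity) ht.2
        linarith
      rcases hσ with rfl | rfl
      · simpa using h0
      · simpa using h0
  · rintro ⟨h1, h2, h3⟩
    have hn : ‖w‖ = 1 := by
      rw [Complex.norm_eq_sqrt_sq_add_sq, h1, Real.sqrt_one]
    rcases hσ with rfl | rfl
    · simpa using exists_exp_eq hn h2 (by simpa using h3)
    -- Complex conjugation turns a clockwise quadrant into a counterclockwise one.
    · obtain ⟨t, ht, h⟩ := exists_exp_eq (w := (starRingEnd ℂ) w) (by rwa [RCLike.norm_conj])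
        (by simpa using h2) (by simpa using h3)
      refine ⟨t, ht, ?_⟩
      rw [← Complex.conj_conj w, ← h, ← Complex.exp_conj, map_mul, Complex.conj_I,
        Complex.conj_ofReal]
      push_cast
      ring_nf

namespace Tangle

variable {r : ℝ} (T : Tangle r)

theorem curve_mem_link (k : ℤ) (t : ℝ) (ht : t ∈ Set.Icc (0 : ℝ) 1) {px py ux uy : ℤ}
    (hc : T.center k = T.frame (2 * (px + py * Complex.I)))
    (hu : T.start k = T.start 0 * (ux + uy * Complex.I)) :
    T.curve (k + t) = T.frame (2 * (px + py * Complex.I) + (ux + uy * Complex.I) *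
      Complex.exp ((T.sign k * (Real.pi / 2) * t : ℝ) * Complex.I)) := by
  rw [T.link k t ht, quadrant, hc, hu]
  simp only [frame]
  ring

theorem range_eq_iUnion_links : T.carrier =
    {z | ∃ k : ℤ, ∃ t ∈ Set.Icc (0 : ℝ) 1, z = T.curve (k + t)} := by
  ext z
  constructor
  · rintro ⟨x, rfl⟩
    exact ⟨⌊x⌋, Int.fract x, ⟨Int.fract_nonneg x, (Int.fract_lt_one x).le⟩,
      by rw [Int.floor_add_fract]⟩
  · rintro ⟨k, t, -, rfl⟩
    exact ⟨_, rfl⟩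

/-- The direction of the tangent turns once in all, in the sense of the link that starts at a
lowest joint. -/
theorem sum_sign (hr : 0 < r) {g : ℝ → ℂ} (hg : ∀ t, T.curve t = T.frame (g t)) (b : ℤ)
    (hb : ∀ t, (g b).im ≤ (g t).im) (hub : T.start b = T.start 0 * (-Complex.I)) :
    ∑ k ∈ Finset.range T.length, T.sign k = 4 * T.sign b := by
  have hpi := Real.pi_pos
  have hrC : (r : ℂ) ≠ 0 := by exact_mod_cast hr.ne'
  have hne := mul_ne_zero hrC (T.start_ne_zero 0)
  have hg' : g = fun t => (T.curve t - T.center 0) / (r * T.start 0) := by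
    ext t
    rw [hg]
    simp only [frame]
    rw [add_sub_cancel_left, mul_div_cancel_left₀ _ hne]
  have hder : ∀ t, deriv g t = deriv T.curve t / (r * T.start 0) := by
    intro t
    rw [hg']
    simp
  have hlink : ∀ (k : ℤ) (t : ℝ), t ∈ Set.Icc (0 : ℝ) 1 → deriv g (k + t) =
      T.start k / T.start 0 * (T.sign k * (Real.pi / 2) * Complex.I) *
      Complex.exp ((T.sign k * (Real.pi / 2) * t : ℝ) * Complex.I) := by
    intro k t ht
    have h0 := T.start_ne_zero 0
    rw [hder, T.deriv_curve k ht]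
    field_simp
  have hsne : ∀ k, (T.sign k : ℂ) ≠ 0 := fun k => by
    rcases T.sign_eq k with h | h <;> simp [h]
  have hpiC : (Real.pi : ℂ) ≠ 0 := by exact_mod_cast hpi.ne'
  have hL : (0 : ℝ) < T.length := by exact_mod_cast T.length_pos
  obtain ⟨θ, hθ, hexp, h1, h2⟩ := exists_log_deriv_of_simple_closed (γ := g) (L := T.length) hL
    (by rw [hg']; intro t; simp only [T.periodic t])
    (by
      intro x hx y hy h
      refine T.injOn hx hy ?_
      rw [hg, hg, h])
    (by rw [hg']; exact (T.contDiff.sub contDiff_const).div_const _)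
    (by
      intro x
      have := hlink ⌊x⌋ (Int.fract x) ⟨Int.fract_nonneg x, (Int.fract_lt_one x).le⟩
      rw [Int.floor_add_fract] at this
      rw [this]
      refine mul_ne_zero (mul_ne_zero (div_ne_zero (T.start_ne_zero _) (T.start_ne_zero _))
        (mul_ne_zero (mul_ne_zero (hsne _) ?_) Complex.I_ne_zero)) (Complex.exp_ne_zero _)
      exact div_ne_zero hpiC two_ne_zero)
    b hb
  -- Along a link the velocity is a constant times an exponential with explicit linear exponent.
  -- Subtracting this exponent from `θ` leaves a logarithm of a constant, so `θ` grows like the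
  -- exponent. The clamp extends the link to all of `ℝ`.
  have hstep : ∀ k : ℤ, θ (k + 1) - θ k = T.sign k * (Real.pi / 2) * Complex.I := by
    intro k
    set cl : ℝ → ℝ := fun h => max 0 (min h 1) with hcl
    have key := eq_of_exp_eq (X := ℝ)
      (G := fun t => θ (k + cl t) - ((T.sign k * (Real.pi / 2) * cl t : ℝ) * Complex.I))
      (by fun_prop)
      (c := (T.start k / T.start 0 * (T.sign k * (Real.pi / 2) * Complex.I)) / T.length) (by
        intro t
        have ht : cl t ∈ Set.Icc (0 : ℝ) 1 :=
          ⟨le_max_left _ _, max_le zero_le_one (min_le_right _ _)⟩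
        have h3 := hexp (k + cl t)
        rw [hlink k _ ht] at h3
        rw [Complex.exp_sub, div_eq_iff (Complex.exp_ne_zero _), div_mul_eq_mul_div,
          eq_div_iff (by exact_mod_cast hL.ne'), ← h3]
        push_cast
        ring) 1 0
    have e1 : cl 1 = 1 := by simp [hcl]
    have e0 : cl 0 = 0 := by simp [hcl]
    simp only [e1, e0, mul_one, mul_zero, Complex.ofReal_zero, zero_mul, sub_zero, add_zero] at key
    rw [sub_eq_iff_eq_add] at key
    rw [key]
    push_cast
    ring
  have hsum : ∀ n : ℕ, θ n - θ 0 =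
      (∑ k ∈ Finset.range n, (T.sign k : ℂ)) * ((Real.pi / 2) * Complex.I) := by
    intro n
    induction n with
    | zero => simp
    | succ n ih =>
      rw [Finset.sum_range_succ, add_mul, ← ih]
      have := hstep n
      push_cast at this ⊢
      rw [← sub_add_sub_cancel _ (θ n), this]
      ring
  -- At the lowest joint the start vector is `-i`, so the velocity is real with the sign of the
  -- link. This sign selects the case of the turning theorem.
  have hb' : deriv g b = T.sign b * (Real.pi / 2) := by
    have := hlink b 0 ⟨le_rfl, zero_le_one⟩
    rw [hub, mul_div_cancel_left₀ _ (T.start_ne_zero 0)] at this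
    simp only [add_zero, mul_zero, Complex.ofReal_zero, zero_mul, Complex.exp_zero, mul_one]
      at this
    rw [this]
    linear_combination (-(T.sign b) * (Real.pi / 2) : ℂ) * Complex.I_mul_I
  have hre : (deriv g b).re = T.sign b * (Real.pi / 2) := by
    rw [hb']
    exact_mod_cast Complex.ofReal_re (T.sign b * (Real.pi / 2))
  have hfin : (∑ k ∈ Finset.range T.length, (T.sign k : ℂ)) * ((Real.pi / 2) * Complex.I) =
      4 * T.sign b * ((Real.pi / 2) * Complex.I) := by
    rw [← hsum]
    rcases T.sign_eq b with h | h
    · rw [h1 (by rw [hre, h]; positivity), h]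
      push_cast
      ring
    · rw [h2 (by rw [hre, h]; linarith), h]
      push_cast
      ring
  have := mul_right_cancel₀ (mul_ne_zero (div_ne_zero hpiC two_ne_zero) Complex.I_ne_zero) hfin
  exact_mod_cast this

/-- The combinatorial part of the proof sees the Tangle only through these three facts; the sum of
signs is the analytic input from the turning of the tangent. -/
theorem exists_gridLoop (hr : 0 < r) : ∃ G : GridLoop,
    T.carrier = T.frame '' G.carrier ∧
      (∀ k, T.center k = T.frame (2 * (G.px k + G.py k * Complex.I))) ∧
      ∑ k ∈ Finset.range G.n, G.s k = 4 * G.s G.base := by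
  choose px py ux uy hc hu h4 using T.exists_int_coordinates hr
  choose s hs hs' using T.exists_int_sign
  have hinj := T.frame_injective hr
  have hfr : ∀ a b c d : ℤ, T.frame (a + b * Complex.I) = T.frame (c + d * Complex.I) →
      a = c ∧ b = d := by
    intro a b c d h
    have := hinj h
    have h1 := congrArg Complex.re this
    have h2 := congrArg Complex.im this
    simp at h1 h2
    exact ⟨h1, h2⟩
  have hjoint : ∀ k : ℤ, T.curve k = T.frame ((2 * px k + ux k : ℤ) +
      (2 * py k + uy k : ℤ) * Complex.I) := by
    intro k
    rw [T.curve_int, hc, hu]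
    simp only [frame]
    push_cast
    ring
  have hst : ∀ a b c d : ℤ, T.start 0 * (a + b * Complex.I) = T.start 0 * (c + d * Complex.I) →
      a = c ∧ b = d := by
    intro a b c d h
    have := mul_left_cancel₀ (T.start_ne_zero 0) h
    have h1 := congrArg Complex.re this
    have h2 := congrArg Complex.im this
    simp at h1 h2
    exact ⟨h1, h2⟩
  have husucc : ∀ k, ux (k + 1) = -(s (k + 1) * uy k) ∧ uy (k + 1) = s (k + 1) * ux k := by
    intro k
    have := T.start_succ hr k
    rw [hu (k + 1), hu k, hs'] at this
    apply hst
    rw [this]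
    push_cast
    linear_combination (s (k + 1) * T.start 0 * uy k) * Complex.I_mul_I
  have hpsucc : ∀ k, 2 * px (k + 1) = 2 * px k - (s k - s (k + 1)) * uy k ∧
      2 * py (k + 1) = 2 * py k + (s k - s (k + 1)) * ux k := by
    intro k
    have := T.center_succ hr k
    rw [hc, hc, hu, hs', hs'] at this
    apply hfr
    simp only [frame] at this ⊢
    push_cast at this ⊢
    linear_combination this + (r * T.start 0 * (s k - s (k + 1)) * uy k) * Complex.I_mul_I
  have hper : ∀ k : ℤ, T.curve ((k + T.length : ℤ) : ℝ) = T.curve k := by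
    intro k
    push_cast
    exact T.periodic k
  have hdvd : ∀ k l : ℤ, T.curve k = T.curve l → (T.length : ℤ) ∣ k - l := by
    intro k l h
    have hpos : (0 : ℤ) < T.length := by exact_mod_cast T.length_pos
    have hmod : ∀ k : ℤ, T.curve ((k % T.length : ℤ) : ℝ) = T.curve k ∧
        ((k % T.length : ℤ) : ℝ) ∈ Set.Ico (0 : ℝ) T.length := by
      intro k
      refine ⟨?_, ?_, ?_⟩
      · rw [Int.emod_def]
        have := T.periodic.sub_int_mul_eq (x := (k : ℝ)) (k / T.length)
        rw [← this]
        congr 1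
        push_cast
        ring
      · exact_mod_cast Int.emod_nonneg k hpos.ne'
      · exact_mod_cast Int.emod_lt_of_pos k hpos
    have := T.injOn (hmod k).2 (hmod l).2 (by rw [(hmod k).1, (hmod l).1, h])
    exact Int.ModEq.dvd (show l ≡ k [ZMOD T.length] from (by exact_mod_cast this.symm))
  obtain ⟨b, -, hb⟩ := Finset.exists_min_image (Finset.range T.length)
    (fun k : ℕ => 2 * py k + uy k) ⟨0, by simpa using T.length_pos⟩
  have hble : ∀ k, 2 * py b + uy b ≤ 2 * py k + uy k := by
    intro k
    have hpos : (0 : ℤ) < T.length := by exact_mod_cast T.length_pos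
    obtain ⟨m, hm⟩ := Int.eq_ofNat_of_zero_le (Int.emod_nonneg k hpos.ne')
    have hm1 : m ∈ Finset.range T.length := by
      have := Int.emod_lt_of_pos k hpos
      rw [Finset.mem_range]
      omega
    refine (hb m hm1).trans (le_of_eq ?_)
    have e : T.curve (m : ℤ) = T.curve k := by
      rw [show (m : ℤ) = k - (k / T.length : ℤ) * T.length by rw [← hm, Int.emod_def]; ring]
      push_cast
      exact T.periodic.sub_int_mul_eq (x := (k : ℝ)) (k / T.length)
    rw [hjoint, hjoint] at e
    exact (hfr _ _ _ _ e).2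
  let G : GridLoop :=
    { n := T.length
      n_pos := T.length_pos
      px := px
      py := py
      ux := ux
      uy := uy
      s := s
      s_eq := hs
      unit := h4
      ux_succ := fun k => (husucc k).1
      uy_succ := fun k => (husucc k).2
      px_succ := fun k => (hpsucc k).1
      py_succ := fun k => (hpsucc k).2
      periodic_x := fun k => by
        have := hper k
        rw [hjoint, hjoint] at this
        exact (hfr _ _ _ _ this).1
      periodic_y := fun k => by
        have := hper k
        rw [hjoint, hjoint] at this
        exact (hfr _ _ _ _ this).2
      inj := fun k l h1 h2 => hdvd k l (by rw [hjoint, hjoint, h1, h2])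
      base := b
      base_le := hble }
  have hlink : ∀ z, z ∈ G.carrier ↔ ∃ k : ℤ, ∃ t ∈ Set.Icc (0 : ℝ) 1,
      T.frame z = T.curve (k + t) := by
    intro z
    refine exists_congr fun k => ?_
    have e1 : (ux k : ℝ) ^ 2 + (uy k : ℝ) ^ 2 = 1 := by
      rcases h4 k with h | h | h | h <;> rw [h.1, h.2] <;> norm_num
    have e1C : (ux k : ℂ) ^ 2 + (uy k : ℂ) ^ 2 = 1 := by exact_mod_cast e1
    -- Multiplication by the conjugate of the unit vector `ux + uy i` rotates the link so that it
    -- starts at `1`.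
    have key := exists_exp_sign_eq_iff (T.sign_eq k)
      ((z - 2 * (px k + py k * Complex.I)) * (ux k - uy k * Complex.I))
    have ere : ((z - 2 * (px k + py k * Complex.I)) * (ux k - uy k * Complex.I)).re =
        ux k * (z.re - 2 * px k) + uy k * (z.im - 2 * py k) := by
      simp
      ring
    have eim : ((z - 2 * (px k + py k * Complex.I)) * (ux k - uy k * Complex.I)).im =
        ux k * (z.im - 2 * py k) - uy k * (z.re - 2 * px k) := by
      simp
      ring
    rw [ere, eim, hs'] at key
    have e2 : (z.re - 2 * px k) ^ 2 + (z.im - 2 * py k) ^ 2 =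
        (ux k * (z.re - 2 * px k) + uy k * (z.im - 2 * py k)) ^ 2 +
        (ux k * (z.im - 2 * py k) - uy k * (z.re - 2 * px k)) ^ 2 := by
      linear_combination (-((z.re - 2 * px k) ^ 2) - (z.im - 2 * py k) ^ 2) * e1
    change (z.re - 2 * px k) ^ 2 + (z.im - 2 * py k) ^ 2 = 1 ∧ _ ↔ _
    rw [e2]
    refine key.symm.trans (exists_congr fun t => and_congr_right fun ht => ?_)
    rw [T.curve_mem_link k t ht (hc k) (hu k), hinj.eq_iff, hs']
    constructor
    · intro h
      rw [h]
      linear_combination (-(z - 2 * (px k + py k * Complex.I))) * e1C +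
        ((z - 2 * (px k + py k * Complex.I)) * (uy k) ^ 2) * Complex.I_mul_I
    · intro h
      rw [h]
      linear_combination (-Complex.exp ((s k * (Real.pi / 2) * t : ℝ) * Complex.I)) * e1C +
        (Complex.exp ((s k * (Real.pi / 2) * t : ℝ) * Complex.I) *
          (uy k) ^ 2) * Complex.I_mul_I
  have hrC : (r : ℂ) ≠ 0 := by exact_mod_cast hr.ne'
  have hne := mul_ne_zero hrC (T.start_ne_zero 0)
  have hnorm : ∀ z, T.frame ((z - T.center 0) / (r * T.start 0)) = z := by
    intro z
    simp only [frame]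
    rw [mul_div_cancel₀ _ hne, add_sub_cancel]
  have hcar : T.carrier = T.frame '' G.carrier := by
    ext z
    rw [T.range_eq_iUnion_links]
    constructor
    · rintro ⟨k, t, ht, rfl⟩
      refine ⟨_, (hlink _).2 ⟨k, t, ht, ?_⟩, hnorm _⟩
      rw [hnorm]
    · rintro ⟨z, hz, rfl⟩
      exact (hlink z).1 hz
  refine ⟨G, hcar, hc, ?_⟩
  have hG := G.base_unit
  have key := T.sum_sign hr (g := fun t => (T.curve t - T.center 0) / (r * T.start 0))
    (fun t => (hnorm _).symm) b ?_ ?_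
  · simp only [hs'] at key
    exact_mod_cast key
  · intro t
    have h1 : (((T.curve b) - T.center 0) / (r * T.start 0)) =
        ((2 * px b + ux b : ℤ) + (2 * py b + uy b : ℤ) * Complex.I) := by
      apply hinj
      rw [hnorm]
      exact hjoint b
    have h2 : (T.curve t - T.center 0) / (r * T.start 0) ∈ G.carrier := by
      rw [hlink, hnorm]
      exact ⟨⌊t⌋, Int.fract t, ⟨Int.fract_nonneg t, (Int.fract_lt_one t).le⟩,
        by rw [Int.floor_add_fract]⟩
    have h3 := G.base_le_im h2
    have h5 : (((T.curve b) - T.center 0) / (r * T.start 0)).im = 2 * py b + uy b := by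
      rw [h1]
      simp
    push_cast
    rw [h5]
    exact_mod_cast h3
  · rw [hu]
    have e1 : ux b = 0 := hG.1
    have e2 : uy b = -1 := hG.2
    rw [e1, e2]
    simp

end Tangle

/-! ### Joints, used squares and crossing parity -/

namespace GridLoop

variable (G : GridLoop)

/-- The `k`-th joint. -/
def jx (k : ℤ) : ℤ := 2 * G.px k + G.ux k

/-- The `k`-th joint. -/
def jy (k : ℤ) : ℤ := 2 * G.py k + G.uy k

/-- The diagonal direction in which the `k`-th link lies, seen from the center of its circle. -/
def dx (k : ℤ) : ℤ := G.ux k - G.s k * G.uy k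

/-- The diagonal direction in which the `k`-th link lies, seen from the center of its circle. -/
def dy (k : ℤ) : ℤ := G.uy k + G.s k * G.ux k

/-- Twice the midpoint of the unit square that contains the `k`-th link. -/
def ex (k : ℤ) : ℤ := 4 * G.px k + G.dx k

/-- Twice the midpoint of the unit square that contains the `k`-th link. -/
def ey (k : ℤ) : ℤ := 4 * G.py k + G.dy k

/-- Collects the facts about a single link in a form on which `omega` can do the later case
analyses. -/
theorem link (k : ℤ) : (G.dx k = 1 ∨ G.dx k = -1) ∧ (G.dy k = 1 ∨ G.dy k = -1) ∧
    ((G.ux k = G.dx k ∧ G.uy k = 0) ∨ (G.ux k = 0 ∧ G.uy k = G.dy k)) ∧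
    G.jx (k + 1) = 2 * G.px k + G.dx k - G.ux k ∧ G.jy (k + 1) = 2 * G.py k + G.dy k - G.uy k := by
  have h1 := G.ux_succ k
  have h2 := G.uy_succ k
  have h3 := G.px_succ k
  have h4 := G.py_succ k
  unfold jx jy dx dy
  rcases G.s_eq k with hs | hs <;> rcases G.s_eq (k + 1) with ht | ht <;>
  simp only [hs, ht] at * <;> have := G.unit k <;> omega

/-- A link arrives at its end in direction `-u`. Whether the curve keeps its circle or changes it,
the gap of the next link therefore lies one step ahead of the joint in that direction. -/
theorem joint (k : ℤ) :
    ((G.s (k + 1) = G.s k ∧ G.px (k + 1) = G.px k ∧ G.py (k + 1) = G.py k) ∨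
      (G.s (k + 1) = -G.s k ∧ G.px (k + 1) = G.px k + (G.dx k - G.ux k) ∧
        G.py (k + 1) = G.py k + (G.dy k - G.uy k))) ∧
    2 * G.px (k + 1) + G.dx (k + 1) = G.jx (k + 1) - G.ux k ∧
    2 * G.py (k + 1) + G.dy (k + 1) = G.jy (k + 1) - G.uy k := by
  have h1 := G.ux_succ k
  have h2 := G.uy_succ k
  have h3 := G.px_succ k
  have h4 := G.py_succ k
  unfold jx jy dx dy
  rcases G.s_eq k with hs | hs <;> rcases G.s_eq (k + 1) with ht | ht <;>
  rw [ht] at h1 h2 <;> rw [hs, ht] at h3 h4 <;> have := G.unit k <;> rw [hs, ht, h1, h2] <;> omega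

theorem ex_eq (k : ℤ) : G.ex k = G.jx k + G.jx (k + 1) := by
  have := G.link k
  unfold ex
  rw [this.2.2.2.1, jx]
  ring

theorem ey_eq (k : ℤ) : G.ey k = G.jy k + G.jy (k + 1) := by
  have := G.link k
  unfold ey
  rw [this.2.2.2.2, jy]
  ring

theorem j_step (k : ℤ) : (G.jx (k + 1) = G.jx k + 1 ∨ G.jx (k + 1) = G.jx k - 1) ∧
    (G.jy (k + 1) = G.jy k + 1 ∨ G.jy (k + 1) = G.jy k - 1) ∧ ¬ 2 ∣ G.jx k - G.jy k := by
  have := G.link k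
  have h : G.jx k = 2 * G.px k + G.ux k := rfl
  have h' : G.jy k = 2 * G.py k + G.uy k := rfl
  omega

/-- Smoothness enters here: two consecutive links lie on opposite sides of the normal at their
joint, so they cannot run through the same square. -/
theorem not_backtrack (k : ℤ) : ¬ (G.jx (k + 1 + 1) = G.jx k ∧ G.jy (k + 1 + 1) = G.jy k) := by
  have := G.link k
  have := G.link (k + 1)
  have := G.joint k
  have h : G.jx k = 2 * G.px k + G.ux k := rfl
  have h' : G.jy k = 2 * G.py k + G.uy k := rfl
  have h1 : G.jx (k + 1) = 2 * G.px (k + 1) + G.ux (k + 1) := rfl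
  have h1' : G.jy (k + 1) = 2 * G.py (k + 1) + G.uy (k + 1) := rfl
  omega

theorem j_periodic (k m : ℤ) : G.jx (k + m * G.n) = G.jx k ∧ G.jy (k + m * G.n) = G.jy k := by
  have hp : ∀ k, G.jx (k + G.n) = G.jx k ∧ G.jy (k + G.n) = G.jy k := fun k =>
    ⟨G.periodic_x k, G.periodic_y k⟩
  induction m using Int.induction_on generalizing k with
  | zero => simp
  | succ m ih =>
    rw [show k + ((m : ℤ) + 1) * G.n = k + m * G.n + G.n by ring, (hp _).1, (hp _).2]
    exact ih k
  | pred m ih =>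
    rw [← (hp (k + (-(m : ℤ) - 1) * G.n)).1, ← (hp (k + (-(m : ℤ) - 1) * G.n)).2,
      show k + (-(m : ℤ) - 1) * G.n + G.n = k + -(m : ℤ) * G.n by ring]
    exact ih k

theorem j_eq_iff (k l : ℤ) : (G.jx k = G.jx l ∧ G.jy k = G.jy l) ↔ (G.n : ℤ) ∣ k - l := by
  constructor
  · rintro ⟨h1, h2⟩
    exact G.inj k l h1 h2
  · rintro ⟨m, hm⟩
    rw [show k = l + m * G.n by linarith]
    exact G.j_periodic l m

theorem e_congr {k l : ℤ} (h : (G.n : ℤ) ∣ k - l) : G.ex k = G.ex l ∧ G.ey k = G.ey l := by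
  have h1 := (G.j_eq_iff k l).2 h
  have h2 := (G.j_eq_iff (k + 1) (l + 1)).2 (by rwa [add_sub_add_right_eq_sub])
  rw [ex_eq, ex_eq, ey_eq, ey_eq, h1.1, h1.2, h2.1, h2.2]
  exact ⟨rfl, rfl⟩

/-- A square has only two corners that can be joints. Two links in it either start at the same
joint, or one starts where the other ends and leads back, which would be backtracking. -/
theorem e_inj {k l : ℤ} (hx : G.ex k = G.ex l) (hy : G.ey k = G.ey l) : (G.n : ℤ) ∣ k - l := by
  rw [ex_eq, ex_eq] at hx
  rw [ey_eq, ey_eq] at hy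
  have h1 := G.j_step k
  have h2 := G.j_step l
  rw [← j_eq_iff]
  by_contra hne
  have h3 : G.jx l = G.jx (k + 1) ∧ G.jy l = G.jy (k + 1) ∧ G.jx (l + 1) = G.jx k ∧
      G.jy (l + 1) = G.jy k := by omega
  have h4 := (G.j_eq_iff l (k + 1)).1 ⟨h3.1, h3.2.1⟩
  have h5 := (G.j_eq_iff (l + 1) (k + 1 + 1)).2 (by rwa [add_sub_add_right_eq_sub])
  exact G.not_backtrack k ⟨by rw [← h5.1, h3.2.2.1], by rw [← h5.2, h3.2.2.2]⟩

/-- A unit square, given by twice its midpoint, is used if it contains a link. -/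
def Used (a b : ℤ) : Prop := ∃ k, G.ex k = a ∧ G.ey k = b

theorem Used.exists_range {a b : ℤ} (h : G.Used a b) :
    ∃ k ∈ Finset.range G.n, G.ex k = a ∧ G.ey k = b := by
  obtain ⟨k, hk⟩ := h
  have hpos : (0 : ℤ) < G.n := by exact_mod_cast G.n_pos
  obtain ⟨m, hm⟩ := Int.eq_ofNat_of_zero_le (Int.emod_nonneg k hpos.ne')
  have hlt := Int.emod_lt_of_pos k hpos
  refine ⟨m, by rw [Finset.mem_range]; omega, ?_⟩
  have := G.e_congr (k := m) (l := k) (by rw [← hm]; exact Int.ModEq.dvd (Int.mod_modEq k G.n).symm)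
  rwa [this.1, this.2]

open Classical in
theorem sum_used (a b : ℤ) : (∑ k ∈ Finset.range G.n,
    if G.ex k = a ∧ G.ey k = b then (1 : ℤ) else 0) = if G.Used a b then 1 else 0 := by
  split_ifs with h
  · obtain ⟨k, hk, h1, h2⟩ := h.exists_range
    rw [Finset.sum_eq_single_of_mem k hk, if_pos ⟨h1, h2⟩]
    intro l hl hlk
    rw [if_neg]
    rintro ⟨h3, h4⟩
    have := G.e_inj (k := l) (l := k) (h3.trans h1.symm) (h4.trans h2.symm)
    rw [Finset.mem_range] at hk hl
    have := Int.eq_zero_of_abs_lt_dvd this (by rw [abs_lt]; omega)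
    omega
  · refine Finset.sum_eq_zero fun k _ => if_neg fun hk => h ⟨k, hk⟩

/-- The number of links that the diagonal ray from `(a, b)` in direction `(1, 1)` crosses. -/
def crossings (a b : ℤ) : ℤ := ∑ k ∈ Finset.range G.n,
  if G.ex k - 2 * a = G.ey k - 2 * b ∧ 1 ≤ G.ex k - 2 * a then 1 else 0

open Classical in
theorem crossings_diag (a b : ℤ) : G.crossings a b = G.crossings (a + 1) (b + 1) +
    if G.Used (2 * a + 1) (2 * b + 1) then 1 else 0 := by
  rw [← sum_used, crossings, crossings, ← Finset.sum_add_distrib]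
  refine Finset.sum_congr rfl fun k _ => ?_
  have := G.link k
  have h1 : G.ex k = 4 * G.px k + G.dx k := rfl
  have h2 : G.ey k = 4 * G.py k + G.dy k := rfl
  split_ifs <;> omega

-- Between the two parallel rays lies a half-diagonal of joints, marked by `h`. A link changes `h`
-- exactly if it lies in a square on one of the rays or in the square between the two starting
-- faces. Around the closed curve the changes of `h` cancel, so the number of such links is even.
open Classical in
theorem crossings_antidiag (a b : ℤ) (hab : 2 ∣ a - b) :
    2 ∣ G.crossings a b + G.crossings (a - 1) (b + 1) +
      if G.Used (2 * a - 1) (2 * b + 1) then 1 else 0 := by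
  rw [← sum_used, crossings, crossings, ← Finset.sum_add_distrib, ← Finset.sum_add_distrib]
  set h : ℤ → ℤ := fun k => if G.jx k - a = G.jy k - b - 1 ∧ a ≤ G.jx k then 1 else 0 with hh
  have hsum : ∑ k ∈ Finset.range G.n, (h (k + 1 : ℤ) - h k) = 0 := by
    have := Finset.sum_range_sub (fun k : ℕ => h k) G.n
    push_cast at this
    rw [this, hh]
    have := G.j_periodic 0 1
    simp only [zero_add, one_mul] at this
    simp only [this.1, this.2, sub_self]
  have key : ∀ k ∈ Finset.range G.n, (2 : ℤ) ∣
      ((((if G.ex k - 2 * a = G.ey k - 2 * b ∧ 1 ≤ G.ex k - 2 * a then 1 else 0) +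
      if G.ex k - 2 * (a - 1) = G.ey k - 2 * (b + 1) ∧ 1 ≤ G.ex k - 2 * (a - 1) then 1 else 0) +
      if G.ex k = 2 * a - 1 ∧ G.ey k = 2 * b + 1 then 1 else 0) - (h (k + 1 : ℤ) - h k)) := by
    intro k _
    rw [hh, ex_eq, ey_eq]
    dsimp only
    have := G.j_step k
    split_ifs <;> omega
  have := Finset.dvd_sum key
  rwa [Finset.sum_sub_distrib, hsum, sub_zero] at this

theorem exists_bound : ∃ N : ℤ, ∀ k, |G.ex k| ≤ N ∧ |G.ey k| ≤ N := by
  refine ⟨∑ k ∈ Finset.range G.n, (|G.ex k| + |G.ey k|), fun k => ?_⟩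
  obtain ⟨m, hm, h1, h2⟩ := Used.exists_range G ⟨k, rfl, rfl⟩
  have := Finset.single_le_sum (f := fun k : ℕ => |G.ex k| + |G.ey k|)
    (fun k _ => add_nonneg (abs_nonneg _) (abs_nonneg _)) hm
  simp only [h1, h2] at this
  constructor
  · linarith [abs_nonneg (G.ey k)]
  · linarith [abs_nonneg (G.ex k)]

/-- The face with midpoint `(a, b)` is surrounded by the curve. -/
def Odd (a b : ℤ) : Prop := ¬ 2 ∣ G.crossings a b

/-- Passing from a face to a neighbouring one changes parity exactly if a link separates them. -/
theorem odd_iff_odd {a b a' b' : ℤ} (hab : 2 ∣ a - b) (ha : a' = a + 1 ∨ a' = a - 1)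
    (hb : b' = b + 1 ∨ b' = b - 1) : (G.Odd a b ↔ G.Odd a' b') ↔ ¬ G.Used (a + a') (b + b') := by
  classical
  unfold Odd
  rcases ha with rfl | rfl <;> rcases hb with rfl | rfl
  · have := G.crossings_diag a b
    rw [show a + (a + 1) = 2 * a + 1 by ring, show b + (b + 1) = 2 * b + 1 by ring]
    split_ifs at this with h <;>
    simp only [h, not_true_eq_false, not_false_eq_true, iff_true, iff_false] <;> omega
  · have := G.crossings_antidiag (a + 1) (b - 1) (by omega)
    rw [show a + (a + 1) = 2 * (a + 1) - 1 by ring, show b + (b - 1) = 2 * (b - 1) + 1 by ring]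
    simp only [add_sub_cancel_right, sub_add_cancel] at this
    split_ifs at this with h <;>
    simp only [h, not_true_eq_false, not_false_eq_true, iff_true, iff_false] <;> omega
  · have := G.crossings_antidiag a b hab
    rw [show a + (a - 1) = 2 * a - 1 by ring, show b + (b + 1) = 2 * b + 1 by ring]
    split_ifs at this with h <;>
    simp only [h, not_true_eq_false, not_false_eq_true, iff_true, iff_false] <;> omega
  · have := G.crossings_diag (a - 1) (b - 1)
    rw [show a + (a - 1) = 2 * (a - 1) + 1 by ring, show b + (b - 1) = 2 * (b - 1) + 1 by ring]
    simp only [sub_add_cancel] at this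
    split_ifs at this with h <;>
    simp only [h, not_true_eq_false, not_false_eq_true, iff_true, iff_false] <;> omega

/-- To the right of or above the curve the ray crosses nothing. From a face far to the left or far
below, antidiagonal steps lead past the curve to such a place without crossing a link. -/
theorem exists_bound_odd : ∃ N : ℤ, ∀ a b, 2 ∣ a - b → G.Odd a b → |a| ≤ N ∧ |b| ≤ N := by
  obtain ⟨N, hN⟩ := G.exists_bound
  have h0 : 0 ≤ N := (abs_nonneg _).trans (hN 0).1
  have hpos : ∀ a b, (N < a ∨ N < b) → ¬ G.Odd a b := by
    intro a b h
    unfold Odd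
    rw [not_not, crossings, Finset.sum_eq_zero]
    · exact dvd_zero _
    · intro k _
      rw [if_neg]
      have := hN k
      rw [abs_le, abs_le] at this
      omega
  have hx : ∀ m : ℕ, ∀ a b, 2 ∣ a - b → a < -N → N < b + m → ¬ G.Odd a b := by
    intro m
    induction m with
    | zero => exact fun a b _ _ h => hpos a b (Or.inr (by simpa using h))
    | succ m ih =>
      intro a b hab ha hb
      have h1 := ih (a - 1) (b + 1) (by omega) (by omega) (by push_cast at hb; omega)
      have h2 := G.odd_iff_odd hab (a' := a - 1) (b' := b + 1) (Or.inr rfl) (Or.inl rfl)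
      have h3 : ¬ G.Used (a + (a - 1)) (b + (b + 1)) := by
        rintro ⟨k, hk, -⟩
        have := (hN k).1
        rw [abs_le] at this
        omega
      rw [h2.2 h3]
      exact h1
  have hy : ∀ m : ℕ, ∀ a b, 2 ∣ a - b → b < -N → N < a + m → ¬ G.Odd a b := by
    intro m
    induction m with
    | zero => exact fun a b _ _ h => hpos a b (Or.inl (by simpa using h))
    | succ m ih =>
      intro a b hab hb ha
      have h1 := ih (a + 1) (b - 1) (by omega) (by omega) (by push_cast at ha; omega)
      have h2 := G.odd_iff_odd hab (a' := a + 1) (b' := b - 1) (Or.inl rfl) (Or.inr rfl)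
      have h3 : ¬ G.Used (a + (a + 1)) (b + (b - 1)) := by
        rintro ⟨k, -, hk⟩
        have := (hN k).2
        rw [abs_le] at this
        omega
      rw [h2.2 h3]
      exact h1
  refine ⟨N, fun a b hab hodd => ?_⟩
  rw [abs_le, abs_le]
  refine ⟨⟨?_, ?_⟩, ?_, ?_⟩ <;> by_contra! hlt
  · exact hx (N - b + 1).toNat a b hab hlt (by omega) hodd
  · exact hpos a b (Or.inl hlt) hodd
  · exact hy (N - a + 1).toNat a b hab hlt (by omega) hodd
  · exact hpos a b (Or.inr hlt) hodd

end GridLoop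

/-! ### The faces of the packing -/

namespace GridLoop

/-- The closed face of the circle packing with midpoint `(a, b)`, where `a` and `b` have the same
parity: a disk of radius `1` if they are even, the gap between four circles if they are odd. -/
def closedFace (a b : ℤ) : Set ℂ :=
  {z | if 2 ∣ a then (z.re - a) ^ 2 + (z.im - b) ^ 2 ≤ 1 else
    |z.re - a| ≤ 1 ∧ |z.im - b| ≤ 1 ∧ 1 ≤ (1 - |z.re - a|) ^ 2 + (1 - |z.im - b|) ^ 2}

/-- The interior of `closedFace a b`. -/
def openFace (a b : ℤ) : Set ℂ :=
  {z | if 2 ∣ a then (z.re - a) ^ 2 + (z.im - b) ^ 2 < 1 else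
    |z.re - a| ≤ 1 ∧ |z.im - b| ≤ 1 ∧ 1 < (1 - |z.re - a|) ^ 2 + (1 - |z.im - b|) ^ 2}

/-- The point with coordinates `a`, `b`. -/
def pt (a b : ℤ) : ℂ := ⟨a, b⟩

theorem one_sub_abs_le {x : ℝ} {a c : ℤ} (hac : a ≠ c) (hx : |x - a| ≤ 1) :
    0 ≤ 1 - |x - a| ∧ 1 - |x - a| ≤ |x - c| := by
  refine ⟨by linarith, ?_⟩
  have h1 : (1 : ℝ) ≤ |(a : ℝ) - c| := by
    exact_mod_cast Int.one_le_abs (sub_ne_zero.2 hac)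
  have h2 : |(a : ℝ) - c| ≤ |x - a| + |x - c| := by
    have := abs_sub_le (a : ℝ) x c
    rwa [abs_sub_comm (a : ℝ) x] at this
  linarith

/-- For a disk, other centers are at distance at least 2. For a gap, the formula bounds the distance
to the nearest corner center, and every other center is at least as far away in each coordinate. -/
theorem sq_add_sq_ne_one_of_mem_openFace {a b : ℤ} (hab : 2 ∣ a - b) {z : ℂ}
    (hz : z ∈ openFace a b) (p q : ℤ) :
    (z.re - 2 * p) ^ 2 + (z.im - 2 * q) ^ 2 ≠ 1 := by
  intro h
  have hp : ((2 * p : ℤ) : ℝ) = 2 * p := by push_cast; ring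
  have hq : ((2 * q : ℤ) : ℝ) = 2 * q := by push_cast; ring
  by_cases h2 : 2 ∣ a
  · rw [openFace, Set.mem_ofPred_eq, if_pos h2] at hz
    have hne : a ≠ 2 * p ∨ b ≠ 2 * q := by
      by_contra! hcon
      rw [hcon.1, hcon.2, hp, hq] at hz
      linarith
    have key : (4 : ℝ) ≤ ((a : ℝ) - 2 * p) ^ 2 + ((b : ℝ) - 2 * q) ^ 2 := by
      obtain ⟨m, rfl⟩ := h2
      obtain ⟨n, rfl⟩ : 2 ∣ b := by omega
      have : 1 ≤ (m - p) ^ 2 + (n - q) ^ 2 := by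
        rcases hne with hne | hne
        · have : m - p ≠ 0 := by omega
          have := Int.one_le_abs this
          nlinarith [sq_abs (m - p), sq_nonneg (n - q)]
        · have : n - q ≠ 0 := by omega
          have := Int.one_le_abs this
          nlinarith [sq_abs (n - q), sq_nonneg (m - p)]
      have h' : (1 : ℝ) ≤ ((m : ℝ) - p) ^ 2 + ((n : ℝ) - q) ^ 2 := by exact_mod_cast this
      push_cast
      nlinarith
    -- Parallelogram law: with `c` the center of the face and `c'` the other one, `|z - c|² + |z -
    -- c'|² ≥ |c - c'|² / 2 ≥ 2`, whereas the left side would be less than `2`.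
    have e1 := sq_nonneg ((z.re - a) - (2 * p - z.re))
    have e2 := sq_nonneg ((z.im - b) - (2 * q - z.im))
    nlinarith
  · rw [openFace, Set.mem_ofPred_eq, if_neg h2] at hz
    have h3 := one_sub_abs_le (c := 2 * p) (by omega) hz.1
    have h4 := one_sub_abs_le (c := 2 * q) (by omega) hz.2.1
    rw [hp] at h3
    rw [hq] at h4
    have h5 := pow_le_pow_left₀ h3.1 h3.2 2
    have h6 := pow_le_pow_left₀ h4.1 h4.2 2
    rw [sq_abs] at h5 h6
    linarith [hz.2.2]

theorem openFace_subset_closedFace (a b : ℤ) : openFace a b ⊆ closedFace a b := by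
  intro z hz
  unfold openFace at hz
  unfold closedFace
  rw [Set.mem_ofPred_eq] at *
  split_ifs at * with h
  · exact hz.le
  · exact ⟨hz.1, hz.2.1, hz.2.2.le⟩

/-- Faces are star-shaped about their midpoints, even though gaps are not convex. This links each
point of a face to the midpoint without meeting the curve on the way. -/
theorem add_mul_mem_openFace {a b : ℤ} {z : ℂ} (hz : z ∈ closedFace a b) {t : ℝ} (h0 : 0 ≤ t)
    (h1 : t < 1) : pt a b + t * (z - pt a b) ∈ openFace a b := by
  have ere : (pt a b + t * (z - pt a b)).re - a = t * (z.re - a) := by simp [pt]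
  have eim : (pt a b + t * (z - pt a b)).im - b = t * (z.im - b) := by simp [pt]
  unfold openFace
  unfold closedFace at hz
  rw [Set.mem_ofPred_eq] at *
  rw [ere, eim, abs_mul, abs_mul, abs_of_nonneg h0]
  split_ifs at * with h
  · have : t ^ 2 < 1 := by nlinarith
    nlinarith [sq_nonneg (z.re - a), sq_nonneg (z.im - b)]
  · obtain ⟨hx, hy, hxy⟩ := hz
    have hx0 := abs_nonneg (z.re - a)
    have hy0 := abs_nonneg (z.im - b)
    set A := |z.re - a|
    set B := |z.im - b|
    refine ⟨by nlinarith, by nlinarith, ?_⟩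
    have e : (1 - t * A) ^ 2 + (1 - t * B) ^ 2 - ((1 - A) ^ 2 + (1 - B) ^ 2) =
      (1 - t) * ((2 * A - (1 + t) * A ^ 2) + (2 * B - (1 + t) * B ^ 2)) := by ring
    have hA : (1 - t) * A ≤ 2 * A - (1 + t) * A ^ 2 := by
      have : (1 + t) * A * A ≤ (1 + t) * A * 1 := mul_le_mul_of_nonneg_left hx (by positivity)
      nlinarith
    have hB : (1 - t) * B ≤ 2 * B - (1 + t) * B ^ 2 := by
      have : (1 + t) * B * B ≤ (1 + t) * B * 1 := mul_le_mul_of_nonneg_left hy (by positivity)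
      nlinarith
    rcases (add_nonneg hx0 hy0).eq_or_lt with h3 | h3
    · have hA0 : A = 0 := by linarith
      have hB0 : B = 0 := by linarith
      rw [hA0, hB0]
      norm_num
    · have : 0 < (1 - t) * ((1 - t) * (A + B)) :=
        mul_pos (by linarith) (mul_pos (by linarith) h3)
      have h5 : (1 - t) * ((1 - t) * (A + B)) ≤
          (1 - t) * ((2 * A - (1 + t) * A ^ 2) + (2 * B - (1 + t) * B ^ 2)) :=
        mul_le_mul_of_nonneg_left (by linarith) (by linarith)
      linarith

theorem pt_mem_closedFace (a b : ℤ) : pt a b ∈ closedFace a b := by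
  simp [closedFace, pt]

theorem pt_mem_openFace (a b : ℤ) : pt a b ∈ openFace a b := by
  have := add_mul_mem_openFace (pt_mem_closedFace a b) le_rfl zero_lt_one
  simpa using this

theorem exists_even_odd_near (x : ℝ) : ∃ a b : ℤ, 2 ∣ a ∧ ¬ 2 ∣ b ∧ |x - a| ≤ 1 ∧ |x - b| ≤ 1 ∧
    1 - |x - b| = |x - a| := by
  have h1 := Int.floor_le x
  have h2 := Int.lt_floor_add_one x
  have e1 : |x - ⌊x⌋| = x - ⌊x⌋ := abs_of_nonneg (by linarith)
  have e2 : |x - (⌊x⌋ + 1 : ℤ)| = 1 - (x - ⌊x⌋) := by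
    push_cast
    rw [abs_of_nonpos (by linarith)]
    ring
  by_cases h : 2 ∣ ⌊x⌋
  · exact ⟨⌊x⌋, ⌊x⌋ + 1, h, by omega, by rw [e1]; linarith, by rw [e2]; linarith,
      by rw [e1, e2]; ring⟩
  · exact ⟨⌊x⌋ + 1, ⌊x⌋, by omega, h, by rw [e2]; linarith, by rw [e1]; linarith,
      by rw [e1, e2]⟩

/-- Every point lies in a unit square with a disk center and a gap midpoint at opposite corners; it
belongs to the disk or else to the gap. -/
theorem exists_mem_closedFace (z : ℂ) : ∃ a b : ℤ, 2 ∣ a - b ∧ z ∈ closedFace a b := by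
  obtain ⟨a, a', ha, ha', h1, h2, h3⟩ := exists_even_odd_near z.re
  obtain ⟨b, b', hb, hb', h4, h5, h6⟩ := exists_even_odd_near z.im
  by_cases h : (z.re - a) ^ 2 + (z.im - b) ^ 2 ≤ 1
  · refine ⟨a, b, by omega, ?_⟩
    rw [closedFace, Set.mem_ofPred_eq, if_pos ha]
    exact h
  · refine ⟨a', b', by omega, ?_⟩
    rw [closedFace, Set.mem_ofPred_eq, if_neg ha', h3, h6, sq_abs, sq_abs]
    exact ⟨h2, h5, (not_le.1 h).le⟩

theorem abs_sub_le_of_mem_closedFace {a b : ℤ} {z : ℂ} (hz : z ∈ closedFace a b) :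
    |z.re - a| ≤ 1 ∧ |z.im - b| ≤ 1 := by
  rw [closedFace, Set.mem_ofPred_eq] at hz
  split_ifs at hz
  · constructor <;> rw [← sq_le_one_iff_abs_le_one] <;>
    nlinarith [sq_nonneg (z.re - a), sq_nonneg (z.im - b)]
  · exact ⟨hz.1, hz.2.1⟩

theorem isClosed_closedFace (a b : ℤ) : IsClosed (closedFace a b) := by
  unfold closedFace
  split_ifs
  · exact isClosed_le (f := fun z : ℂ => (z.re - a) ^ 2 + (z.im - b) ^ 2) (by fun_prop)
      continuous_const
  · have h1 : IsClosed {z : ℂ | |z.re - a| ≤ 1} := isClosed_le (by fun_prop) continuous_const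
    have h2 : IsClosed {z : ℂ | |z.im - b| ≤ 1} := isClosed_le (by fun_prop) continuous_const
    have h3 : IsClosed {z : ℂ | 1 ≤ (1 - |z.re - a|) ^ 2 + (1 - |z.im - b|) ^ 2} :=
      isClosed_le continuous_const (by fun_prop)
    exact h1.inter (h2.inter h3)

theorem finite_setOf_abs_sub_le (x c : ℝ) : {a : ℤ | |x - a| ≤ c}.Finite := by
  refine (Set.finite_Icc ⌊x - c⌋ ⌈x + c⌉).subset fun a ha => ?_
  rw [Set.mem_ofPred_eq, abs_le] at ha
  constructor
  · have : (⌊x - c⌋ : ℝ) ≤ a := (Int.floor_le _).trans (by linarith)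
    exact_mod_cast this
  · have : (a : ℝ) ≤ ⌈x + c⌉ := le_trans (by linarith) (Int.le_ceil _)
    exact_mod_cast this

theorem locallyFinite_closedFace :
    LocallyFinite fun f : ℤ × ℤ => closedFace f.1 f.2 := by
  intro z
  refine ⟨Metric.ball z 1, Metric.ball_mem_nhds _ one_pos, ?_⟩
  refine ((finite_setOf_abs_sub_le z.re 2).prod (finite_setOf_abs_sub_le z.im 2)).subset ?_
  rintro ⟨a, b⟩ ⟨w, hw, hwz⟩
  have h1 := abs_sub_le_of_mem_closedFace hw
  rw [Metric.mem_ball, Complex.dist_eq, ← Complex.norm_conj] at hwz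
  have h2 := (Complex.abs_re_le_norm (w - z))
  have h3 := (Complex.abs_im_le_norm (w - z))
  rw [Complex.norm_conj] at hwz
  rw [Complex.sub_re, abs_sub_comm] at h2
  rw [Complex.sub_im, abs_sub_comm] at h3
  have h4 := abs_sub_le z.re w.re a
  have h5 := abs_sub_le z.im w.im b
  exact ⟨by dsimp only at *; rw [Set.mem_ofPred_eq]; linarith,
    by dsimp only at *; rw [Set.mem_ofPred_eq]; linarith⟩

theorem isClosed_iUnion_closedFace (p : ℤ → ℤ → Prop) :
    IsClosed {z | ∃ a b, p a b ∧ z ∈ closedFace a b} := by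
  have h := (locallyFinite_closedFace.subset
    (g := fun f : ℤ × ℤ => {z | p f.1 f.2 ∧ z ∈ closedFace f.1 f.2})
    (fun f z hz => hz.2)).isClosed_iUnion (fun f => by
      by_cases hp : p f.1 f.2
      · simpa [hp] using isClosed_closedFace f.1 f.2
      · simp [hp])
  convert h using 1
  ext z
  simp

variable (G : GridLoop)

/-- Replaces the start vector and sense of rotation by the quadrant of the circle that holds the
link, so the direction of travel disappears. -/
theorem mem_carrier_iff (z : ℂ) : z ∈ G.carrier ↔
    ∃ k, (z.re - 2 * G.px k) ^ 2 + (z.im - 2 * G.py k) ^ 2 = 1 ∧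
      0 ≤ G.dx k * (z.re - 2 * G.px k) ∧ 0 ≤ G.dy k * (z.im - 2 * G.py k) := by
  refine exists_congr fun k => ?_
  rcases G.unit k with h | h | h | h <;> rcases G.s_eq k with hs | hs <;>
  simp only [dx, dy, h.1, h.2, hs] <;> push_cast <;> constructor <;> rintro ⟨h1, h2, h3⟩ <;>
  refine ⟨h1, ?_, ?_⟩ <;> linarith

theorem disjoint_openFace_carrier {a b : ℤ} (hab : 2 ∣ a - b) {z : ℂ} (hz : z ∈ openFace a b) :
    z ∉ G.carrier := by
  rintro ⟨k, h, -⟩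
  exact sq_add_sq_ne_one_of_mem_openFace hab hz _ _ h

theorem joint_mem_carrier (k : ℤ) :
    pt (G.jx k) (G.jy k) ∈ G.carrier ∧ pt (G.jx (k + 1)) (G.jy (k + 1)) ∈ G.carrier := by
  have h := G.link k
  rw [h.2.2.2.1, h.2.2.2.2, mem_carrier_iff, mem_carrier_iff]
  constructor <;> refine ⟨k, ?_⟩ <;> simp only [pt, jx, jy] <;> push_cast <;>
  rcases h with ⟨h1 | h1, h2 | h2, ⟨h3, h4⟩ | ⟨h3, h4⟩, -⟩ <;>
  simp only [h1, h2, h3, h4] <;> push_cast <;> norm_num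

/-- The four faces around a kissing point off the curve have the same parity. -/
theorem odd_iff_of_kissing {a b : ℤ} (hab : ¬ 2 ∣ a - b) (h : pt a b ∉ G.carrier) :
    (G.Odd (a + 1) b ↔ G.Odd (a - 1) b) ∧ (G.Odd a (b + 1) ↔ G.Odd a (b - 1)) := by
  have hunused : ∀ d e : ℤ, (d = 1 ∨ d = -1) → (e = 1 ∨ e = -1) →
      ¬ G.Used (2 * a + d) (2 * b + e) := by
    rintro d e hd he ⟨k, hx, hy⟩
    rw [ex_eq] at hx
    rw [ey_eq] at hy
    have h1 := G.j_step k
    have h2 := G.joint_mem_carrier k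
    have : (a = G.jx k ∧ b = G.jy k) ∨ (a = G.jx (k + 1) ∧ b = G.jy (k + 1)) := by omega
    rcases this with ⟨rfl, rfl⟩ | ⟨rfl, rfl⟩
    exacts [h h2.1, h h2.2]
  have h1 := G.odd_iff_odd (a := a + 1) (b := b) (a' := a) (b' := b + 1) (by omega)
    (by omega) (by omega)
  have h2 := G.odd_iff_odd (a := a - 1) (b := b) (a' := a) (b' := b + 1) (by omega)
    (by omega) (by omega)
  have h3 := G.odd_iff_odd (a := a + 1) (b := b) (a' := a) (b' := b - 1) (by omega)
    (by omega) (by omega)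
  rw [show a + 1 + a = 2 * a + 1 by ring, show b + (b + 1) = 2 * b + 1 by ring] at h1
  rw [show a - 1 + a = 2 * a + -1 by ring, show b + (b + 1) = 2 * b + 1 by ring] at h2
  rw [show a + 1 + a = 2 * a + 1 by ring, show b + (b - 1) = 2 * b + -1 by ring] at h3
  have h1' := h1.2 (hunused 1 1 (by simp) (by simp))
  have h2' := h2.2 (hunused (-1) 1 (by simp) (by simp))
  have h3' := h3.2 (hunused 1 (-1) (by simp) (by simp))
  exact ⟨h1'.trans h2'.symm, h1'.symm.trans h3'⟩

/-- Such faces touch at the kissing point midway. If the curve misses it, none of the four squares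
around it is used. -/
theorem odd_iff_of_dist_two {a b a' b' : ℤ} (hab : 2 ∣ a - b) {z : ℂ}
    (hz : z ∉ G.carrier) (h : (a' = a + 2 ∨ a' = a - 2) ∧ b' = b ∧ 2 * z.re = a + a' ∧ z.im = b ∨
      (b' = b + 2 ∨ b' = b - 2) ∧ a' = a ∧ 2 * z.im = b + b' ∧ z.re = a) :
    G.Odd a b ↔ G.Odd a' b' := by
  have key : ∀ c d : ℤ, z.re = c → z.im = d → pt c d ∉ G.carrier := by
    intro c d hc hd
    rw [show pt c d = z from Complex.ext hc.symm hd.symm]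
    exact hz
  rcases h with ⟨rfl | rfl, rfl, h1, h2⟩ | ⟨rfl | rfl, rfl, h1, h2⟩ <;> push_cast at h1
  · have := (G.odd_iff_of_kissing (a := a + 1) (b := b') (by omega)
      (key _ _ (by push_cast; linarith) h2)).1
    rw [show a + 1 + 1 = a + 2 by ring, add_sub_cancel_right] at this
    exact this.symm
  · have := (G.odd_iff_of_kissing (a := a - 1) (b := b') (by omega)
      (key _ _ (by push_cast; linarith) h2)).1
    rwa [show a - 1 - 1 = a - 2 by ring, sub_add_cancel] at this
  · have := (G.odd_iff_of_kissing (a := a') (b := b + 1) (by omega)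
      (key _ _ h2 (by push_cast; linarith))).2
    rw [show b + 1 + 1 = b + 2 by ring, add_sub_cancel_right] at this
    exact this.symm
  · have := (G.odd_iff_of_kissing (a := a') (b := b - 1) (by omega)
      (key _ _ h2 (by push_cast; linarith))).2
    rwa [show b - 1 - 1 = b - 2 by ring, sub_add_cancel] at this

end GridLoop

/-! ### Regions of constant parity and components of the complement -/

namespace GridLoop

variable (G : GridLoop)

theorem abs_sub_eq_one_of_dist_two {x : ℝ} {a a' : ℤ} (h : |x - a| ≤ 1) (h' : |x - a'| ≤ 1)
    (haa : a' = a + 2 ∨ a' = a - 2) : 2 * x = a + a' ∧ |x - a| = 1 ∧ |x - a'| = 1 := by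
  rw [abs_le] at h h'
  rcases haa with rfl | rfl
  · push_cast at *
    have e : x = a + 1 := by linarith
    refine ⟨by linarith, ?_, ?_⟩ <;> rw [e] <;> ring_nf <;> norm_num
  · push_cast at *
    have e : x = a - 1 := by linarith
    refine ⟨by linarith, ?_, ?_⟩ <;> rw [e] <;> ring_nf <;> norm_num

theorem abs_int_sub_le_two {x : ℝ} {a a' : ℤ} (h : |x - a| ≤ 1) (h' : |x - a'| ≤ 1) :
    a' = a + 2 ∨ a' = a - 2 ∨ a' = a + 1 ∨ a' = a - 1 ∨ a' = a := by
  rw [abs_le] at h h'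
  have h1 : (a' : ℝ) ≤ a + 2 := by linarith
  have h2 : (a : ℝ) ≤ a' + 2 := by linarith
  have h3 : a' ≤ a + 2 := by exact_mod_cast h1
  have h4 : a ≤ a' + 2 := by exact_mod_cast h2
  omega

theorem im_eq_of_mem_closedFace {a b : ℤ} {z : ℂ} (h : z ∈ closedFace a b)
    (h1 : |z.re - a| = 1) : z.im = b := by
  have h3 := (abs_sub_le_of_mem_closedFace h).2
  have h4 := abs_nonneg (z.im - b)
  rw [closedFace, Set.mem_ofPred_eq, ← sq_abs (z.re - a), ← sq_abs (z.im - b), h1] at h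
  have : |z.im - b| = 0 := by
    split_ifs at h
    · nlinarith
    · nlinarith [h.2.2]
  rw [abs_eq_zero] at this
  linarith

theorem re_eq_of_mem_closedFace {a b : ℤ} {z : ℂ} (h : z ∈ closedFace a b)
    (h1 : |z.im - b| = 1) : z.re = a := by
  have h3 := (abs_sub_le_of_mem_closedFace h).1
  have h4 := abs_nonneg (z.re - a)
  rw [closedFace, Set.mem_ofPred_eq, ← sq_abs (z.re - a), ← sq_abs (z.im - b), h1] at h
  have : |z.re - a| = 0 := by
    split_ifs at h
    · nlinarith
    · nlinarith [h.2.2]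
  rw [abs_eq_zero] at this
  linarith

theorem one_sub_abs_eq {x : ℝ} {c d : ℤ} (hd : d = 1 ∨ d = -1) (h1 : |x - c| ≤ 1)
    (h2 : |x - (c + d : ℤ)| ≤ 1) :
    0 ≤ d * (x - c) ∧ (1 - |x - (c + d : ℤ)|) ^ 2 = (x - c) ^ 2 := by
  rw [abs_le] at h1 h2
  rcases hd with rfl | rfl <;> push_cast at *
  · rw [abs_of_nonpos (by linarith)]
    exact ⟨by linarith, by ring⟩
  · rw [abs_of_nonneg (by linarith)]
    exact ⟨by linarith, by ring⟩

/-- A disk and a gap meet, if at all, in the quadrant between them. -/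
theorem mem_carrier_of_used {a b d e : ℤ} (ha : 2 ∣ a) (hb : 2 ∣ b) (hd : d = 1 ∨ d = -1)
    (he : e = 1 ∨ e = -1) (hu : G.Used (2 * a + d) (2 * b + e)) {z : ℂ}
    (h : z ∈ closedFace a b) (h' : z ∈ closedFace (a + d) (b + e)) : z ∈ G.carrier := by
  have h1 := abs_sub_le_of_mem_closedFace h
  have h2 := abs_sub_le_of_mem_closedFace h'
  have s1 := one_sub_abs_eq hd h1.1 h2.1
  have s2 := one_sub_abs_eq he h1.2 h2.2
  rw [closedFace, Set.mem_ofPred_eq, if_pos ha] at h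
  rw [closedFace, Set.mem_ofPred_eq, if_neg (by omega), s1.2, s2.2] at h'
  obtain ⟨k, hkx, hky⟩ := hu
  have hlk := G.link k
  have hk : 2 * G.px k = a ∧ 2 * G.py k = b ∧ G.dx k = d ∧ G.dy k = e := by
    unfold ex at hkx
    unfold ey at hky
    omega
  have e1 : (2 * G.px k : ℝ) = a := by exact_mod_cast hk.1
  have e2 : (2 * G.py k : ℝ) = b := by exact_mod_cast hk.2.1
  refine (G.mem_carrier_iff z).2 ⟨k, ?_, ?_, ?_⟩
  · rw [e1, e2]
    exact le_antisymm h h'.2.2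
  · rw [e1, hk.2.2.1]
    exact s1.1
  · rw [e2, hk.2.2.2]
    exact s2.1

/-- Between a face of each parity the curve passes. -/
theorem mem_carrier_of_mem_faces {a b a' b' : ℤ} (hab : 2 ∣ a - b) (hab' : 2 ∣ a' - b') {z : ℂ}
    (h : z ∈ closedFace a b) (h' : z ∈ closedFace a' b') (hodd : ¬ (G.Odd a b ↔ G.Odd a' b')) :
    z ∈ G.carrier := by
  by_contra hz
  -- Diagonal neighbours are of different kinds, so in that case this makes the first face the disk.
  wlog h2 : 2 ∣ a' → 2 ∣ a generalizing a b a' b'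
  · exact this hab' hab h' h (fun e => hodd e.symm) (by tauto)
  have hb := abs_sub_le_of_mem_closedFace h
  have hb' := abs_sub_le_of_mem_closedFace h'
  have hdx := abs_int_sub_le_two hb.1 hb'.1
  have hdy := abs_int_sub_le_two hb.2 hb'.2
  have hint : ∀ {m n : ℤ} {y : ℝ}, y = m → y = n → m = n := fun h1 h2 => by
    exact_mod_cast h1.symm.trans h2
  by_cases hx : a' = a + 2 ∨ a' = a - 2
  · obtain ⟨e1, e2, e3⟩ := abs_sub_eq_one_of_dist_two hb.1 hb'.1 hx
    have e4 := im_eq_of_mem_closedFace h e2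
    have e5 := im_eq_of_mem_closedFace h' e3
    exact hodd (G.odd_iff_of_dist_two hab hz (Or.inl ⟨hx, hint e5 e4, e1, e4⟩))
  by_cases hy : b' = b + 2 ∨ b' = b - 2
  · obtain ⟨e1, e2, e3⟩ := abs_sub_eq_one_of_dist_two hb.2 hb'.2 hy
    have e4 := re_eq_of_mem_closedFace h e2
    have e5 := re_eq_of_mem_closedFace h' e3
    exact hodd (G.odd_iff_of_dist_two hab hz (Or.inr ⟨hy, hint e5 e4, e1, e4⟩))
  by_cases hx0 : a = a'
  · have : b = b' := by omega
    subst hx0 this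
    exact hodd Iff.rfl
  obtain ⟨d, rfl⟩ : ∃ d, a' = a + d := ⟨a' - a, by ring⟩
  obtain ⟨e, rfl⟩ : ∃ e, b' = b + e := ⟨b' - b, by ring⟩
  have hd : d = 1 ∨ d = -1 := by omega
  have he : e = 1 ∨ e = -1 := by omega
  refine hz (G.mem_carrier_of_used (by omega) (by omega) hd he ?_ h h')
  by_contra hu
  refine hodd ((G.odd_iff_odd hab (by omega) (by omega)).2 ?_)
  rwa [← add_assoc, ← add_assoc, ← two_mul, ← two_mul]

/-- The points off the curve that lie in a face of given parity. -/
def oddRegion (G : GridLoop) : Set ℂ := {z | ∃ a b, (2 ∣ a - b ∧ G.Odd a b) ∧ z ∈ closedFace a b}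

/-- The points that lie in a face of even parity. -/
def evenRegion (G : GridLoop) : Set ℂ :=
  {z | ∃ a b, (2 ∣ a - b ∧ ¬ G.Odd a b) ∧ z ∈ closedFace a b}

/-- The odd and the even region are closed, cover the plane and meet only on the curve, so a
connected set off the curve cannot contain points of both. -/
theorem subset_oddRegion {U : Set ℂ} (hU : IsPreconnected U) (hUc : U ⊆ G.carrierᶜ) {z : ℂ}
    (hzU : z ∈ U) (hz : z ∈ G.oddRegion) : U ⊆ G.oddRegion := by
  by_contra hcon
  obtain ⟨w, hwU, hw⟩ := Set.not_subset.1 hcon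
  have hcover : ∀ v, v ∈ G.oddRegion ∪ G.evenRegion := by
    intro v
    obtain ⟨a, b, hab, hv⟩ := exists_mem_closedFace v
    by_cases h : G.Odd a b
    exacts [Or.inl ⟨a, b, ⟨hab, h⟩, hv⟩, Or.inr ⟨a, b, ⟨hab, h⟩, hv⟩]
  obtain ⟨v, hvU, ⟨a, b, ⟨h1, h2⟩, h3⟩, ⟨a', b', ⟨h1', h2'⟩, h3'⟩⟩ :=
    isPreconnected_closed_iff.1 hU G.oddRegion G.evenRegion (isClosed_iUnion_closedFace _)
      (isClosed_iUnion_closedFace _) (fun v _ => hcover v) ⟨z, hzU, hz⟩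
      ⟨w, hwU, (hcover w).resolve_left hw⟩
  exact hUc hvU (G.mem_carrier_of_mem_faces h1 h1' h3 h3' (by tauto))

theorem isBounded_oddRegion : Bornology.IsBounded G.oddRegion := by
  obtain ⟨N, hN⟩ := G.exists_bound_odd
  refine (Metric.isBounded_closedBall (x := (0 : ℂ)) (r := 2 * (N + 1))).subset ?_
  rintro z ⟨a, b, ⟨hab, hodd⟩, hz⟩
  have h1 := hN a b hab hodd
  have h2 := abs_sub_le_of_mem_closedFace hz
  have h3 : |(a : ℝ)| ≤ N := by exact_mod_cast h1.1
  have h4 : |(b : ℝ)| ≤ N := by exact_mod_cast h1.2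
  rw [mem_closedBall_zero_iff]
  refine (Complex.norm_le_abs_re_add_abs_im z).trans ?_
  have h5 := abs_add_le (z.re - a) a
  have h6 := abs_add_le (z.im - b) b
  rw [sub_add_cancel] at h5 h6
  linarith

/-- The connected component of a point in the complement of the curve. -/
def comp (z : ℂ) : Set ℂ := connectedComponentIn G.carrierᶜ z

theorem comp_eq_of_segment {z w : ℂ} (h : segment ℝ z w ⊆ G.carrierᶜ) : G.comp z = G.comp w := by
  apply connectedComponentIn_eq
  exact (convex_segment z w).isPreconnected.subset_connectedComponentIn (left_mem_segment ℝ z w) h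
    (right_mem_segment ℝ z w)

theorem mem_segment_pt {a b a' b' : ℤ} {z : ℂ} (hz : z ∈ segment ℝ (pt a b) (pt a' b')) :
    ∃ t ∈ Set.Icc (0 : ℝ) 1, z.re = a + t * (a' - a) ∧ z.im = b + t * (b' - b) := by
  rw [segment_eq_image] at hz
  obtain ⟨t, ht, rfl⟩ := hz
  refine ⟨t, ht, ?_, ?_⟩ <;> simp [pt] <;> ring

theorem comp_eq_center {a b : ℤ} (hab : 2 ∣ a - b) {z : ℂ} (hz : z ∈ closedFace a b)
    (hzc : z ∉ G.carrier) : G.comp z = G.comp (pt a b) := by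
  symm
  apply G.comp_eq_of_segment
  rw [segment_eq_image']
  rintro _ ⟨t, ht, rfl⟩
  rcases ht.2.eq_or_lt with rfl | h1
  · simpa using hzc
  · have := add_mul_mem_openFace hz ht.1 h1
    exact G.disjoint_openFace_carrier hab (by simpa using this)

/-- The segment is a diagonal of one unit square, and apart from its ends it lies in the interior; a
link meeting it there must lie in this square. -/
theorem segment_subset_of_not_used {a b a' b' : ℤ} (hab : 2 ∣ a - b)
    (ha : a' = a + 1 ∨ a' = a - 1) (hb : b' = b + 1 ∨ b' = b - 1)
    (hu : ¬ G.Used (a + a') (b + b')) : segment ℝ (pt a b) (pt a' b') ⊆ G.carrierᶜ := by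
  intro z hz hzc
  obtain ⟨t, ht, hx, hy⟩ := mem_segment_pt hz
  rcases ht.1.eq_or_lt with rfl | h0
  · refine G.disjoint_openFace_carrier hab (pt_mem_openFace a b) ?_
    rwa [show pt a b = z from Complex.ext (by simp [hx, pt]) (by simp [hy, pt])]
  rcases ht.2.eq_or_lt with rfl | h1
  · refine G.disjoint_openFace_carrier (a := a') (b := b') (by omega) (pt_mem_openFace a' b') ?_
    rwa [show pt a' b' = z from Complex.ext (by simp [hx, pt]) (by simp [hy, pt])]
  obtain ⟨k, hk1, hk2, hk3⟩ := (G.mem_carrier_iff z).1 hzc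
  have hlk := G.link k
  have key : ∀ {x : ℝ} {c c' p d : ℤ}, (c' = c + 1 ∨ c' = c - 1) → (d = 1 ∨ d = -1) →
      x = c + t * (c' - c) → |x - 2 * p| ≤ 1 → 0 ≤ d * (x - 2 * p) → 4 * p + d = c + c' := by
    intro x c c' p d hc hd hx h2 h3
    rw [abs_le] at h2
    have h4 : ((4 * p + d - (c + c') : ℤ) : ℝ) < 2 ∧ (-2 : ℝ) < (4 * p + d - (c + c') : ℤ) := by
      rcases hc with rfl | rfl <;> rcases hd with rfl | rfl <;> push_cast at * <;>
      constructor <;> linarith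
    have h5 : 4 * p + d - (c + c') < 2 := by exact_mod_cast h4.1
    have h6 : -2 < 4 * p + d - (c + c') := by exact_mod_cast h4.2
    omega
  refine hu ⟨k, key ha hlk.1 hx ?_ hk2, key hb hlk.2.1 hy ?_ hk3⟩
  · rw [← sq_le_one_iff_abs_le_one]
    nlinarith [sq_nonneg (z.im - 2 * G.py k)]
  · rw [← sq_le_one_iff_abs_le_one]
    nlinarith [sq_nonneg (z.re - 2 * G.px k)]

theorem comp_eq_of_not_used {a b a' b' : ℤ} (hab : 2 ∣ a - b)
    (ha : a' = a + 1 ∨ a' = a - 1) (hb : b' = b + 1 ∨ b' = b - 1)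
    (hu : ¬ G.Used (a + a') (b + b')) : G.comp (pt a b) = G.comp (pt a' b') :=
  G.comp_eq_of_segment (G.segment_subset_of_not_used hab ha hb hu)

/-- The component of the circle of the `k`-th link. -/
def diskComp (k : ℤ) : Set ℂ := G.comp (pt (2 * G.px k) (2 * G.py k))

/-- The component of the gap next to the `k`-th link. -/
def gapComp (k : ℤ) : Set ℂ := G.comp (pt (2 * G.px k + G.dx k) (2 * G.py k + G.dy k))

/-- The squares around a joint that contain a link. -/
theorem used_at_joint {k a b : ℤ} (h : G.Used a b)
    (ha : a = 2 * G.jx (k + 1) + 1 ∨ a = 2 * G.jx (k + 1) - 1)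
    (hb : b = 2 * G.jy (k + 1) + 1 ∨ b = 2 * G.jy (k + 1) - 1) :
    (a = G.ex k ∧ b = G.ey k) ∨ (a = G.ex (k + 1) ∧ b = G.ey (k + 1)) := by
  obtain ⟨l, rfl, rfl⟩ := h
  have h1 := G.j_step l
  have h1' := G.j_step (k + 1)
  have h2 := G.ex_eq l
  have h3 := G.ey_eq l
  have : (G.jx l = G.jx (k + 1) ∧ G.jy l = G.jy (k + 1)) ∨
      (G.jx (l + 1) = G.jx (k + 1) ∧ G.jy (l + 1) = G.jy (k + 1)) := by omega
  rcases this with h | h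
  · exact Or.inr (G.e_congr ((G.j_eq_iff _ _).1 h))
  · have := (G.j_eq_iff _ _).1 h
    rw [add_sub_add_right_eq_sub] at this
    exact Or.inl (G.e_congr this)

/-- The gaps before and after the joint both border the other circle through it. The two squares
leading to that circle are unused, since the only links at the joint lie on the present circle. -/
theorem comp_step_of_eq {k : ℤ} (h : G.s (k + 1) = G.s k) :
    G.diskComp (k + 1) = G.diskComp k ∧ G.gapComp (k + 1) = G.gapComp k := by
  have hs := G.s_eq k
  have hj := G.joint k
  have hp : G.px (k + 1) = G.px k ∧ G.py (k + 1) = G.py k := by omega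
  replace hj := hj.2
  clear hs
  have hl := (G.link k).2.2
  have h1 := (G.link k).1
  have h2 := (G.link k).2.1
  rw [hl.2.1, hl.2.2] at hj
  unfold diskComp gapComp
  refine ⟨by rw [hp.1, hp.2], ?_⟩
  rw [hj.1, hj.2]
  trans G.comp (pt (2 * (G.px k + (G.dx k - G.ux k))) (2 * (G.py k + (G.dy k - G.uy k))))
  · refine G.comp_eq_of_not_used (by omega) (by omega) (by omega) fun hu => ?_
    have := G.used_at_joint (k := k) hu (by omega) (by omega)
    unfold ex ey at this
    omega
  · symm
    refine G.comp_eq_of_not_used (by omega) (by omega) (by omega) fun hu => ?_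
    have := G.used_at_joint (k := k) hu (by omega) (by omega)
    unfold ex ey at this
    omega

/-- When the curve changes circles, disk and gap exchange sides: at the joint an unused square
connects the old gap to the new disk, another one the old disk to the new gap. -/
theorem comp_step_of_neg {k : ℤ} (h : G.s (k + 1) = -G.s k) :
    G.diskComp (k + 1) = G.gapComp k ∧ G.gapComp (k + 1) = G.diskComp k := by
  have hs := G.s_eq k
  have hj := G.joint k
  have hp : G.px (k + 1) = G.px k + (G.dx k - G.ux k) ∧
        G.py (k + 1) = G.py k + (G.dy k - G.uy k) := by omega
  replace hj := hj.2
  clear hs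
  have hl := (G.link k).2.2
  have h1 := (G.link k).1
  have h2 := (G.link k).2.1
  rw [hl.2.1, hl.2.2] at hj
  unfold diskComp gapComp
  constructor
  · rw [hp.1, hp.2]
    symm
    refine G.comp_eq_of_not_used (by omega) (by omega) (by omega) fun hu => ?_
    have := G.used_at_joint (k := k) hu (by omega) (by omega)
    unfold ex ey at this
    omega
  · rw [hj.1, hj.2]
    refine G.comp_eq_of_not_used (by omega) (by omega) (by omega) fun hu => ?_
    have := G.used_at_joint (k := k) hu (by omega) (by omega)
    unfold ex ey at this
    omega

end GridLoop

/-! ### The Jordan curve theorem for grid loops -/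

namespace GridLoop

variable (G : GridLoop)

theorem comps (k : ℤ) :
    (G.s k = G.s G.base → G.diskComp k = G.diskComp G.base ∧ G.gapComp k = G.gapComp G.base) ∧
    (G.s k = -G.s G.base →
      G.diskComp k = G.gapComp G.base ∧ G.gapComp k = G.diskComp G.base) := by
  have hstep : ∀ k, (G.s (k + 1) = G.s k ∧
      G.diskComp (k + 1) = G.diskComp k ∧ G.gapComp (k + 1) = G.gapComp k) ∨
      (G.s (k + 1) = -G.s k ∧
      G.diskComp (k + 1) = G.gapComp k ∧ G.gapComp (k + 1) = G.diskComp k) := by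
    intro k
    have : G.s (k + 1) = G.s k ∨ G.s (k + 1) = -G.s k := by
      have := G.s_eq k
      have := G.s_eq (k + 1)
      omega
    exact this.imp (fun h => ⟨h, G.comp_step_of_eq h⟩) (fun h => ⟨h, G.comp_step_of_neg h⟩)
  have h0 := G.s_eq G.base
  induction k using Int.inductionOn' (b := G.base) with
  | zero => exact ⟨fun _ => ⟨rfl, rfl⟩, fun h => by omega⟩
  | succ k _ ih =>
    rcases hstep k with ⟨h1, h2, h3⟩ | ⟨h1, h2, h3⟩
    · rw [h1, h2, h3]
      exact ih
    · rw [h1, h2, h3]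
      exact ⟨fun h => (ih.2 (by omega)).symm, fun h => (ih.1 (by omega)).symm⟩
  | pred k _ ih =>
    have := hstep (k - 1)
    rw [sub_add_cancel] at this
    rcases this with ⟨h1, h2, h3⟩ | ⟨h1, h2, h3⟩
    · rw [← h1, ← h2, ← h3]
      exact ih
    · rw [h1, h2, h3] at ih
      exact ⟨fun h => (ih.2 (by omega)).symm, fun h => (ih.1 (by omega)).symm⟩

/-- The complement of the curve has at most two components. -/
theorem comp_pt {a b : ℤ} (hab : 2 ∣ a - b) :
    G.comp (pt a b) = G.diskComp G.base ∨ G.comp (pt a b) = G.gapComp G.base := by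
  have hlink : ∀ k, (G.diskComp k = G.diskComp G.base ∨ G.diskComp k = G.gapComp G.base) ∧
      (G.gapComp k = G.diskComp G.base ∨ G.gapComp k = G.gapComp G.base) := by
    intro k
    have h1 := G.comps k
    have : G.s k = G.s G.base ∨ G.s k = -G.s G.base := by
      have := G.s_eq k
      have := G.s_eq G.base
      omega
    rcases this with h | h
    · exact ⟨Or.inl (h1.1 h).1, Or.inr (h1.1 h).2⟩
    · exact ⟨Or.inr (h1.2 h).1, Or.inl (h1.2 h).2⟩
  have hprop : ∀ {a b a' b' : ℤ}, 2 ∣ a - b → (a' = a + 1 ∨ a' = a - 1) →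
      (b' = b + 1 ∨ b' = b - 1) →
      (G.comp (pt a b) = G.diskComp G.base ∨ G.comp (pt a b) = G.gapComp G.base) →
      (G.comp (pt a' b') = G.diskComp G.base ∨ G.comp (pt a' b') = G.gapComp G.base) := by
    intro a b a' b' hab ha hb h
    by_cases hu : G.Used (a + a') (b + b')
    · obtain ⟨k, hx, hy⟩ := hu
      have h1 := G.link k
      unfold ex at hx
      unfold ey at hy
      have : (a' = 2 * G.px k ∧ b' = 2 * G.py k) ∨
          (a' = 2 * G.px k + G.dx k ∧ b' = 2 * G.py k + G.dy k) := by omega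
      rcases this with ⟨rfl, rfl⟩ | ⟨rfl, rfl⟩
      exacts [(hlink k).1, (hlink k).2]
    · rwa [← G.comp_eq_of_not_used hab ha hb hu]
  have hdiag : ∀ m : ℤ, ∀ a b, 2 ∣ a - b →
      (G.comp (pt a b) = G.diskComp G.base ∨ G.comp (pt a b) = G.gapComp G.base) →
      (G.comp (pt (a + m) (b + m)) = G.diskComp G.base ∨
        G.comp (pt (a + m) (b + m)) = G.gapComp G.base) := by
    intro m a b hab h
    induction m using Int.induction_on with
    | zero => simpa using h
    | succ m ih => exact hprop (by omega) (by omega) (by omega) ih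
    | pred m ih => exact hprop (by omega) (by omega) (by omega) ih
  have hanti : ∀ m : ℤ, ∀ a b, 2 ∣ a - b →
      (G.comp (pt a b) = G.diskComp G.base ∨ G.comp (pt a b) = G.gapComp G.base) →
      (G.comp (pt (a + m) (b - m)) = G.diskComp G.base ∨
        G.comp (pt (a + m) (b - m)) = G.gapComp G.base) := by
    intro m a b hab h
    induction m using Int.induction_on with
    | zero => simpa using h
    | succ m ih => exact hprop (by omega) (by omega) (by omega) ih
    | pred m ih => exact hprop (by omega) (by omega) (by omega) ih
  obtain ⟨m, hm⟩ := hab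
  -- Diagonal and antidiagonal steps together reach every face midpoint; the two step counts solve
  -- the linear system for `(a, b)` starting from the base circle.
  have h1 := hdiag (b - 2 * G.py G.base + (m - G.px G.base + G.py G.base)) _ _ (by omega)
    (hlink G.base).1
  have h2 := hanti (m - G.px G.base + G.py G.base) _ _ (by omega) h1
  convert h2 using 3 <;> congr 1 <;> omega

/-- The midpoint of the base gap lies at the height of the lowest joint. The vertical ray down from
it is otherwise below the whole curve, and the midpoint itself is interior to a face. -/
theorem not_isBounded_gapComp_base : ¬ Bornology.IsBounded (G.gapComp G.base) := by
  intro hbd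
  have hu := G.base_unit
  have hlk := G.link G.base
  obtain ⟨gx, hgx⟩ : ∃ gx, gx = 2 * G.px G.base + G.dx G.base := ⟨_, rfl⟩
  obtain ⟨gy, hgy⟩ : ∃ gy, gy = 2 * G.py G.base + G.dy G.base := ⟨_, rfl⟩
  have hgy' : gy = 2 * G.py G.base + G.uy G.base := by omega
  unfold gapComp at hbd
  rw [← hgx, ← hgy] at hbd
  set R : Set ℂ := (fun t : ℝ => (⟨gx, t⟩ : ℂ)) '' Set.Iic (gy : ℝ) with hR
  have hcont : Continuous fun t : ℝ => (⟨gx, t⟩ : ℂ) := by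
    have : (fun t : ℝ => (⟨gx, t⟩ : ℂ)) = fun t : ℝ => (gx : ℂ) + t * Complex.I := by
      ext t
      apply Complex.ext <;> simp
    rw [this]
    fun_prop
  have hpre : IsPreconnected R := isPreconnected_Iic.image _ hcont.continuousOn
  have hsub : R ⊆ G.carrierᶜ := by
    rintro _ ⟨t, ht, rfl⟩ hc
    have h1 := G.base_le_im hc
    rw [← hgy'] at h1
    have h2 : t = gy := le_antisymm ht h1
    rw [h2] at hc
    exact G.disjoint_openFace_carrier (a := gx) (b := gy) (by omega) (pt_mem_openFace gx gy) hc
  have hmem : R ⊆ G.comp (pt gx gy) :=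
    hpre.subset_connectedComponentIn ⟨gy, Set.self_mem_Iic, rfl⟩ hsub
  obtain ⟨C, hC⟩ := (hbd.subset hmem).exists_norm_le
  have h3 := hC _ ⟨min gy (-C - 1), Set.mem_Iic.2 (min_le_left _ _), rfl⟩
  have h4 := Complex.abs_im_le_norm (⟨gx, min gy (-C - 1)⟩ : ℂ)
  have h5 : min (gy : ℝ) (-C - 1) ≤ -C - 1 := min_le_right _ _
  have h6 := neg_abs_le (min (gy : ℝ) (-C - 1))
  dsimp only at h4
  linarith

theorem isBounded_comp_of_odd {a b : ℤ} (hab : 2 ∣ a - b) {z : ℂ} (hz : z ∈ closedFace a b)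
    (hzc : z ∉ G.carrier) (h : G.Odd a b) : Bornology.IsBounded (G.comp z) :=
  G.isBounded_oddRegion.subset (G.subset_oddRegion isPreconnected_connectedComponentIn
    (connectedComponentIn_subset _ _) (mem_connectedComponentIn hzc) ⟨a, b, ⟨hab, h⟩, hz⟩)

/-- Jordan curve theorem for the curve: a point off the curve has a bounded component exactly if
it lies in a face of odd parity. -/
theorem isBounded_comp_iff {a b : ℤ} (hab : 2 ∣ a - b) {z : ℂ} (hz : z ∈ closedFace a b)
    (hzc : z ∉ G.carrier) : Bornology.IsBounded (G.comp z) ↔ G.Odd a b := by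
  refine ⟨fun hbd => ?_, G.isBounded_comp_of_odd hab hz hzc⟩
  by_contra hodd
  rw [G.comp_eq_center hab hz hzc] at hbd
  have hlk := G.link G.base
  have hptc : ∀ {a b : ℤ}, 2 ∣ a - b → pt a b ∉ G.carrier := fun hab =>
    G.disjoint_openFace_carrier hab (pt_mem_openFace _ _)
  have hgap : ¬ G.Odd (2 * G.px G.base + G.dx G.base) (2 * G.py G.base + G.dy G.base) := fun h =>
    G.not_isBounded_gapComp_base (G.isBounded_comp_of_odd (by omega) (pt_mem_closedFace _ _)
      (hptc (by omega)) h)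
  have hdisk : G.Odd (2 * G.px G.base) (2 * G.py G.base) := by
    by_contra h
    refine (G.odd_iff_odd (a := 2 * G.px G.base) (b := 2 * G.py G.base) (by omega) (by omega)
      (by omega)).1 (iff_of_false h hgap) ⟨G.base, ?_, ?_⟩ <;> simp only [ex, ey] <;> ring
  -- The component of the base disk lies in the odd region and so cannot contain the midpoint of an
  -- even face; the component of the base gap is unbounded.
  rcases G.comp_pt hab with h | h
  · have h1 := G.subset_oddRegion isPreconnected_connectedComponentIn
      (connectedComponentIn_subset _ _) (mem_connectedComponentIn (hptc (by omega)))
      (⟨2 * G.px G.base, 2 * G.py G.base, ⟨by omega, hdisk⟩, pt_mem_closedFace _ _⟩)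
    have hmem : pt a b ∈ G.diskComp G.base := h ▸ mem_connectedComponentIn (hptc hab)
    obtain ⟨a', b', ⟨h2, h3⟩, h4⟩ := h1 hmem
    exact hptc hab (G.mem_carrier_of_mem_faces hab h2 (pt_mem_closedFace _ _) h4 (by tauto))
  · rw [h] at hbd
    exact G.not_isBounded_gapComp_base hbd

theorem odd_iff_isBounded {a b : ℤ} (hab : 2 ∣ a - b) :
    G.Odd a b ↔ Bornology.IsBounded (G.comp (pt a b)) :=
  (G.isBounded_comp_iff hab (pt_mem_closedFace _ _)
    (G.disjoint_openFace_carrier hab (pt_mem_openFace _ _))).symm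

/-- The circles of the links with the sense of rotation of the base link are inside. -/
theorem odd_disk_iff (k : ℤ) : G.Odd (2 * G.px k) (2 * G.py k) ↔ G.s k = G.s G.base := by
  have hlk := G.link k
  have hgap := G.odd_iff_odd (a := 2 * G.px k) (b := 2 * G.py k) (a' := 2 * G.px k + G.dx k)
    (b' := 2 * G.py k + G.dy k) (by omega) (by omega) (by omega)
  have hu : G.Used (2 * G.px k + (2 * G.px k + G.dx k)) (2 * G.py k + (2 * G.py k + G.dy k)) :=
    ⟨k, by unfold ex; ring, by unfold ey; ring⟩
  have h1 := G.odd_iff_isBounded (a := 2 * G.px k) (b := 2 * G.py k) (by omega)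
  have h2 := G.odd_iff_isBounded (a := 2 * G.px k + G.dx k) (b := 2 * G.py k + G.dy k) (by omega)
  change _ ↔ Bornology.IsBounded (G.diskComp k) at h1
  change _ ↔ Bornology.IsBounded (G.gapComp k) at h2
  have h3 := G.comps k
  have h4 := G.not_isBounded_gapComp_base
  have h5 : G.s k = G.s G.base ∨ G.s k = -G.s G.base := by
    have := G.s_eq k
    have := G.s_eq G.base
    omega
  constructor
  · intro h
    rcases h5 with h5 | h5
    · exact h5
    · rw [h1, (h3.2 h5).1] at h
      exact absurd h h4
  · intro h
    rw [(h3.1 h).2] at h2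
    tauto

theorem odd_gap_iff (k : ℤ) : G.Odd (2 * G.px k + G.dx k) (2 * G.py k + G.dy k) ↔
    G.s k ≠ G.s G.base := by
  have hlk := G.link k
  have hgap := G.odd_iff_odd (a := 2 * G.px k) (b := 2 * G.py k) (a' := 2 * G.px k + G.dx k)
    (b' := 2 * G.py k + G.dy k) (by omega) (by omega) (by omega)
  have hu : G.Used (2 * G.px k + (2 * G.px k + G.dx k)) (2 * G.py k + (2 * G.py k + G.dy k)) :=
    ⟨k, by unfold ex; ring, by unfold ey; ring⟩
  have := G.odd_disk_iff k
  tauto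

end GridLoop

/-! ### The enclosed area -/

open MeasureTheory in
theorem Complex.volume_reProdIm (s t : Set ℝ) : volume (s ×ℂ t) = volume s * volume t := by
  have : s ×ℂ t = Complex.measurableEquivRealProd ⁻¹' (s ×ˢ t) := rfl
  rw [this, Complex.volume_preserving_equiv_real_prod.measure_preimage_equiv,
    Measure.volume_eq_prod, Measure.prod_prod]

open MeasureTheory in
theorem Complex.ae_re_ne (c : ℝ) : ∀ᵐ z : ℂ, z.re ≠ c := by
  rw [ae_iff]
  have : {z : ℂ | ¬ z.re ≠ c} = {c} ×ℂ Set.univ := by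
    ext z
    simp [Complex.mem_reProdIm]
  rw [this, Complex.volume_reProdIm]
  simp

open MeasureTheory in
theorem Complex.ae_im_ne (c : ℝ) : ∀ᵐ z : ℂ, z.im ≠ c := by
  rw [ae_iff]
  have : {z : ℂ | ¬ z.im ≠ c} = Set.univ ×ℂ {c} := by
    ext z
    simp [Complex.mem_reProdIm]
  rw [this, Complex.volume_reProdIm]
  simp

/-- A quarter of the unit disk. -/
def quarterDisk (d e : ℤˣ) : Set ℂ :=
  {z | z ∈ Metric.ball (0 : ℂ) 1 ∧ 0 < (d : ℤ) * z.re ∧ 0 < (e : ℤ) * z.im}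

theorem measurableSet_quarterDisk (d e : ℤˣ) : MeasurableSet (quarterDisk d e) := by
  unfold quarterDisk
  apply IsOpen.measurableSet
  have h1 : IsOpen {z : ℂ | 0 < ((d : ℤ) : ℝ) * z.re} := isOpen_lt continuous_const (by fun_prop)
  have h2 : IsOpen {z : ℂ | 0 < ((e : ℤ) : ℝ) * z.im} := isOpen_lt continuous_const (by fun_prop)
  exact Metric.isOpen_ball.inter (h1.inter h2)

open MeasureTheory in
theorem volume_quarterDisk_eq (d e : ℤˣ) :
    volume (quarterDisk d e) = volume (quarterDisk 1 1) := by
  have hneg : ∀ d e : ℤˣ, volume (quarterDisk (-d) (-e)) = volume (quarterDisk d e) := by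
    intro d e
    rw [← (LinearIsometryEquiv.neg ℝ (E := ℂ)).measurePreserving.measure_preimage
      (measurableSet_quarterDisk d e).nullMeasurableSet]
    congr 1
    ext z
    simp [quarterDisk]
  have hconj : ∀ d e : ℤˣ, volume (quarterDisk d (-e)) = volume (quarterDisk d e) := by
    intro d e
    rw [← Complex.conjLIE.measurePreserving.measure_preimage
      (measurableSet_quarterDisk d e).nullMeasurableSet]
    congr 1
    ext z
    simp [quarterDisk]
  rcases Int.units_eq_one_or d with rfl | rfl <;> rcases Int.units_eq_one_or e with rfl | rfl
  · rfl
  · exact hconj 1 1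
  · rw [← hconj]
    exact hneg 1 1
  · exact hneg 1 1

open MeasureTheory in
theorem volume_quarterDisk (d e : ℤˣ) :
    volume (quarterDisk d e) = ENNReal.ofReal (Real.pi / 4) := by
  have hdisj : Pairwise (Function.onFun Disjoint fun i : ℤˣ × ℤˣ => quarterDisk i.1 i.2) := by
    rintro ⟨d, e⟩ ⟨d', e'⟩ hne
    refine Set.disjoint_left.2 fun z h h' => hne ?_
    obtain ⟨-, h1, h2⟩ := h
    obtain ⟨-, h3, h4⟩ := h'
    rcases Int.units_eq_one_or d with rfl | rfl <;> rcases Int.units_eq_one_or d' with rfl | rfl <;>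
    rcases Int.units_eq_one_or e with rfl | rfl <;> rcases Int.units_eq_one_or e' with rfl | rfl <;>
    first | rfl | (exfalso; simp at h1 h2 h3 h4; linarith)
  have hun : (Metric.ball (0 : ℂ) 1 : Set ℂ) =ᵐ[volume]
      ⋃ i : ℤˣ × ℤˣ, quarterDisk i.1 i.2 := by
    rw [Filter.eventuallyEq_set]
    filter_upwards [Complex.ae_re_ne 0, Complex.ae_im_ne 0] with z hx hy
    rw [Set.mem_iUnion]
    constructor
    · intro hz
      rcases lt_or_gt_of_ne hx with hx | hx <;> rcases lt_or_gt_of_ne hy with hy | hy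
      exacts [⟨(-1, -1), hz, by simpa using hx, by simpa using hy⟩,
        ⟨(-1, 1), hz, by simpa using hx, by simpa using hy⟩,
        ⟨(1, -1), hz, by simpa using hx, by simpa using hy⟩,
        ⟨(1, 1), hz, by simpa using hx, by simpa using hy⟩]
    · rintro ⟨i, hi, -⟩
      exact hi
  have h := measure_congr hun
  rw [measure_iUnion hdisj (fun i => measurableSet_quarterDisk _ _), tsum_fintype] at h
  simp only [volume_quarterDisk_eq] at h
  rw [Complex.volume_ball, Finset.sum_const, Finset.card_univ, Fintype.card_prod] at h
  rw [volume_quarterDisk_eq]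
  have hcard : Fintype.card ℤˣ = 2 := rfl
  rw [hcard] at h
  have h4 : ENNReal.ofReal Real.pi = (NNReal.pi : ENNReal) := by
    rw [← NNReal.coe_real_pi, ENNReal.ofReal_coe_nnreal]
  simp only [ENNReal.ofReal_one, one_pow, one_mul, nsmul_eq_mul] at h
  rw [← ENNReal.mul_right_inj (a := 4) (by norm_num) (by norm_num)]
  norm_num at h
  rw [← h, ← h4, show (4 : ENNReal) = ENNReal.ofReal 4 by simp,
    ← ENNReal.ofReal_mul (by norm_num)]
  congr 1
  ring

namespace GridLoop

/-- The unit square between the midpoint `(2 i + 1, 2 j + 1)` of a gap and the center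
`(2 i + 1 + d, 2 j + 1 + e)` of an adjacent circle. -/
def square (i : (ℤ × ℤ) × (ℤˣ × ℤˣ)) : Set ℂ :=
  {x | 0 < ((i.2.1 : ℤ) : ℝ) * (x - (2 * i.1.1 + 1)) ∧
    ((i.2.1 : ℤ) : ℝ) * (x - (2 * i.1.1 + 1)) < 1} ×ℂ
  {y | 0 < ((i.2.2 : ℤ) : ℝ) * (y - (2 * i.1.2 + 1)) ∧
    ((i.2.2 : ℤ) : ℝ) * (y - (2 * i.1.2 + 1)) < 1}

/-- The center of the circle at a corner of a square. -/
noncomputable def corner (i : (ℤ × ℤ) × (ℤˣ × ℤˣ)) : ℂ :=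
  pt (2 * i.1.1 + 1 + i.2.1) (2 * i.1.2 + 1 + i.2.2)

theorem measurableSet_square (i : (ℤ × ℤ) × (ℤˣ × ℤˣ)) : MeasurableSet (square i) := by
  have h : ∀ (d : ℤˣ) (g : ℝ),
      MeasurableSet {x : ℝ | 0 < ((d : ℤ) : ℝ) * (x - g) ∧ ((d : ℤ) : ℝ) * (x - g) < 1} :=
    fun d g => by
      have h1 : IsOpen {x : ℝ | 0 < ((d : ℤ) : ℝ) * (x - g)} :=
        isOpen_lt continuous_const (by fun_prop)
      have h2 : IsOpen {x : ℝ | ((d : ℤ) : ℝ) * (x - g) < 1} :=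
        isOpen_lt (by fun_prop) continuous_const
      exact (h1.inter h2).measurableSet
  exact (Complex.measurable_re (h _ _)).inter (Complex.measurable_im (h _ _))

open MeasureTheory in
theorem volume_square (i : (ℤ × ℤ) × (ℤˣ × ℤˣ)) : volume (square i) = 1 := by
  have h : ∀ (d : ℤˣ) (g : ℝ),
      volume {x : ℝ | 0 < ((d : ℤ) : ℝ) * (x - g) ∧ ((d : ℤ) : ℝ) * (x - g) < 1} = 1 := by
    intro d g
    rcases Int.units_eq_one_or d with rfl | rfl
    · have : {x : ℝ | 0 < (((1 : ℤˣ) : ℤ) : ℝ) * (x - g) ∧ (((1 : ℤˣ) : ℤ) : ℝ) * (x - g) < 1} =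
          Set.Ioo g (g + 1) := by
        ext x
        simp
        intro _
        constructor <;> intro <;> linarith
      rw [this, Real.volume_Ioo]
      simp
    · have : {x : ℝ | 0 < (((-1 : ℤˣ) : ℤ) : ℝ) * (x - g) ∧
          (((-1 : ℤˣ) : ℤ) : ℝ) * (x - g) < 1} = Set.Ioo (g - 1) g := by
        ext x
        simp
        constructor <;> rintro ⟨h1, h2⟩ <;> constructor <;> linarith
      rw [this, Real.volume_Ioo]
      simp
  rw [square, Complex.volume_reProdIm, h, h, one_mul]

theorem mem_ball_pt {a b : ℤ} {z : ℂ} :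
    z ∈ Metric.ball (pt a b) 1 ↔ (z.re - a) ^ 2 + (z.im - b) ^ 2 < 1 := by
  rw [Metric.mem_ball, Complex.dist_eq_re_im, Real.sqrt_lt' one_pos, one_pow]
  rfl

theorem mem_square_inter_ball {i : (ℤ × ℤ) × (ℤˣ × ℤˣ)} {z : ℂ} :
    z ∈ square i ∩ Metric.ball (corner i) 1 ↔ z + -corner i ∈ quarterDisk (-i.2.1) (-i.2.2) := by
  obtain ⟨⟨i, j⟩, d, e⟩ := i
  have hb : z ∈ Metric.ball (corner ((i, j), d, e)) 1 ↔
      z + -corner ((i, j), d, e) ∈ Metric.ball (0 : ℂ) 1 := by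
    rw [Metric.mem_ball, Metric.mem_ball, dist_zero_right, ← sub_eq_add_neg, Complex.dist_eq]
  rw [quarterDisk, Set.mem_ofPred_eq, ← hb, Set.mem_inter_iff, and_comm]
  refine and_congr_right fun h => ?_
  rw [corner, mem_ball_pt] at h
  have h1 : |z.re - (2 * i + 1 + d : ℤ)| < 1 := by
    rw [← sq_lt_one_iff_abs_lt_one]
    nlinarith [sq_nonneg (z.im - (2 * j + 1 + e : ℤ))]
  have h2 : |z.im - (2 * j + 1 + e : ℤ)| < 1 := by
    rw [← sq_lt_one_iff_abs_lt_one]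
    nlinarith [sq_nonneg (z.re - (2 * i + 1 + d : ℤ))]
  rw [abs_lt] at h1 h2
  rw [square, Complex.mem_reProdIm, Set.mem_ofPred_eq, Set.mem_ofPred_eq]
  simp only [corner, pt, Complex.add_re, Complex.neg_re, Complex.add_im, Complex.neg_im]
  rcases Int.units_eq_one_or d with rfl | rfl <;> rcases Int.units_eq_one_or e with rfl | rfl <;>
  push_cast at * <;> constructor <;> rintro ⟨h3, h4⟩ <;> constructor <;>
  first | linarith | (constructor <;> linarith)

open MeasureTheory in
theorem volume_square_inter_ball (i : (ℤ × ℤ) × (ℤˣ × ℤˣ)) :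
    volume (square i ∩ Metric.ball (corner i) 1) = ENNReal.ofReal (Real.pi / 4) := by
  rw [← volume_quarterDisk (-i.2.1) (-i.2.2), 
    ← measure_preimage_add_right volume (-corner i) (quarterDisk _ _)]
  congr 1
  ext z
  exact mem_square_inter_ball

open MeasureTheory in
theorem volume_square_diff_ball (i : (ℤ × ℤ) × (ℤˣ × ℤˣ)) :
    volume (square i \ Metric.ball (corner i) 1) = ENNReal.ofReal (1 - Real.pi / 4) := by
  have h := measure_inter_add_sdiff (μ := volume) (square i)
    (Metric.isOpen_ball (x := corner i) (ε := 1)).measurableSet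
  rw [volume_square, volume_square_inter_ball] at h
  rw [ENNReal.ofReal_sub _ (by positivity), ENNReal.ofReal_one, ← h,
    ENNReal.add_sub_cancel_left ENNReal.ofReal_ne_top]

theorem mem_openFace_corner {i : (ℤ × ℤ) × (ℤˣ × ℤˣ)} {z : ℂ}
    (hz : z ∈ Metric.ball (corner i) 1) :
    z ∈ openFace (2 * i.1.1 + 1 + i.2.1) (2 * i.1.2 + 1 + i.2.2) := by
  rw [corner, mem_ball_pt] at hz
  rw [openFace, Set.mem_ofPred_eq, if_pos]
  · exact hz
  · rcases Int.units_eq_one_or i.2.1 with h | h <;> rw [h] <;> push_cast <;> omega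

theorem mem_openFace_gap {i : (ℤ × ℤ) × (ℤˣ × ℤˣ)} {z : ℂ} (hz : z ∈ square i)
    (hb : z ∉ Metric.closedBall (corner i) 1) :
    z ∈ openFace (2 * i.1.1 + 1) (2 * i.1.2 + 1) := by
  obtain ⟨⟨i, j⟩, d, e⟩ := i
  rw [Metric.mem_closedBall, not_le, Complex.dist_eq_re_im, Real.lt_sqrt zero_le_one,
    one_pow] at hb
  simp only [corner, pt] at hb
  obtain ⟨h1, h2⟩ := hz
  simp only [Set.mem_preimage, Set.mem_ofPred_eq] at h1 h2
  rw [openFace, Set.mem_ofPred_eq, if_neg (by dsimp only; omega)]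
  have key : ∀ {x : ℝ} {i : ℤ} {d : ℤˣ}, 0 < ((d : ℤ) : ℝ) * (x - (2 * i + 1)) →
      ((d : ℤ) : ℝ) * (x - (2 * i + 1)) < 1 → |x - (2 * i + 1 : ℤ)| ≤ 1 ∧
      (1 - |x - (2 * i + 1 : ℤ)|) ^ 2 = (x - (2 * i + 1 + d : ℤ)) ^ 2 := by
    intro x i d h1 h2
    rcases Int.units_eq_one_or d with rfl | rfl <;> push_cast at *
    · rw [abs_of_pos (by linarith)]
      exact ⟨by linarith, by ring⟩
    · rw [abs_of_neg (by linarith)]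
      exact ⟨by linarith, by ring⟩
  obtain ⟨k1, k2⟩ := key h1.1 h1.2
  obtain ⟨k3, k4⟩ := key h2.1 h2.2
  dsimp only
  rw [k2, k4]
  exact ⟨k1, k3, hb⟩

theorem pairwise_disjoint_square : Pairwise (Function.onFun Disjoint square) := by
  rintro ⟨⟨i, j⟩, d, e⟩ ⟨⟨i', j'⟩, d', e'⟩ hne
  refine Set.disjoint_left.2 fun z h h' => hne ?_
  have key : ∀ {x : ℝ} {i i' : ℤ} {d d' : ℤˣ}, 0 < ((d : ℤ) : ℝ) * (x - (2 * i + 1)) →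
      ((d : ℤ) : ℝ) * (x - (2 * i + 1)) < 1 → 0 < ((d' : ℤ) : ℝ) * (x - (2 * i' + 1)) →
      ((d' : ℤ) : ℝ) * (x - (2 * i' + 1)) < 1 → i = i' ∧ d = d' := by
    intro x i i' d d' h1 h2 h3 h4
    have h5 : ((4 * i + d - (4 * i' + d') : ℤ) : ℝ) < 2 ∧
        (-2 : ℝ) < (4 * i + d - (4 * i' + d') : ℤ) := by
      rcases Int.units_eq_one_or d with rfl | rfl <;>
      rcases Int.units_eq_one_or d' with rfl | rfl <;> push_cast at * <;> constructor <;> linarith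
    have h6 : 4 * i + d - (4 * i' + d') < 2 := by exact_mod_cast h5.1
    have h7 : -2 < 4 * i + d - (4 * i' + d') := by exact_mod_cast h5.2
    rcases Int.units_eq_one_or d with rfl | rfl <;>
      rcases Int.units_eq_one_or d' with rfl | rfl <;> push_cast at h6 h7 <;>
      first | exact ⟨by omega, rfl⟩ | (exfalso; omega)
  obtain ⟨h1, h2⟩ := h
  obtain ⟨h3, h4⟩ := h'
  obtain ⟨rfl, rfl⟩ := key h1.1 h1.2 h3.1 h3.2
  obtain ⟨rfl, rfl⟩ := key h2.1 h2.2 h4.1 h4.2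
  rfl

open MeasureTheory in
theorem ae_mem_square : ∀ᵐ z : ℂ, z ∈ ⋃ i, square i := by
  have h1 : ∀ᵐ z : ℂ, ∀ n : ℤ, z.re ≠ n := ae_all_iff.2 fun n => Complex.ae_re_ne n
  have h2 : ∀ᵐ z : ℂ, ∀ n : ℤ, z.im ≠ n := ae_all_iff.2 fun n => Complex.ae_im_ne n
  filter_upwards [h1, h2] with z hx hy
  have key : ∀ x : ℝ, (∀ n : ℤ, x ≠ n) → ∃ (i : ℤ) (d : ℤˣ),
      0 < ((d : ℤ) : ℝ) * (x - (2 * i + 1)) ∧ ((d : ℤ) : ℝ) * (x - (2 * i + 1)) < 1 := by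
    intro x hx
    have h1 := lt_of_le_of_ne (Int.floor_le x) (hx _).symm
    have h2 := Int.lt_floor_add_one x
    rcases Int.even_or_odd' ⌊x⌋ with ⟨k, hk | hk⟩ <;> rw [hk] at h1 h2 <;> push_cast at h1 h2
    · exact ⟨k, -1, by push_cast; linarith, by push_cast; linarith⟩
    · exact ⟨k, 1, by push_cast; linarith, by push_cast; linarith⟩
  obtain ⟨i, d, hi⟩ := key _ hx
  obtain ⟨j, e, hj⟩ := key _ hy
  exact Set.mem_iUnion.2 ⟨((i, j), (d, e)), hi, hj⟩

variable (G : GridLoop)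

/-- The region enclosed by the curve. -/
def enclosed : Set ℂ := {z | z ∈ G.carrierᶜ ∧ Bornology.IsBounded (G.comp z)}

theorem mem_enclosed_iff {a b : ℤ} (hab : 2 ∣ a - b) {z : ℂ} (hz : z ∈ openFace a b) :
    z ∈ G.enclosed ↔ G.Odd a b := by
  have h1 := G.disjoint_openFace_carrier hab hz
  rw [← G.isBounded_comp_iff hab (openFace_subset_closedFace a b hz) h1]
  exact and_iff_right h1

-- The circle cuts the square into a piece of a disk and a piece of a gap, each inside or outside as
-- a whole; the arc between them is a null set.
open MeasureTheory Classical in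
theorem volume_enclosed_inter_square (i : (ℤ × ℤ) × (ℤˣ × ℤˣ)) :
    volume (G.enclosed ∩ square i) = ENNReal.ofReal
      ((if G.Odd (2 * i.1.1 + 1 + i.2.1) (2 * i.1.2 + 1 + i.2.2) then Real.pi / 4 else 0) +
        if G.Odd (2 * i.1.1 + 1) (2 * i.1.2 + 1) then 1 - Real.pi / 4 else 0) := by
  have hpi : 0 ≤ 1 - Real.pi / 4 := by linarith [Real.pi_le_four]
  rw [← measure_inter_add_sdiff (μ := volume) (G.enclosed ∩ square i)
    (Metric.isOpen_ball (x := corner i) (ε := 1)).measurableSet, ENNReal.ofReal_add]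
  · congr 1
    · split_ifs with h
      · rw [← volume_square_inter_ball i]
        congr 1
        ext z
        constructor
        · rintro ⟨⟨-, h1⟩, h2⟩
          exact ⟨h1, h2⟩
        · rintro ⟨h1, h2⟩
          refine ⟨⟨(G.mem_enclosed_iff ?_ (mem_openFace_corner h2)).2 h, h1⟩, h2⟩
          rcases Int.units_eq_one_or i.2.1 with h | h <;>
          rcases Int.units_eq_one_or i.2.2 with h' | h' <;> rw [h, h'] <;> push_cast <;> omega
      · rw [ENNReal.ofReal_zero]
        refine measure_mono_null (t := ∅) ?_ measure_empty
        rintro z ⟨⟨h0, h1⟩, h2⟩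
        refine h ((G.mem_enclosed_iff ?_ (mem_openFace_corner h2)).1 h0)
        rcases Int.units_eq_one_or i.2.1 with h | h <;>
        rcases Int.units_eq_one_or i.2.2 with h' | h' <;> rw [h, h'] <;> push_cast <;> omega
    · have hsph : ∀ᵐ z : ℂ, z ∉ Metric.sphere (corner i) 1 :=
        measure_eq_zero_iff_ae_notMem.1 (Measure.addHaar_sphere volume (corner i) 1)
      have hout : ∀ {z : ℂ}, z ∉ Metric.sphere (corner i) 1 → z ∉ Metric.ball (corner i) 1 →
          z ∉ Metric.closedBall (corner i) 1 := by
        intro z h1 h2 h3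
        rw [← Metric.ball_union_sphere] at h3
        exact h3.elim h2 h1
      split_ifs with h
      · rw [← volume_square_diff_ball i]
        apply measure_congr
        rw [Filter.eventuallyEq_set]
        filter_upwards [hsph] with z hz
        constructor
        · rintro ⟨⟨-, h1⟩, h2⟩
          exact ⟨h1, h2⟩
        · rintro ⟨h1, h2⟩
          exact ⟨⟨(G.mem_enclosed_iff (by omega)
            (mem_openFace_gap h1 (hout hz h2))).2 h, h1⟩, h2⟩
      · rw [ENNReal.ofReal_zero, measure_eq_zero_iff_ae_notMem]
        filter_upwards [hsph] with z hz
        rintro ⟨⟨h0, h1⟩, h2⟩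
        exact h ((G.mem_enclosed_iff (by omega) (mem_openFace_gap h1 (hout hz h2))).1 h0)
  · split_ifs <;> positivity
  · split_ifs
    exacts [hpi, le_rfl]

/-- The gaps inside the curve. -/
def innerGaps : Set (ℤ × ℤ) := {p | G.Odd (2 * p.1 + 1) (2 * p.2 + 1)}

theorem finite_innerGaps : G.innerGaps.Finite := by
  obtain ⟨N, hN⟩ := G.exists_bound_odd
  refine ((Set.finite_Icc (-N) N).prod (Set.finite_Icc (-N) N)).subset ?_
  rintro ⟨i, j⟩ h
  have := hN _ _ (by dsimp only; omega) h
  rw [abs_le, abs_le] at this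
  dsimp only at this
  exact ⟨⟨by dsimp only; omega, by dsimp only; omega⟩, by dsimp only; omega, by dsimp only; omega⟩

open Classical in
/-- How much more of a square the curve encloses near the circle than near the gap. -/
noncomputable def defect (i : (ℤ × ℤ) × (ℤˣ × ℤˣ)) : ℤ :=
  (if G.Odd (2 * i.1.1 + 1 + i.2.1) (2 * i.1.2 + 1 + i.2.2) then 1 else 0) -
    if G.Odd (2 * i.1.1 + 1) (2 * i.1.2 + 1) then 1 else 0

/-- The square that contains the `k`-th link. -/
def linkSquare (k : ℤ) : (ℤ × ℤ) × (ℤˣ × ℤˣ) :=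
  ((G.px k + if G.dx k = 1 then 0 else -1, G.py k + if G.dy k = 1 then 0 else -1),
    (if G.dx k = 1 then -1 else 1, if G.dy k = 1 then -1 else 1))

theorem linkSquare_eq_iff (k : ℤ) (i : (ℤ × ℤ) × (ℤˣ × ℤˣ)) : G.linkSquare k = i ↔
    G.ex k = 4 * i.1.1 + 2 + i.2.1 ∧ G.ey k = 4 * i.1.2 + 2 + i.2.2 := by
  obtain ⟨⟨i, j⟩, d, e⟩ := i
  have hl := G.link k
  unfold linkSquare ex ey
  simp only [Prod.mk.injEq]
  rcases Int.units_eq_one_or d with rfl | rfl <;> rcases Int.units_eq_one_or e with rfl | rfl <;>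
  rcases hl.1 with h | h <;> rcases hl.2.1 with h' | h' <;> rw [h, h'] <;> norm_num <;> omega

theorem defect_linkSquare (k : ℤ) : G.defect (G.linkSquare k) = G.s k * G.s G.base := by
  have hl := G.link k
  have h1 : 2 * (G.linkSquare k).1.1 + 1 = 2 * G.px k + G.dx k ∧
      2 * (G.linkSquare k).1.2 + 1 = 2 * G.py k + G.dy k := by
    unfold linkSquare
    dsimp only
    constructor <;> split_ifs <;> omega
  have h2 : (((G.linkSquare k).2.1 : ℤˣ) : ℤ) = -G.dx k ∧
      (((G.linkSquare k).2.2 : ℤˣ) : ℤ) = -G.dy k := by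
    unfold linkSquare
    dsimp only
    constructor <;> split_ifs <;> push_cast <;> omega
  rw [defect, h1.1, h1.2, h2.1, h2.2, add_neg_cancel_right, add_neg_cancel_right]
  simp only [odd_disk_iff, odd_gap_iff]
  rcases G.s_eq k with h | h <;> rcases G.s_eq G.base with h' | h' <;> rw [h, h'] <;> norm_num

/-- Parity changes across a square only if it contains a link, and each link has its own square. The
defects are the products `s k * s base`, with sum `4 (s base)² = 4`. -/
theorem sum_defect (hG : ∑ k ∈ Finset.range G.n, G.s k = 4 * G.s G.base)
    (F : Finset ((ℤ × ℤ) × (ℤˣ × ℤˣ))) (hF : ∀ i, G.defect i ≠ 0 → i ∈ F) :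
    ∑ i ∈ F, G.defect i = 4 := by
  classical
  have hne : ∀ k, G.s k * G.s G.base ≠ 0 := by
    intro k
    have h1 := G.s_eq k
    have h2 := G.s_eq G.base
    exact mul_ne_zero (by omega) (by omega)
  have hinj : Set.InjOn (fun k : ℕ => G.linkSquare k) (Finset.range G.n) := by
    intro k hk l hl h
    have h1 := (G.linkSquare_eq_iff k _).1 h
    have h2 := (G.linkSquare_eq_iff l _).1 rfl
    have := G.e_inj (h1.1.trans h2.1.symm) (h1.2.trans h2.2.symm)
    rw [Finset.coe_range, Set.mem_Iio] at hk hl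
    have := Int.eq_zero_of_abs_lt_dvd this (by rw [abs_lt]; omega)
    omega
  have hsub : (Finset.range G.n).image (fun k : ℕ => G.linkSquare k) ⊆ F := by
    intro i hi
    obtain ⟨k, -, rfl⟩ := Finset.mem_image.1 hi
    exact hF _ (by rw [defect_linkSquare]; exact hne k)
  rw [← Finset.sum_subset hsub, Finset.sum_image hinj]
  · simp only [defect_linkSquare]
    rw [← Finset.sum_mul, hG]
    rcases G.s_eq G.base with h | h <;> rw [h] <;> norm_num
  · intro i _ hi
    by_contra hd
    have hodd : ¬ (G.Odd (2 * i.1.1 + 1) (2 * i.1.2 + 1) ↔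
        G.Odd (2 * i.1.1 + 1 + i.2.1) (2 * i.1.2 + 1 + i.2.2)) := by
      intro h
      apply hd
      unfold defect
      simp [h]
    have hu : ∀ d : ℤˣ, (d : ℤ) = 1 ∨ (d : ℤ) = -1 := fun d => by
      rcases Int.units_eq_one_or d with rfl | rfl <;> simp
    have hd1 := hu i.2.1
    have hd2 := hu i.2.2
    rw [G.odd_iff_odd (by omega) (by omega) (by omega), not_not] at hodd
    obtain ⟨k, hk, h1, h2⟩ := hodd.exists_range
    refine hi (Finset.mem_image.2 ⟨k, hk, ?_⟩)
    rw [linkSquare_eq_iff]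
    constructor <;> omega

open MeasureTheory in
/-- The area enclosed by the curve. -/
theorem volume_enclosed (hG : ∑ k ∈ Finset.range G.n, G.s k = 4 * G.s G.base) :
    volume G.enclosed = ENNReal.ofReal (4 * (G.innerGaps.ncard : ℝ) + Real.pi) := by
  classical
  have hpi : 0 ≤ 1 - Real.pi / 4 := by linarith [Real.pi_le_four]
  obtain ⟨N, hN⟩ := G.exists_bound_odd
  set B : Finset (ℤ × ℤ) := Finset.Icc (-N - 1) N ×ˢ Finset.Icc (-N - 1) N with hB
  have hu : ∀ d : ℤˣ, (d : ℤ) = 1 ∨ (d : ℤ) = -1 := fun d => by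
    rcases Int.units_eq_one_or d with rfl | rfl <;> simp
  have hBg : ∀ p : ℤ × ℤ, G.Odd (2 * p.1 + 1) (2 * p.2 + 1) → p ∈ B := by
    intro p h
    have := hN _ _ (by omega) h
    rw [abs_le, abs_le] at this
    rw [hB, Finset.mem_product, Finset.mem_Icc, Finset.mem_Icc]
    omega
  have hBc : ∀ i : (ℤ × ℤ) × (ℤˣ × ℤˣ),
      G.Odd (2 * i.1.1 + 1 + i.2.1) (2 * i.1.2 + 1 + i.2.2) → i.1 ∈ B := by
    intro i h
    have h1 := hu i.2.1
    have h2 := hu i.2.2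
    have := hN _ _ (by omega) h
    rw [abs_le, abs_le] at this
    rw [hB, Finset.mem_product, Finset.mem_Icc, Finset.mem_Icc]
    omega
  set F : Finset ((ℤ × ℤ) × (ℤˣ × ℤˣ)) := B ×ˢ Finset.univ with hF
  set v : (ℤ × ℤ) × (ℤˣ × ℤˣ) → ℝ := fun i =>
    (if G.Odd (2 * i.1.1 + 1 + i.2.1) (2 * i.1.2 + 1 + i.2.2) then Real.pi / 4 else 0) +
        if G.Odd (2 * i.1.1 + 1) (2 * i.1.2 + 1) then 1 - Real.pi / 4 else 0 with hv
  have hv0 : ∀ i, 0 ≤ v i := by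
    intro i
    rw [hv]
    dsimp only
    split_ifs <;> linarith [Real.pi_pos]
  have h1 : volume G.enclosed = ∑' i, ENNReal.ofReal (v i) := by
    have e1 : volume G.enclosed = (volume.restrict (⋃ i, square i)) G.enclosed := by
      rw [Measure.restrict_eq_self_of_ae_mem ae_mem_square]
    rw [e1, Measure.restrict_iUnion pairwise_disjoint_square measurableSet_square,
      Measure.sum_apply_of_countable]
    congr 1
    ext i
    rw [Measure.restrict_apply' (measurableSet_square i), volume_enclosed_inter_square]
  rw [h1, tsum_eq_sum (s := F), ← ENNReal.ofReal_sum_of_nonneg (fun i _ => hv0 i)]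
  · congr 1
    -- This splitting separates the count of gaps from the turning: each gap has four squares, and
    -- the defects sum to 4.
    have e2 : ∀ i, v i = (if G.Odd (2 * i.1.1 + 1) (2 * i.1.2 + 1) then (1 : ℝ) else 0) +
        Real.pi / 4 * (G.defect i : ℝ) := by
      intro i
      simp only [hv, defect]
      push_cast
      split_ifs <;> ring
    simp only [e2]
    rw [Finset.sum_add_distrib, ← Finset.mul_sum, ← Int.cast_sum, G.sum_defect hG]
    · have hcard : Fintype.card ℤˣ = 2 := rfl
      have e3 : ∀ p ∈ B, (∑ x : ℤˣ × ℤˣ,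
          if G.Odd (2 * (p, x).1.1 + 1) (2 * (p, x).1.2 + 1) then (1 : ℝ) else 0) =
          4 * if G.Odd (2 * p.1 + 1) (2 * p.2 + 1) then (1 : ℝ) else 0 := by
        intro p _
        by_cases h : G.Odd (2 * p.1 + 1) (2 * p.2 + 1)
        · simp [h, hcard]
        · simp [h]
      rw [hF, Finset.sum_product, Finset.sum_congr rfl e3, ← Finset.mul_sum, Finset.sum_boole]
      have : G.innerGaps = (B.filter fun p => G.Odd (2 * p.1 + 1) (2 * p.2 + 1) : Finset _) := by
        ext p
        rw [Finset.coe_filter]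
        exact ⟨fun h => ⟨hBg p h, h⟩, fun h => h.2⟩
      rw [this, Set.ncard_coe_finset]
      push_cast
      ring
    · intro i hi
      rw [hF, Finset.mem_product]
      refine ⟨?_, Finset.mem_univ _⟩
      by_contra hcon
      refine hi ?_
      rw [defect, if_neg (fun h => hcon (hBc i h)), if_neg (fun h => hcon (hBg _ h)), sub_zero]
  · intro i hi
    have hcon : i.1 ∉ B := fun h => hi (Finset.mem_product.2 ⟨h, Finset.mem_univ _⟩)
    simp only [hv]
    rw [if_neg (fun h => hcon (hBc i h)), if_neg (fun h => hcon (hBg _ h))]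
    simp

end GridLoop

/-! ### Black circles and the gaps between them -/

namespace GridLoop

variable (G : GridLoop)

/-- Links on circles of the same colour have the same sense of rotation. -/
theorem color_iff (k : ℤ) :
    2 ∣ G.px k + G.py k - (G.px G.base + G.py G.base) ↔ G.s k = G.s G.base := by
  have hstep : ∀ k, (G.s (k + 1) = G.s k ↔ 2 ∣ G.px (k + 1) + G.py (k + 1) - (G.px k + G.py k)) := by
    intro k
    have := G.joint k
    have := G.link k
    have := G.s_eq k
    omega
  have hs := G.s_eq
  induction k using Int.inductionOn' (b := G.base) with
  | zero => simp
  | succ k _ ih =>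
    have := hstep k
    have := hs k
    have := hs (k + 1)
    have := hs G.base
    omega
  | pred k _ ih =>
    have := hstep (k - 1)
    rw [sub_add_cancel] at this
    have := hs k
    have := hs (k - 1)
    have := hs G.base
    omega

/-- The black circles: those of the colour of the circle of the base link. -/
def Black (p : ℤ × ℤ) : Prop := 2 ∣ p.1 + p.2 - (G.px G.base + G.py G.base)

/-- Two circles are joined if the segment between their centers avoids the curve and the other
circles of the packing. -/
def Joined (p q : ℤ × ℤ) : Prop :=
  p ≠ q ∧ Disjoint (segment ℝ (pt (2 * p.1) (2 * p.2)) (pt (2 * q.1) (2 * q.2))) G.carrier ∧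
    ∀ s : ℤ × ℤ, s ≠ p → s ≠ q →
      Disjoint (segment ℝ (pt (2 * p.1) (2 * p.2)) (pt (2 * q.1) (2 * q.2)))
        (Metric.sphere (pt (2 * s.1) (2 * s.2)) 1)

theorem mem_sphere_pt {a b : ℤ} {z : ℂ} :
    z ∈ Metric.sphere (pt a b) 1 ↔ (z.re - a) ^ 2 + (z.im - b) ^ 2 = 1 := by
  rw [Metric.mem_sphere, Complex.dist_eq_re_im, Real.sqrt_eq_one]
  rfl

theorem pt_add_mem_segment (a b a' b' : ℤ) {t : ℝ} (ht : t ∈ Set.Icc (0 : ℝ) 1) :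
    (⟨a + t * (a' - a), b + t * (b' - b)⟩ : ℂ) ∈ segment ℝ (pt a b) (pt a' b') := by
  rw [segment_eq_image]
  refine ⟨t, ht, ?_⟩
  apply Complex.ext <;> simp [pt] <;> ring

/-- A segment that starts at the center of a circle and comes close to the center of another
circle meets the latter. -/
theorem not_disjoint_sphere {p q s : ℤ × ℤ} (hs : s ≠ p) {t : ℝ} (ht : t ∈ Set.Icc (0 : ℝ) 1)
    (h : (p.1 + t * (q.1 - p.1) - s.1) ^ 2 + (p.2 + t * (q.2 - p.2) - s.2) ^ 2 ≤ 1 / 4) :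
    ¬ Disjoint (segment ℝ (pt (2 * p.1) (2 * p.2)) (pt (2 * q.1) (2 * q.2)))
        (Metric.sphere (pt (2 * s.1) (2 * s.2)) 1) := by
  -- A quarter of the squared distance to the center of circle `s`. It is at least `1` at the start
  -- and at most `1/4` at `t`, and the value `1/4` means a point on the circle.
  set f : ℝ → ℝ := fun t =>
    (p.1 + t * (q.1 - p.1) - s.1) ^ 2 + (p.2 + t * (q.2 - p.2) - s.2) ^ 2 with hf
  have hfc : Continuous f := by fun_prop
  have h0 : (1 : ℝ) ≤ f 0 := by
    have : 1 ≤ (p.1 - s.1) ^ 2 + (p.2 - s.2) ^ 2 := by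
      have : p.1 - s.1 ≠ 0 ∨ p.2 - s.2 ≠ 0 := by
        by_contra! hcon
        exact hs (Prod.ext (by omega) (by omega))
      rcases this with h | h
      · have := Int.one_le_abs h
        nlinarith [sq_abs (p.1 - s.1), sq_nonneg (p.2 - s.2)]
      · have := Int.one_le_abs h
        nlinarith [sq_abs (p.2 - s.2), sq_nonneg (p.1 - s.1)]
    have h' : (1 : ℝ) ≤ ((p.1 : ℝ) - s.1) ^ 2 + ((p.2 : ℝ) - s.2) ^ 2 := by exact_mod_cast this
    simpa [hf] using h'
  obtain ⟨τ, hτ, hfτ⟩ := intermediate_value_Icc' ht.1 hfc.continuousOn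
    (show (1 / 4 : ℝ) ∈ Set.Icc (f t) (f 0) from ⟨h, by linarith⟩)
  rw [Set.not_disjoint_iff]
  refine ⟨_, pt_add_mem_segment _ _ _ _ ⟨hτ.1, hτ.2.trans ht.2⟩, ?_⟩
  rw [mem_sphere_pt]
  simp only [hf] at hfτ
  push_cast
  linear_combination 4 * hfτ

/-- At `t = 1 / |a|` the segment has moved one column away from its start, which is not yet the
column of its end as `|a| ≥ 2`. The nearest lattice point in this column is at distance at most
`1/2`. -/
theorem exists_near {x : ℝ} {a b : ℤ} (ha : 2 ≤ |a|) :
    ∃ t ∈ Set.Icc (0 : ℝ) 1, ∃ d e : ℤ, d ≠ 0 ∧ d ≠ a ∧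
      (t * a - d) ^ 2 + (x + t * b - e) ^ 2 ≤ 1 / 4 := by
  have ha' : (2 : ℝ) ≤ |(a : ℝ)| := by exact_mod_cast ha
  refine ⟨1 / |(a : ℝ)|, ⟨by positivity, (div_le_one (by linarith)).2 (by linarith)⟩,
    if 0 < a then 1 else -1, round (x + 1 / |(a : ℝ)| * b), by split_ifs <;> norm_num, ?_, ?_⟩
  · rw [le_abs] at ha
    split_ifs <;> omega
  · have h1 : 1 / |(a : ℝ)| * a = ((if 0 < a then 1 else -1 : ℤ) : ℝ) := by
      split_ifs with h
      · have : (0 : ℝ) < a := by exact_mod_cast h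
        rw [abs_of_pos this]
        push_cast
        field_simp
      · have : (a : ℝ) < 0 := by
          rw [le_abs] at ha
          exact_mod_cast (by omega : a < 0)
        rw [abs_of_neg this, one_div, inv_neg, neg_mul, inv_mul_cancel₀ this.ne]
        norm_num
    rw [h1, sub_self]
    have h2 := abs_sub_round (x + 1 / |(a : ℝ)| * b)
    rw [abs_le] at h2
    nlinarith

/-- Joined circles of the same colour are diagonal neighbours. -/
theorem Joined.diagonal {p q : ℤ × ℤ} (h : G.Joined p q) (hp : G.Black p) (hq : G.Black q) :
    (q.1 = p.1 + 1 ∨ q.1 = p.1 - 1) ∧ (q.2 = p.2 + 1 ∨ q.2 = p.2 - 1) := by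
  obtain ⟨hne, -, hs⟩ := h
  unfold Black at hp hq
  have h1 : ¬ 2 ≤ |q.1 - p.1| := by
    intro ha
    obtain ⟨t, ht, d, e, hd, hda, hle⟩ := exists_near (x := 0) (b := q.2 - p.2) ha
    refine not_disjoint_sphere (p := p) (q := q) (s := (p.1 + d, p.2 + e)) ?_ ht ?_ (hs _ ?_ ?_)
    · intro h
      have := congrArg Prod.fst h
      dsimp only at this
      omega
    · push_cast at hle ⊢
      linarith
    · intro h
      have := congrArg Prod.fst h
      dsimp only at this
      omega
    · intro h
      have := congrArg Prod.fst h
      dsimp only at this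
      omega
  have h2 : ¬ 2 ≤ |q.2 - p.2| := by
    intro ha
    obtain ⟨t, ht, d, e, hd, hda, hle⟩ := exists_near (x := 0) (b := q.1 - p.1) ha
    refine not_disjoint_sphere (p := p) (q := q) (s := (p.1 + e, p.2 + d)) ?_ ht ?_ (hs _ ?_ ?_)
    · intro h
      have := congrArg Prod.snd h
      dsimp only at this
      omega
    · push_cast at hle ⊢
      linarith
    · intro h
      have := congrArg Prod.snd h
      dsimp only at this
      omega
    · intro h
      have := congrArg Prod.snd h
      dsimp only at this
      omega
  rw [le_abs] at h1 h2
  have h3 : ¬ (q.1 = p.1 ∧ q.2 = p.2) := fun h => hne (Prod.ext h.1.symm h.2.symm)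
  omega

/-- The gap between two joined diagonal neighbours inside the curve is inside. -/
theorem Joined.odd {p q : ℤ × ℤ} (h : G.Joined p q)
    (h1 : q.1 = p.1 + 1 ∨ q.1 = p.1 - 1) (h2 : q.2 = p.2 + 1 ∨ q.2 = p.2 - 1)
    (hodd : G.Odd (2 * p.1) (2 * p.2)) : G.Odd (p.1 + q.1) (p.2 + q.2) := by
  rw [G.odd_iff_isBounded (by omega)] at hodd ⊢
  have hsub : segment ℝ (pt (2 * p.1) (2 * p.2)) (pt (p.1 + q.1) (p.2 + q.2)) ⊆ G.carrierᶜ := by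
    refine Set.Subset.trans ?_ (Set.disjoint_left.1 h.2.1)
    apply (convex_segment _ _).segment_subset (left_mem_segment ℝ _ _)
    have := pt_add_mem_segment (2 * p.1) (2 * p.2) (2 * q.1) (2 * q.2) (t := 1 / 2)
      ⟨by norm_num, by norm_num⟩
    convert this using 1
    unfold pt
    push_cast
    congr 1 <;> ring
  rwa [← G.comp_eq_of_segment hsub]

/-- A gap inside the curve is not separated by the curve from the black circles around it. -/
theorem not_used_of_odd_gap {c g : ℤ × ℤ} (hc : G.Black c)
    (h1 : g.1 = 2 * c.1 + 1 ∨ g.1 = 2 * c.1 - 1) (h2 : g.2 = 2 * c.2 + 1 ∨ g.2 = 2 * c.2 - 1)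
    (hg : G.Odd g.1 g.2) : ¬ G.Used (2 * c.1 + g.1) (2 * c.2 + g.2) := by
  rintro ⟨k, hx, hy⟩
  have hl := G.link k
  unfold ex at hx
  unfold ey at hy
  have hk : c.1 = G.px k ∧ c.2 = G.py k ∧ g.1 = 2 * G.px k + G.dx k ∧
      g.2 = 2 * G.py k + G.dy k := by omega
  -- Such a link lies on a black circle, hence rotates like the base link, and then its gap is
  -- outside.
  rw [hk.2.2.1, hk.2.2.2, odd_gap_iff] at hg
  unfold Black at hc
  rw [hk.1, hk.2.1, color_iff] at hc
  exact hg hc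

theorem odd_of_odd_gap {c g : ℤ × ℤ} (hc : G.Black c)
    (h1 : g.1 = 2 * c.1 + 1 ∨ g.1 = 2 * c.1 - 1) (h2 : g.2 = 2 * c.2 + 1 ∨ g.2 = 2 * c.2 - 1)
    (hg : G.Odd g.1 g.2) : G.Odd (2 * c.1) (2 * c.2) :=
  ((G.odd_iff_odd (by omega) h1 h2).2 (G.not_used_of_odd_gap hc h1 h2 hg)).2 hg

/-- In coordinates halved so that circles have radius `1/2`, the diagonal of a lattice square stays
clear of the circles centered at all other lattice points: off the diagonal the squared distance is
at least `(a - b)² / 2`. -/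
theorem one_lt_sq_add_sq {a b : ℤ} (h : ¬ (a = 0 ∧ b = 0)) (h' : ¬ (a = 1 ∧ b = 1)) {t : ℝ}
    (ht : t ∈ Set.Icc (0 : ℝ) 1) : 1 / 4 < (t - a) ^ 2 + (t - b) ^ 2 := by
  by_cases hab : a = b
  · subst hab
    have : a ≤ -1 ∨ 2 ≤ a := by omega
    rcases this with h1 | h1
    · have : (a : ℝ) ≤ -1 := by exact_mod_cast h1
      nlinarith [ht.1, ht.2]
    · have : (2 : ℝ) ≤ a := by exact_mod_cast h1
      nlinarith [ht.1, ht.2]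
  · have h1 := Int.one_le_abs (sub_ne_zero.2 hab)
    have h2 : 1 ≤ (a - b) ^ 2 := by nlinarith [sq_abs (a - b)]
    have h3 : (1 : ℝ) ≤ ((a : ℝ) - b) ^ 2 := by exact_mod_cast h2
    nlinarith [sq_nonneg ((t - a) + (t - b))]

/-- Two black circles around a gap inside the curve are joined. -/
theorem joined_of_odd_gap {p q : ℤ × ℤ} (hp : G.Black p) (hq : G.Black q)
    (h1 : q.1 = p.1 + 1 ∨ q.1 = p.1 - 1) (h2 : q.2 = p.2 + 1 ∨ q.2 = p.2 - 1)
    (hg : G.Odd (p.1 + q.1) (p.2 + q.2)) : G.Joined p q := by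
  refine ⟨fun h => by rw [h] at h1; omega, ?_, ?_⟩
  · rw [Set.disjoint_left]
    intro z hz
    have e1 := G.segment_subset_of_not_used (a := 2 * p.1) (b := 2 * p.2) (a' := p.1 + q.1)
      (b' := p.2 + q.2) (by omega) (by omega) (by omega)
      (G.not_used_of_odd_gap (g := (p.1 + q.1, p.2 + q.2)) hp (by dsimp only; omega)
        (by dsimp only; omega) hg)
    have e2 := G.segment_subset_of_not_used (a := 2 * q.1) (b := 2 * q.2) (a' := p.1 + q.1)
      (b' := p.2 + q.2) (by omega) (by omega) (by omega)
      (G.not_used_of_odd_gap (g := (p.1 + q.1, p.2 + q.2)) hq (by dsimp only; omega)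
        (by dsimp only; omega) hg)
    obtain ⟨t, ht, hx, hy⟩ := mem_segment_pt hz
    push_cast at hx hy
    rcases le_total t (1 / 2) with h | h
    · apply e1
      have := pt_add_mem_segment (2 * p.1) (2 * p.2) (p.1 + q.1) (p.2 + q.2) (t := 2 * t)
        ⟨by linarith [ht.1], by linarith⟩
      convert this using 1
      apply Complex.ext
      · rw [hx]; push_cast; ring
      · rw [hy]; push_cast; ring
    · apply e2
      have := pt_add_mem_segment (2 * q.1) (2 * q.2) (p.1 + q.1) (p.2 + q.2) (t := 2 * (1 - t))
        ⟨by linarith [ht.2], by linarith⟩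
      convert this using 1
      apply Complex.ext
      · rw [hx]; push_cast; ring
      · rw [hy]; push_cast; ring
  · intro s hsp hsq
    rw [Set.disjoint_left]
    intro z hz hzs
    obtain ⟨t, ht, hx, hy⟩ := mem_segment_pt hz
    rw [mem_sphere_pt, hx, hy] at hzs
    have h3 : ¬ (s.1 = p.1 ∧ s.2 = p.2) := fun h => hsp (Prod.ext h.1 h.2)
    have h4 : ¬ (s.1 = q.1 ∧ s.2 = q.2) := fun h => hsq (Prod.ext h.1 h.2)
    obtain ⟨d, hd⟩ : ∃ d, q.1 = p.1 + d := ⟨q.1 - p.1, by ring⟩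
    obtain ⟨e, he⟩ : ∃ e, q.2 = p.2 + e := ⟨q.2 - p.2, by ring⟩
    have hd1 : d = 1 ∨ d = -1 := by omega
    have he1 : e = 1 ∨ e = -1 := by omega
    rw [hd, he] at h4 hzs
    clear hx hy hz
    -- Reflections by the signs `d` and `e` carry the segment to the one from `(0, 0)` to `(1, 1)`.
    have key := one_lt_sq_add_sq (a := (s.1 - p.1) * d) (b := (s.2 - p.2) * e)
      (by rcases hd1 with rfl | rfl <;> rcases he1 with rfl | rfl <;> omega)
      (by rcases hd1 with rfl | rfl <;> rcases he1 with rfl | rfl <;> omega) ht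
    push_cast at key hzs
    rcases hd1 with rfl | rfl <;> rcases he1 with rfl | rfl <;> push_cast at * <;>
    nlinarith

end GridLoop

/-! ### Transport to the Tangle and its dual graph -/

namespace Tangle

variable {r : ℝ} (T : Tangle r)

theorem norm_frame_coeff (hr : 0 < r) : ‖(r * T.start 0 : ℂ)‖ = r := by
  rw [norm_mul, T.norm_start, mul_one, Complex.norm_real, Real.norm_eq_abs, abs_of_pos hr]

theorem frame_coeff_ne_zero (hr : 0 < r) : (r * T.start 0 : ℂ) ≠ 0 := by
  rw [← norm_ne_zero_iff, T.norm_frame_coeff hr]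
  exact hr.ne'

theorem dist_frame (hr : 0 < r) (z w : ℂ) : dist (T.frame z) (T.frame w) = r * dist z w := by
  rw [frame, frame, dist_add_left, Complex.dist_eq, Complex.dist_eq, ← mul_sub, norm_mul,
    T.norm_frame_coeff hr]

/-- `Tangle.frame` as a homeomorphism of the plane. -/
noncomputable def frameHomeomorph (hr : 0 < r) : ℂ ≃ₜ ℂ :=
  (Homeomorph.mulLeft₀ _ (T.frame_coeff_ne_zero hr)).trans (Homeomorph.addLeft (T.center 0))

theorem coe_frameHomeomorph (hr : 0 < r) : ⇑(T.frameHomeomorph hr) = T.frame := rfl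

theorem isBounded_image_frame (hr : 0 < r) (S : Set ℂ) :
    Bornology.IsBounded (T.frame '' S) ↔ Bornology.IsBounded S := by
  simp only [Metric.isBounded_iff, Set.forall_mem_image, T.dist_frame hr]
  constructor
  · rintro ⟨C, hC⟩
    exact ⟨C / r, fun x hx y hy => (le_div_iff₀' hr).2 (hC hx hy)⟩
  · rintro ⟨C, hC⟩
    exact ⟨r * C, fun x hx y hy => mul_le_mul_of_nonneg_left (hC hx hy) hr.le⟩

theorem enclosed_eq (hr : 0 < r) {G : GridLoop} (hG : T.carrier = T.frame '' G.carrier) :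
    T.enclosed = T.frame '' G.enclosed := by
  have hcompl : T.carrierᶜ = T.frame '' G.carrierᶜ := by
    rw [hG, ← T.coe_frameHomeomorph hr, Set.image_compl_eq (T.frameHomeomorph hr).bijective]
  have key : ∀ z, T.frame z ∈ T.enclosed ↔ z ∈ G.enclosed := by
    intro z
    rw [enclosed, Set.mem_ofPred_eq, hcompl, (T.frame_injective hr).mem_set_image]
    refine and_congr_right fun hz => ?_
    have := (T.frameHomeomorph hr).image_connectedComponentIn hz
    rw [coe_frameHomeomorph] at this
    rw [← this, T.isBounded_image_frame hr]
    rfl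
  ext z
  constructor
  · intro hz
    obtain ⟨w, rfl⟩ := (T.frameHomeomorph hr).surjective z
    exact ⟨w, (key w).1 hz, rfl⟩
  · rintro ⟨w, hw, rfl⟩
    exact (key w).2 hw

open MeasureTheory in
theorem volume_image_frame (hr : 0 < r) (S : Set ℂ) :
    volume (T.frame '' S) = ENNReal.ofReal (r ^ 2) * volume S := by
  have h1 : T.frame '' S = (fun z => T.center 0 + z) ''
      (LinearMap.mulLeft ℝ (r * T.start 0 : ℂ) '' S) := by
    rw [Set.image_image]
    rfl
  have hdet : LinearMap.det (LinearMap.mulLeft ℝ (r * T.start 0 : ℂ)) = r ^ 2 := by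
    have := Algebra.norm_apply ℝ (r * T.start 0 : ℂ)
    rw [Algebra.norm_complex_apply, Complex.normSq_eq_norm_sq, T.norm_frame_coeff hr] at this
    exact this.symm
  rw [h1, Set.image_add_left, measure_preimage_add, Measure.addHaar_image_linearMap, hdet,
    abs_of_nonneg (sq_nonneg r)]

theorem image_frame_segment (z w : ℂ) :
    segment ℝ (T.frame z) (T.frame w) = T.frame '' segment ℝ z w := by
  rw [segment_eq_image, segment_eq_image, Set.image_image]
  congr 1
  ext t
  simp only [frame, Complex.real_smul]
  push_cast
  ring

theorem image_frame_sphere (hr : 0 < r) (z : ℂ) :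
    Metric.sphere (T.frame z) r = T.frame '' Metric.sphere z 1 := by
  ext w
  obtain ⟨w, rfl⟩ := (T.frameHomeomorph hr).surjective w
  rw [coe_frameHomeomorph, (T.frame_injective hr).mem_set_image, Metric.mem_sphere,
    Metric.mem_sphere, T.dist_frame hr, mul_eq_left₀ hr.ne']

theorem image_frame_ball (hr : 0 < r) (z : ℂ) :
    Metric.ball (T.frame z) r = T.frame '' Metric.ball z 1 := by
  ext w
  obtain ⟨w, rfl⟩ := (T.frameHomeomorph hr).surjective w
  rw [coe_frameHomeomorph, (T.frame_injective hr).mem_set_image, Metric.mem_ball,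
    Metric.mem_ball, T.dist_frame hr, mul_lt_iff_lt_one_right hr]

theorem packingCenter_eq (p : ℤ × ℤ) :
    T.packingCenter p = T.frame (GridLoop.pt (2 * p.1) (2 * p.2)) := by
  have : GridLoop.pt (2 * p.1) (2 * p.2) = 2 * ((p.1 : ℂ) + (p.2 : ℂ) * Complex.I) := by
    apply Complex.ext <;> simp [GridLoop.pt]
  rw [packingCenter, frame, this]
  ring

theorem circleInside_iff (hr : 0 < r) {G : GridLoop} (hG : T.carrier = T.frame '' G.carrier)
    (p : ℤ × ℤ) : T.CircleInside p ↔ G.Odd (2 * p.1) (2 * p.2) := by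
  have hface : ∀ z ∈ Metric.ball (GridLoop.pt (2 * p.1) (2 * p.2)) 1,
      (z ∈ G.enclosed ↔ G.Odd (2 * p.1) (2 * p.2)) := by
    intro z hz
    refine G.mem_enclosed_iff (by omega) ?_
    rw [GridLoop.mem_ball_pt] at hz
    rw [GridLoop.openFace, Set.mem_ofPred_eq, if_pos (by omega)]
    exact hz
  rw [CircleInside, packingCenter_eq, T.image_frame_ball hr, T.enclosed_eq hr hG,
    Set.image_subset_image_iff (T.frame_injective hr)]
  constructor
  · intro h
    have := Metric.mem_ball_self (x := GridLoop.pt (2 * p.1) (2 * p.2)) one_pos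
    exact (hface _ this).1 (h this)
  · exact fun h z hz => (hface z hz).2 h

/-- All circles that carry a link and lie inside have the sense of rotation, hence the colour, of
the base circle, which is one of them. So the existential in the definition of black picks out a
single colour. -/
theorem isBlack_iff (hr : 0 < r) {G : GridLoop} (hG : T.carrier = T.frame '' G.carrier)
    (hc : ∀ k, T.center k = T.frame (2 * (G.px k + G.py k * Complex.I))) (p : ℤ × ℤ) :
    T.IsBlack p ↔ G.Black p := by
  have hc' : ∀ k, T.center k = T.packingCenter (G.px k, G.py k) := by
    intro k
    rw [hc, packingCenter_eq]
    congr 1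
    apply Complex.ext <;> simp [GridLoop.pt]
  unfold IsBlack GridLoop.Black
  constructor
  · rintro ⟨k, q, hq, hin, heven⟩
    rw [hc', packingCenter_eq, packingCenter_eq] at hq
    have hpt := T.frame_injective hr hq
    have h1 : (2 * q.1 : ℤ) = 2 * G.px k := Int.cast_injective (α := ℝ) (congrArg Complex.re hpt)
    have h2 : (2 * q.2 : ℤ) = 2 * G.py k := Int.cast_injective (α := ℝ) (congrArg Complex.im hpt)
    rw [T.circleInside_iff hr hG, h1, h2, GridLoop.odd_disk_iff, ← GridLoop.color_iff] at hin
    rw [even_iff_two_dvd] at heven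
    omega
  · intro h
    refine ⟨G.base, (G.px G.base, G.py G.base), (hc' _).symm, ?_, even_iff_two_dvd.2 h⟩
    rw [T.circleInside_iff hr hG, GridLoop.odd_disk_iff]

theorem adj_iff (hr : 0 < r) {G : GridLoop} (hG : T.carrier = T.frame '' G.carrier)
    (p q : T.dualVertices) : T.dualGraph.Adj p q ↔ G.Joined p q := by
  have hinj := T.frame_injective hr
  change (p ≠ q ∧ _ ∧ _) ↔ _
  unfold GridLoop.Joined
  rw [← Subtype.coe_ne_coe]
  simp only [packingCenter_eq, image_frame_segment, T.image_frame_sphere hr, hG,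
    Set.disjoint_image_iff hinj]

/-- The dual graph has an edge for each gap inside the Tangle. -/
theorem bijOn_edgeSet (hr : 0 < r) {G : GridLoop} (hG : T.carrier = T.frame '' G.carrier)
    (hc : ∀ k, T.center k = T.frame (2 * (G.px k + G.py k * Complex.I))) :
    Set.BijOn (Sym2.lift ⟨fun p q : T.dualVertices => (p : ℤ × ℤ) + q, fun _ _ => add_comm _ _⟩)
      T.dualGraph.edgeSet ((fun p : ℤ × ℤ => (2 * p.1 + 1, 2 * p.2 + 1)) '' G.innerGaps) := by
  have hblack : ∀ p : T.dualVertices, G.Black p := fun p => (T.isBlack_iff hr hG hc p).1 p.2.1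
  have hodd : ∀ p : T.dualVertices, G.Odd (2 * (p : ℤ × ℤ).1) (2 * (p : ℤ × ℤ).2) := fun p =>
    (T.circleInside_iff hr hG p).1 p.2.2
  refine ⟨?_, ?_, ?_⟩
  · intro e
    induction e using Sym2.ind with
    | _ p q =>
    intro h
    rw [SimpleGraph.mem_edgeSet, T.adj_iff hr hG] at h
    obtain ⟨h1, h2⟩ := h.diagonal G (hblack p) (hblack q)
    have h3 := h.odd G h1 h2 (hodd p)
    obtain ⟨i, hi⟩ : ∃ i, (p : ℤ × ℤ).1 + (q : ℤ × ℤ).1 = 2 * i + 1 := by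
      rcases h1 with h1 | h1
      exacts [⟨(p : ℤ × ℤ).1, by omega⟩, ⟨(p : ℤ × ℤ).1 - 1, by omega⟩]
    obtain ⟨j, hj⟩ : ∃ j, (p : ℤ × ℤ).2 + (q : ℤ × ℤ).2 = 2 * j + 1 := by
      rcases h2 with h2 | h2
      exacts [⟨(p : ℤ × ℤ).2, by omega⟩, ⟨(p : ℤ × ℤ).2 - 1, by omega⟩]
    rw [hi, hj] at h3
    exact ⟨(i, j), h3, Prod.ext hi.symm hj.symm⟩
  · intro e
    induction e using Sym2.ind with
    | _ p q =>
    intro h e'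
    induction e' using Sym2.ind with
    | _ p' q' =>
    intro h' heq
    rw [SimpleGraph.mem_edgeSet, T.adj_iff hr hG] at h h'
    have h1 := h.diagonal G (hblack p) (hblack q)
    have h2 := h'.diagonal G (hblack p') (hblack q')
    have h3 := hblack p
    have h4 := hblack p'
    unfold GridLoop.Black at h3 h4
    have e1 : (p : ℤ × ℤ).1 + (q : ℤ × ℤ).1 = (p' : ℤ × ℤ).1 + (q' : ℤ × ℤ).1 :=
      congrArg Prod.fst heq
    have e2 : (p : ℤ × ℤ).2 + (q : ℤ × ℤ).2 = (p' : ℤ × ℤ).2 + (q' : ℤ × ℤ).2 :=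
      congrArg Prod.snd heq
    -- The sum `p + q` is the midpoint of the gap. Of the two diagonal pairs of circles around it
    -- only one is black, so the midpoint determines the edge.
    have key : ((p : ℤ × ℤ).1 = (p' : ℤ × ℤ).1 ∧ (p : ℤ × ℤ).2 = (p' : ℤ × ℤ).2) ∨
        ((p : ℤ × ℤ).1 = (q' : ℤ × ℤ).1 ∧ (p : ℤ × ℤ).2 = (q' : ℤ × ℤ).2) := by omega
    rw [Sym2.eq_iff]
    rcases key with key | key
    · exact Or.inl ⟨Subtype.ext (Prod.ext key.1 key.2),
        Subtype.ext (Prod.ext (by omega) (by omega))⟩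
    · exact Or.inr ⟨Subtype.ext (Prod.ext key.1 key.2),
        Subtype.ext (Prod.ext (by omega) (by omega))⟩
  · have key : ∀ p q : ℤ × ℤ, G.Black p → G.Black q → (q.1 = p.1 + 1 ∨ q.1 = p.1 - 1) →
        (q.2 = p.2 + 1 ∨ q.2 = p.2 - 1) → G.Odd (p.1 + q.1) (p.2 + q.2) → p + q ∈ Sym2.lift
        ⟨fun p q : T.dualVertices => (p : ℤ × ℤ) + q, fun _ _ => add_comm _ _⟩ ''
        T.dualGraph.edgeSet := by
      intro p q hp hq h1 h2 hg
      have hpv : p ∈ T.dualVertices := ⟨(T.isBlack_iff hr hG hc p).2 hp,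
        (T.circleInside_iff hr hG p).2 (G.odd_of_odd_gap (g := (p.1 + q.1, p.2 + q.2)) hp
          (by dsimp only; omega) (by dsimp only; omega) hg)⟩
      have hqv : q ∈ T.dualVertices := ⟨(T.isBlack_iff hr hG hc q).2 hq,
        (T.circleInside_iff hr hG q).2 (G.odd_of_odd_gap (g := (p.1 + q.1, p.2 + q.2)) hq
          (by dsimp only; omega) (by dsimp only; omega) hg)⟩
      refine ⟨s(⟨p, hpv⟩, ⟨q, hqv⟩), ?_, rfl⟩
      rw [SimpleGraph.mem_edgeSet, T.adj_iff hr hG]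
      exact G.joined_of_odd_gap hp hq h1 h2 hg
    rintro _ ⟨⟨i, j⟩, hg, rfl⟩
    change G.Odd (2 * i + 1) (2 * j + 1) at hg
    -- The parity of `i + j` decides which of the two diagonals of the gap is the black one.
    by_cases h : 2 ∣ i + j - (G.px G.base + G.py G.base)
    · have := key (i, j) (i + 1, j + 1) h
        (by unfold GridLoop.Black; dsimp only; omega) (Or.inl rfl) (Or.inl rfl)
        (by convert hg using 1 <;> ring)
      convert this using 1
      simp only [Prod.mk_add_mk, Prod.mk.injEq]
      constructor <;> ring
    · have := key (i + 1, j) (i, j + 1)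
        (by unfold GridLoop.Black; dsimp only; omega)
        (by unfold GridLoop.Black; dsimp only; omega) (Or.inr (by dsimp only; ring)) (Or.inl rfl)
        (by convert hg using 1 <;> ring)
      convert this using 1
      simp only [Prod.mk_add_mk, Prod.mk.injEq]
      constructor <;> ring

end Tangle

theorem mainTheorem2 (r : ℝ) (hr : 0 < r) (T : Tangle r) :
    T.dualGraph.edgeSet.Finite ∧
      MeasureTheory.volume T.enclosed =
        ENNReal.ofReal ((4 * (T.size : ℝ) + Real.pi) * r ^ 2) := by
  obtain ⟨G, hG, hc, hsum⟩ := T.exists_gridLoop hr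
  have hbij := T.bijOn_edgeSet hr hG hc
  have hinj : Function.Injective fun p : ℤ × ℤ => (2 * p.1 + 1, 2 * p.2 + 1) := by
    intro p q h
    simp only [Prod.mk.injEq] at h
    exact Prod.ext (by omega) (by omega)
  have hsize : T.size = G.innerGaps.ncard := by
    rw [Tangle.size, ← hbij.injOn.ncard_image, hbij.image_eq,
      Set.ncard_image_of_injective _ hinj]
  refine ⟨Set.Finite.of_finite_image ?_ hbij.injOn, ?_⟩
  · rw [hbij.image_eq]
    exact G.finite_innerGaps.image _
  · rw [T.enclosed_eq hr hG, T.volume_image_frame hr, G.volume_enclosed hsum, hsize,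
      ← ENNReal.ofReal_mul (sq_nonneg r), mul_comm]
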